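/- Let $N,n\ge 0$ be integers and let $\alpha>0$ be real. Let $\mathcal H=\mathbb C[z_1^{\pm1},\dots,z_N^{\pm1}]\otimes(\mathbb C^n)^{\otimes N}$, let $K_{i,j}$ exchange the variables $z_i,z_j$, let $P_{i,j}$ exchange the $i$-th and $j$-th factors $\mathbb C^n$, and put $\mathcal H^{(-)}=\bigcap_{i=1}^{N-1}\mathrm{Ker}(K_{i,i+1}P_{i,i+1}+1)$. The Dunkl operators are $$d_i=\alpha z_i\frac{\partial}{\partial z_i}-i+\sum_{j>i}\frac{z_j}{z_j-z_i}(K_{i,j}-1)-\sum_{j<i}\frac{z_i}{z_i-z_j}(K_{i,j}-1).$$ The Yangian $Y(\mathfrak{gl}_n)$ is the unital associative $\mathbb C$-algebra with generators $T^{(s)}_{a,b}$ ($1\le a,b\le n$, $s\ge1$), $T^{(0)}_{a,b}=\delta_{a,b}$, and relations $$[T^{(r)}_{a,b},T^{(s+1)}_{c,d}]-[T^{(r+1)}_{a,b},T^{(s)}_{c,d}]=T^{(r)}_{c,b}T^{(s)}_{a,d}-T^{(s)}_{c,b}T^{(r)}_{a,d}\qquad(r,s\ge0).$$ Write $T_{a,b}(u)=\sum_{s\ge0}T^{(s)}_{a,b}u^{-s}$.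 It acts on tensor products through the coproduct $\Delta T_{a,b}(u)=\sum_cT_{a,c}(u)\otimes T_{c,b}(u)$. For $p\geq 1$ and $h\in\mathbb C$, $V_p(h)$ is the space of totally antisymmetric tensors in $(\mathbb C^n)^{\otimes p}$ (for $p\le n$ the fundamental $\mathfrak{gl}_n$-module of highest weight $(1^p,0^{n-p})$, and $0$ for $p>n$) with $T_{a,b}(u)$ acting as $\delta_{a,b}+(u+h)^{-1}E_{b,a}$. On $\mathcal H$ let $\hat T^{(s)}_{a,b}$ be the operators given by $$\sum_{a,b}E_{a,b}\otimes\sum_{s\ge0}u^{-s}\hat T^{(s)}_{a,b}=\Bigl(1+\frac{P_{0,1}}{u+d_1}\Bigr)\cdots\Bigl(1+\frac{P_{0,N}}{u+d_N}\Bigr),$$ where $P_{0,i}$ exchanges an auxiliary copy of $\mathbb C^n$ with the $i$-th factor. Let $\mathbf m=(m_1\ge m_2\ge\dots\ge m_N)\in\mathbb Z^N$. Let $S^{\mathbf m}\subset\mathfrak S_N$ be the set of $\sigma$ with $\sigma(i)=\#\{j\le i: m_{\sigma(j)}\ge m_{\sigma(i)}\}+\#\{j>i: m_{\sigma(j)}>m_{\sigma(i)}\}$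 for all $i$; put $\xi_i^{\mathbf m}(\sigma)=\alpha m_{\sigma(i)}-\sigma(i)$. For $\sigma\in S^{\mathbf m}$ the non-symmetric Jack polynomial $\Phi^{\mathbf m}_\sigma$ is the Laurent polynomial with $d_i\Phi^{\mathbf m}_\sigma=\xi^{\mathbf m}_i(\sigma)\Phi^{\mathbf m}_\sigma$ for all $i$ which equals $z_1^{m_{\sigma(1)}}\cdots z_N^{m_{\sigma(N)}}$ plus a linear combination of monomials $z_1^{m'_{\sigma'(1)}}\cdots z_N^{m'_{\sigma'(N)}}$ with $\mathbf m'$ weakly decreasing, $\sigma'\in S^{\mathbf m'}$ and $(\mathbf m',\sigma')<(\mathbf m,\sigma)$; here $(\mathbf m',\sigma')<(\mathbf m,\sigma)$ means that either $\mathbf m'<\mathbf m$ in the dominance order, or $\mathbf m'=\mathbf m$ and the last non-zero entry of $(m_{\sigma(i)}-m_{\sigma'(i)})_{i}$ is negative. Define $\check{\mathbb R}^{(-)}(\sigma)\in\mathrm{End}((\mathbb C^n)^{\otimes N})$ for $\sigma\in S^{\mathbf m}$ by $\check{\mathbb R}^{(-)}(\mathrm{id})=1$ and, whenever $m_{\sigma(i)}>m_{\sigma(i+1)}$,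 $$\check{\mathbb R}^{(-)}(\sigma(i,i+1))=-\bigl((\xi^{\mathbf m}_i(\sigma)-\xi^{\mathbf m}_{i+1}(\sigma))^{-1}+P_{i,i+1}\bigr)\check{\mathbb R}^{(-)}(\sigma).$$ Put $E^{\mathbf m}=\mathrm{span}\{\Phi^{\mathbf m}_\sigma:\sigma\in S^{\mathbf m}\}$, $F^{\mathbf m}=(E^{\mathbf m}\otimes(\mathbb C^n)^{\otimes N})\cap\mathcal H^{(-)}$, $W^{\mathbf m}_{(-)}=\bigcap_{i:\,m_i=m_{i+1}}\mathrm{Ker}(P_{i,i+1}+1)\subset(\mathbb C^n)^{\otimes N}$ and $$U^{\mathbf m}_{(-)}v=\sum_{\sigma\in S^{\mathbf m}}\Phi^{\mathbf m}_\sigma\otimes\check{\mathbb R}^{(-)}(\sigma)v .$$ Let $p_1,\dots,p_M$ be the multiplicities of the $M$ distinct values of $\mathbf m$, taken in decreasing order of the values, and $h^{(s)}=\xi^{\mathbf m}_{1+p_1+\dots+p_{s-1}}(\mathrm{id})$. **Theorem.** For every weakly decreasing $\mathbf m\in\mathbb Z^N$ the polynomials $\Phi^{\mathbf m}_\sigma$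 and the operators $\check{\mathbb R}^{(-)}(\sigma)$, $\sigma\in S^{\mathbf m}$, exist and are uniquely determined by the above, and $U^{\mathbf m}_{(-)}$ maps $W^{\mathbf m}_{(-)}$ into $F^{\mathbf m}$. The space $F^{\mathbf m}$ is invariant under all $\hat T^{(s)}_{a,b}$, and $T^{(s)}_{a,b}\mapsto\hat T^{(s)}_{a,b}|_{F^{\mathbf m}}$ makes it a $Y(\mathfrak{gl}_n)$-module. Concatenation of tensors identifies $V_{p_1}(h^{(1)})\otimes\dots\otimes V_{p_M}(h^{(M)})$ with $W^{\mathbf m}_{(-)}$, which is thereby a $Y(\mathfrak{gl}_n)$-module, and $U^{\mathbf m}_{(-)}:W^{\mathbf m}_{(-)}\to F^{\mathbf m}$ is an isomorphism of $Y(\mathfrak{gl}_n)$-modules. -/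

import Mathlib

open scoped TensorProduct

namespace SpinCS

noncomputable section

/-! ### The Yangian of `gl_n` -/

section YangianDef

/-- The free-algebra symbol `T_{a,b}^{(s)}`: a free generator for `s ≥ 1`, and `δ_{a,b}` for `s = 0`. -/
def freeT (n : ℕ) (a b : Fin n) : ℕ → FreeAlgebra ℂ (Fin n × Fin n × ℕ)
  | 0 => if a = b then 1 else 0
  | s + 1 => FreeAlgebra.ι ℂ (a, b, s)

/-- The defining relations of the Yangian `Y(gl_n)`:
`[T_{ab}^{(r)}, T_{cd}^{(s+1)}] - [T_{ab}^{(r+1)}, T_{cd}^{(s)}]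
  = T_{cb}^{(r)} T_{ad}^{(s)} - T_{cb}^{(s)} T_{ad}^{(r)}`, for `r, s ≥ 0`. -/
inductive YangianRel (n : ℕ) :
    FreeAlgebra ℂ (Fin n × Fin n × ℕ) → FreeAlgebra ℂ (Fin n × Fin n × ℕ) → Prop
  | rel (a b c d : Fin n) (r s : ℕ) : YangianRel n
      ((freeT n a b r * freeT n c d (s + 1) - freeT n c d (s + 1) * freeT n a b r)
        - (freeT n a b (r + 1) * freeT n c d s - freeT n c d s * freeT n a b (r + 1)))
      (freeT n c b r * freeT n a d s - freeT n c b s * freeT n a d r)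

/-- The Yangian `Y(gl_n)`, as a unital associative complex algebra given by generators and relations.
A `Y(gl_n)`-module structure on `V` is an algebra homomorphism `Yangian n →ₐ[ℂ] Module.End ℂ V`. -/
abbrev Yangian (n : ℕ) : Type := RingQuot (YangianRel n)

/-- The elements `T_{a,b}^{(s)}` of the Yangian. -/
def yT {n : ℕ} (a b : Fin n) (s : ℕ) : Yangian n :=
  RingQuot.mkAlgHom ℂ (YangianRel n) (freeT n a b s)

variable {n : ℕ} {A : Type*} [Semiring A] [Algebra ℂ A]

/-- A matrix `T_{a,b}(u) = ∑_s T_{a,b}^{(s)} u^{-s}` of power series in `u^{-1}` satisfies the defining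
relations of `Y(gl_n)` (written without subtraction). -/
structure IsYangianSeries (T : Matrix (Fin n) (Fin n) (PowerSeries A)) : Prop where
  coeff_zero : ∀ a b, PowerSeries.coeff 0 (T a b) = if a = b then 1 else 0
  rel_add : ∀ a b c d r s,
    PowerSeries.coeff r (T a b) * PowerSeries.coeff (s + 1) (T c d)
        + PowerSeries.coeff s (T c d) * PowerSeries.coeff (r + 1) (T a b)
        + PowerSeries.coeff s (T c b) * PowerSeries.coeff r (T a d)
    = PowerSeries.coeff (s + 1) (T c d) * PowerSeries.coeff r (T a b)
        + PowerSeries.coeff (r + 1) (T a b) * PowerSeries.coeff s (T c d)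
        + PowerSeries.coeff r (T c b) * PowerSeries.coeff s (T a d)

theorem isYangianSeries_iff_sub {A : Type*} [Ring A]
    {T : Matrix (Fin n) (Fin n) (PowerSeries A)} : IsYangianSeries T ↔
    (∀ a b, PowerSeries.coeff 0 (T a b) = if a = b then 1 else 0) ∧
    ∀ a b c d r s,
      (PowerSeries.coeff r (T a b) * PowerSeries.coeff (s + 1) (T c d)
          - PowerSeries.coeff (s + 1) (T c d) * PowerSeries.coeff r (T a b))
        - (PowerSeries.coeff (r + 1) (T a b) * PowerSeries.coeff s (T c d)
          - PowerSeries.coeff s (T c d) * PowerSeries.coeff (r + 1) (T a b))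
      = PowerSeries.coeff r (T c b) * PowerSeries.coeff s (T a d)
          - PowerSeries.coeff s (T c b) * PowerSeries.coeff r (T a d) := by
  constructor
  · intro h
    refine ⟨h.1, fun a b c d r s => ?_⟩
    have := h.2 a b c d r s
    rw [← sub_eq_zero] at this ⊢
    rw [← this]
    abel
  · intro h
    refine ⟨h.1, fun a b c d r s => ?_⟩
    have := h.2 a b c d r s
    rw [← sub_eq_zero] at this ⊢
    rw [← this]
    abel

/-- The value on free generators of the homomorphism attached to a matrix of series. -/
def freeLift (T : Matrix (Fin n) (Fin n) (PowerSeries A)) :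
    FreeAlgebra ℂ (Fin n × Fin n × ℕ) →ₐ[ℂ] A :=
  FreeAlgebra.lift ℂ fun p => PowerSeries.coeff (p.2.2 + 1) (T p.1 p.2.1)

theorem freeLift_freeT {T : Matrix (Fin n) (Fin n) (PowerSeries A)} (hT : IsYangianSeries T)
    (a b : Fin n) (s : ℕ) : freeLift T (freeT n a b s) = PowerSeries.coeff s (T a b) := by
  cases s with
  | zero => rw [hT.coeff_zero]; simp only [freeT]; split_ifs <;> simp
  | succ s => simp [freeT, freeLift]

/-- A matrix of series satisfying the relations defines a homomorphism from the Yangian. -/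
def yangianLift (T : Matrix (Fin n) (Fin n) (PowerSeries A)) (hT : IsYangianSeries T) :
    Yangian n →ₐ[ℂ] A :=
  RingQuot.liftAlgHom ℂ ⟨freeLift T, by
    let _ : Ring A := Algebra.semiringToRing ℂ
    rintro _ _ ⟨a, b, c, d, r, s⟩
    simp only [map_sub, map_mul, freeLift_freeT hT]
    exact (isYangianSeries_iff_sub.1 hT).2 a b c d r s⟩

theorem yangianLift_yT (T : Matrix (Fin n) (Fin n) (PowerSeries A)) (hT : IsYangianSeries T)
    (a b : Fin n) (s : ℕ) : yangianLift T hT (yT a b s) = PowerSeries.coeff s (T a b) := by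
  simp [yangianLift, yT, freeLift_freeT hT]

/-- The matrix of series `∑_s φ(T_{a,b}^{(s)}) u^{-s}` of a homomorphism from the Yangian. -/
def seriesOf (φ : Yangian n →ₐ[ℂ] A) : Matrix (Fin n) (Fin n) (PowerSeries A) :=
  Matrix.of fun a b => PowerSeries.mk fun s => φ (yT a b s)

theorem isYangianSeries_seriesOf (φ : Yangian n →ₐ[ℂ] A) : IsYangianSeries (seriesOf φ) := by
  let _ : Ring A := Algebra.semiringToRing ℂ
  refine isYangianSeries_iff_sub.2 ⟨fun a b => ?_, fun a b c d r s => ?_⟩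
  · simp only [seriesOf, Matrix.of_apply, PowerSeries.coeff_mk, yT, freeT]
    split_ifs <;> simp
  · have h := congrArg φ (RingQuot.mkAlgHom_rel ℂ (YangianRel.rel a b c d r s))
    simpa [seriesOf, yT] using h

end YangianDef

/-! ### Products of commuting solutions of the Yangian relations -/

section YangianMul

variable {n : ℕ} {A : Type*} [Ring A]

open PowerSeries in
theorem isYangianSeries_iff (T : Matrix (Fin n) (Fin n) (PowerSeries A))
    (h0 : ∀ a b, coeff 0 (T a b) = if a = b then (1 : A) else 0) :
    IsYangianSeries T ↔ ∀ a b c d,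
      ((X : PowerSeries (PowerSeries A)) - C X)
        * (C (T a b) * map C (T c d) - map C (T c d) * C (T a b))
      = X * (C X * (map C (T c b) * C (T a d) - C (T c b) * map C (T a d))) := by
  constructor
  · intro h a b c d
    ext s r
    rcases s with _ | s <;> rcases r with _ | r
    · simp [sub_mul, coeff_zero_X_mul]
    · have := h0 c d
      simp only [sub_mul, map_sub, coeff_zero_X_mul, coeff_C_mul, coeff_succ_X_mul, coeff_mul_C,
        coeff_map, this]
      split_ifs <;> simp
    · have := h0 a b
      simp only [sub_mul, map_sub, coeff_zero_X_mul, coeff_C_mul, coeff_succ_X_mul, coeff_mul_C,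
        coeff_map, this]
      split_ifs <;> simp
    · have := (isYangianSeries_iff_sub.1 h).2 a b c d r s
      simp only [sub_mul, map_sub, coeff_C_mul, coeff_succ_X_mul, coeff_mul_C, coeff_map]
      rw [← sub_eq_zero] at this ⊢
      rw [← neg_eq_zero, ← this]
      abel
  · intro h
    refine isYangianSeries_iff_sub.2 ⟨h0, fun a b c d r s => ?_⟩
    have := congrArg (fun f => coeff (r + 1) (coeff (s + 1) f)) (h a b c d)
    simp only [sub_mul, map_sub, coeff_C_mul, coeff_succ_X_mul, coeff_mul_C, coeff_map] at this
    rw [← sub_eq_zero] at this ⊢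
    rw [← neg_eq_zero, ← this]
    abel

open PowerSeries in
theorem IsYangianSeries.one : IsYangianSeries (1 : Matrix (Fin n) (Fin n) (PowerSeries A)) := by
  have key : ∀ (a b : Fin n) (r : ℕ), coeff r ((1 : Matrix (Fin n) (Fin n) (PowerSeries A)) a b)
      = if r = 0 then (if a = b then 1 else 0) else 0 := by
    intro a b r
    rw [Matrix.one_apply]
    split_ifs <;> simp_all [coeff_one]
  refine ⟨fun a b => by simp [key], fun a b c d r s => ?_⟩
  simp only [key]
  split_ifs <;> simp_all

theorem rtt_mul {n : ℕ} {B : Type*} [Ring B] (x y : B) (hx : ∀ f, x * f = f * x)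
    (hy : ∀ f, y * f = f * y) (a a' b b' : Fin n → Fin n → B)
    (hA : ∀ i j k l, x * (a i j * a' k l - a' k l * a i j)
      = y * (a' k j * a i l - a k j * a' i l))
    (hB : ∀ i j k l, x * (b i j * b' k l - b' k l * b i j)
      = y * (b' k j * b i l - b k j * b' i l))
    (h1 : ∀ i j k l, Commute (b i j) (a' k l)) (h2 : ∀ i j k l, Commute (b' i j) (a k l))
    (i j u v : Fin n) :
    x * ((∑ k, a i k * b k j) * (∑ l, a' u l * b' l v)
        - (∑ l, a' u l * b' l v) * (∑ k, a i k * b k j))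
      = y * ((∑ k, a' u k * b' k j) * (∑ l, a i l * b l v)
        - (∑ k, a u k * b k j) * (∑ l, a' i l * b' l v)) := by
  have e1 : ∀ i j u v, (∑ k, a i k * b k j) * (∑ l, a' u l * b' l v)
      = ∑ k, ∑ l, a i k * a' u l * (b k j * b' l v) := by
    intro i j u v
    rw [Finset.sum_mul_sum]
    refine Finset.sum_congr rfl fun k _ => Finset.sum_congr rfl fun l _ => ?_
    rw [mul_assoc, ← mul_assoc (b k j), (h1 k j u l).eq, mul_assoc, mul_assoc]
  have e2 : ∀ i j u v, (∑ k, a' i k * b' k j) * (∑ l, a u l * b l v)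
      = ∑ k, ∑ l, a' i k * a u l * (b' k j * b l v) := by
    intro i j u v
    rw [Finset.sum_mul_sum]
    refine Finset.sum_congr rfl fun k _ => Finset.sum_congr rfl fun l _ => ?_
    rw [mul_assoc, ← mul_assoc (b' k j), (h2 k j u l).eq, mul_assoc, mul_assoc]
  have e3 : ∑ k, ∑ l, a' u l * a i k * (b l j * b' k v)
      = ∑ k, ∑ l, a' u k * a i l * (b k j * b' l v) := Finset.sum_comm
  have e4 : ∑ k, ∑ l, a' u k * a i l * (b' k v * b l j)
      = ∑ k, ∑ l, a' u l * a i k * (b' l v * b k j) := Finset.sum_comm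
  have e5 : ∑ k, ∑ l, a' u k * a i l * (b' k j * b l v)
      = ∑ k, ∑ l, a' u l * a i k * (b' l j * b k v) := Finset.sum_comm
  rw [e1, e2, e2, e1, e4, e5]
  have key : ∀ k l, x * (a i k * a' u l * (b k j * b' l v) - a' u l * a i k * (b' l v * b k j))
      = y * (a' u k * a i l * (b k j * b' l v)) - y * (a u k * a' i l * (b k j * b' l v))
        + (y * (a' u l * a i k * (b' l j * b k v)) - y * (a' u l * a i k * (b l j * b' k v))) := by
    intro k l
    have hA' := hA i k u l
    have hB' := hB k j l v
    calc _ = x * (a i k * a' u l - a' u l * a i k) * (b k j * b' l v)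
          + a' u l * a i k * (x * (b k j * b' l v - b' l v * b k j)) := by
          rw [← mul_assoc (a' u l * a i k) x, ← hx]; noncomm_ring
      _ = _ := by
          rw [hA', hB', ← mul_assoc (a' u l * a i k) y, ← hy]; noncomm_ring
  rw [← Finset.sum_sub_distrib, Finset.mul_sum]
  simp_rw [← Finset.sum_sub_distrib, Finset.mul_sum, key]
  simp only [Finset.sum_add_distrib, Finset.sum_sub_distrib, ← Finset.mul_sum, mul_sub]
  rw [e3]
  abel

open PowerSeries in
theorem IsYangianSeries.mul {T S : Matrix (Fin n) (Fin n) (PowerSeries A)}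
    (hT : IsYangianSeries T) (hS : IsYangianSeries S)
    (hc : ∀ a b c d r s, Commute (coeff r (T a b)) (coeff s (S c d))) :
    IsYangianSeries (T * S) := by
  have h0 : ∀ a b, coeff 0 ((T * S) a b) = if a = b then (1 : A) else 0 := by
    intro a b
    have : ∀ k, coeff 0 (T a k * S k b)
        = (1 : Matrix (Fin n) (Fin n) A) a k * (1 : Matrix (Fin n) (Fin n) A) k b := by
      intro k
      rw [coeff_mul]
      simp [hT.coeff_zero, hS.coeff_zero, Matrix.one_apply]
    rw [Matrix.mul_apply, map_sum, Finset.sum_congr rfl fun k _ => this k, ← Matrix.mul_apply]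
    simp [Matrix.one_apply]
  rw [isYangianSeries_iff _ h0]
  rw [isYangianSeries_iff _ hT.coeff_zero] at hT
  rw [isYangianSeries_iff _ hS.coeff_zero] at hS
  intro a b c d
  have hX : ∀ f : PowerSeries (PowerSeries A), X * f = f * X := fun f => (commute_X f).eq.symm
  have hCX : ∀ f : PowerSeries (PowerSeries A), C X * f = f * C X := by
    intro f
    ext s : 1
    simp only [coeff_C_mul, coeff_mul_C]
    exact (commute_X _).eq.symm
  have hcc : ∀ (a b c d : Fin n) (r s : ℕ), Commute (coeff s (S c d)) (coeff r (T a b)) :=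
    fun a b c d r s => (hc a b c d r s).symm
  have := rtt_mul (X - C X : PowerSeries (PowerSeries A)) (X * C X)
    (fun f => by rw [sub_mul, mul_sub, hX, hCX]) (fun f => by rw [mul_assoc, hCX, ← mul_assoc, hX,
      mul_assoc]) (fun a b => C (T a b)) (fun a b => map C (T a b))
    (fun a b => C (S a b)) (fun a b => map C (S a b))
    (fun i j k l => by simpa only [mul_assoc] using hT i j k l)
    (fun i j k l => by simpa only [mul_assoc] using hS i j k l)
    (fun i j k l => by
      rw [commute_iff_eq]
      ext s r
      simpa only [coeff_C_mul, coeff_mul_C, coeff_map] using (hcc k l i j s r).eq)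
    (fun i j k l => by
      rw [commute_iff_eq]
      ext s r
      simpa only [coeff_C_mul, coeff_mul_C, coeff_map] using (hcc k l i j r s).eq) a b c d
  simpa only [Matrix.mul_apply, map_sum, map_mul, mul_assoc] using this

end YangianMul

section YangianProd

variable {n : ℕ} {A : Type*} [Semiring A]

theorem commute_coeff_matrix_mul {T S R : Matrix (Fin n) (Fin n) (PowerSeries A)}
    (hS : ∀ a b c d r s, Commute (PowerSeries.coeff r (T a b)) (PowerSeries.coeff s (S c d)))
    (hR : ∀ a b c d r s, Commute (PowerSeries.coeff r (T a b)) (PowerSeries.coeff s (R c d)))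
    (a b c d : Fin n) (r s : ℕ) :
    Commute (PowerSeries.coeff r (T a b)) (PowerSeries.coeff s ((S * R) c d)) := by
  rw [Matrix.mul_apply, map_sum]
  refine Commute.sum_right _ _ _ fun k _ => ?_
  rw [PowerSeries.coeff_mul]
  exact Commute.sum_right _ _ _ fun p _ => (hS _ _ _ _ _ _).mul_right (hR _ _ _ _ _ _)

theorem IsYangianSeries.list_prod [Algebra ℂ A] (l : List (Matrix (Fin n) (Fin n) (PowerSeries A)))
    (hl : ∀ T ∈ l, IsYangianSeries T)
    (hc : l.Pairwise fun T S => ∀ a b c d r s,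
      Commute (PowerSeries.coeff r (T a b)) (PowerSeries.coeff s (S c d))) :
    IsYangianSeries l.prod := by
  let _ : Ring A := Algebra.semiringToRing ℂ
  induction l with
  | nil => exact IsYangianSeries.one
  | cons T l ih =>
    rw [List.pairwise_cons] at hc
    rw [List.prod_cons]
    refine (hl T (by simp)).mul (ih (fun S hS => hl S (by simp [hS])) hc.2) ?_
    have h := hc.1
    clear hc ih hl
    induction l with
    | nil =>
      intro a b c d r s
      rw [List.prod_nil, Matrix.one_apply]
      split_ifs
      · rw [PowerSeries.coeff_one]
        split_ifs <;> simp
      · simp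
    | cons S l ih =>
      rw [List.prod_cons]
      exact commute_coeff_matrix_mul (h S (by simp)) (ih fun S' hS' => h S' (by simp [hS']))

/-- The matrix of series `δ_{a,b} + e_{b,a} / (u + x)`, expanded in powers of `u^{-1}`, that is
`∑_{a,b} E_{a,b} ⊗ (δ_{a,b} + (u + x)^{-1} e_{b,a})`. When `e_{b,a}` is the matrix unit acting in one
tensor factor `ℂ^n`, this is `1 + P / (u + x)` with `P = ∑_{a,b} E_{a,b} ⊗ E_{b,a}` the permutation of
the auxiliary copy of `ℂ^n` with that factor. -/
def lax [Algebra ℂ A] (x : A) (e : Fin n → Fin n → A) : Matrix (Fin n) (Fin n) (PowerSeries A) :=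
  Matrix.of fun a b => PowerSeries.mk fun s =>
    match s with
    | 0 => if a = b then 1 else 0
    | s + 1 => (-1 : ℂ) ^ s • (x ^ s * e b a)

theorem isYangianSeries_lax [Algebra ℂ A] (x : A) (e : Fin n → Fin n → A) (hx : ∀ a b, Commute x (e a b))
    (he : ∀ a b c d, e a b * e c d + (if d = a then e c b else 0)
      = e c d * e a b + (if b = c then e a d else 0)) :
    IsYangianSeries (lax x e) := by
  let _ : Ring A := Algebra.semiringToRing ℂ
  have he : ∀ a b c d, e a b * e c d - e c d * e a b
      = (if b = c then e a d else 0) - (if d = a then e c b else 0) := by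
    intro a b c d
    rw [sub_eq_sub_iff_add_eq_add, he, add_comm]
  have hs : ∀ s a b, (-1 : ℂ) ^ s • (x ^ s * e a b) = (-x) ^ s * e a b := by
    intro s a b
    rw [neg_pow x, mul_assoc]
    rcases s.even_or_odd with h' | h' <;> simp [h'.neg_one_pow]
  refine isYangianSeries_iff_sub.2 ⟨fun a b => by simp [lax], fun a b c d r s => ?_⟩
  ·
    have hp : ∀ k a b, e a b * (-x) ^ k = (-x) ^ k * e a b := fun k a b =>
      ((hx a b).neg_left.pow_left k).eq.symm
    have hm : ∀ k l a b c d, (-x) ^ k * e a b * ((-x) ^ l * e c d)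
        = (-x) ^ (k + l) * (e a b * e c d) := by
      intro k l a b c d
      rw [mul_assoc, ← mul_assoc (e a b), hp, pow_add]
      simp only [mul_assoc]
    have he' : ∀ k a b c d, (-x) ^ k * (e a b * e c d) - (-x) ^ k * (e c d * e a b)
      = (-x) ^ k * ((if b = c then e a d else 0) - (if d = a then e c b else 0)) := by
      intro k a b c d
      rw [← mul_sub, he]
    simp only [lax, Matrix.of_apply, PowerSeries.coeff_mk, hs]
    rcases r with _ | r <;> rcases s with _ | s
    · simp only []
      split_ifs <;> simp
    · simp only [hm]
      rw [zero_add, add_comm s 0, zero_add, he']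
      simp only [eq_comm (a := c) (b := b)]
      split_ifs <;> simp [mul_sub]
    · simp only [hm]
      rw [add_zero, zero_add, he']
      simp only [eq_comm (a := c) (b := b)]
      split_ifs <;> simp [mul_sub]
    · simp only [hm]
      rw [add_comm (s + 1) r, add_comm s (r + 1), add_comm s r, he', he']
      rw [show r + 1 + s = r + (s + 1) by ring]
      simp

end YangianProd

/-! ### Operators in tensor products and the tensor product of Yangian modules -/

section Tensor

section Site

variable {ι : Type*} [DecidableEq ι] {V : ι → Type*} [∀ i, AddCommMonoid (V i)]
  [∀ i, Module ℂ (V i)]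

theorem map_update_id_tprod (i : ι) (f : Module.End ℂ (V i)) (v : ∀ i, V i) :
    PiTensorProduct.map (Function.update (fun _ => LinearMap.id) i f) (PiTensorProduct.tprod ℂ v)
      = PiTensorProduct.tprod ℂ (Function.update v i (f (v i))) := by
  rw [PiTensorProduct.map_tprod]
  congr 1
  funext j
  by_cases h : j = i
  · subst h; simp
  · simp [h]

/-- The operator `f` acting in the `i`-th factor of `⨂ V_i`, trivially in the others. -/
def siteOp (i : ι) : Module.End ℂ (V i) →ₐ[ℂ] Module.End ℂ (⨂[ℂ] i, V i) where
  toFun f := PiTensorProduct.map (Function.update (fun _ => LinearMap.id) i f)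
  map_one' := by ext v; simp only [LinearMap.compMultilinearMap_apply, map_update_id_tprod]; simp
  map_mul' f g := by
    ext v
    simp only [LinearMap.compMultilinearMap_apply, Module.End.mul_apply, map_update_id_tprod]
    simp
  map_zero' := by
    ext v
    simp only [LinearMap.compMultilinearMap_apply, map_update_id_tprod]
    rw [LinearMap.zero_apply, MultilinearMap.map_update_zero]
    simp
  map_add' f g := PiTensorProduct.map_update_add _ _ _ _
  commutes' c := by
    ext v
    simp only [LinearMap.compMultilinearMap_apply, map_update_id_tprod]
    simp [Module.algebraMap_end_apply]

theorem siteOp_tprod (i : ι) (f : Module.End ℂ (V i)) (v : ∀ i, V i) :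
    siteOp i f (PiTensorProduct.tprod ℂ v)
      = PiTensorProduct.tprod ℂ (Function.update v i (f (v i))) :=
  map_update_id_tprod i f v

theorem siteOp_commute {i j : ι} (h : i ≠ j) (f : Module.End ℂ (V i)) (g : Module.End ℂ (V j)) :
    Commute (siteOp (V := V) i f) (siteOp j g) := by
  rw [commute_iff_eq]
  ext v
  simp only [LinearMap.compMultilinearMap_apply, Module.End.mul_apply, siteOp_tprod]
  rw [Function.update_of_ne h, Function.update_of_ne h.symm, Function.update_comm h]

end Site

/-- The tensor product `V_1 ⊗ ⋯ ⊗ V_M` of Yangian modules, with the action given by the iterated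
coproduct:
`T_{ab}(u) (v_1 ⊗ ⋯ ⊗ v_M) = ∑ T_{a k_1}(u) v_1 ⊗ T_{k_1 k_2}(u) v_2 ⊗ ⋯ ⊗ T_{k_{M-1} b}(u) v_M`,
the sum over all `k_1, …, k_{M-1}`. -/
def tensorModule {n M : ℕ} {V : Fin M → Type*} [∀ s, AddCommMonoid (V s)] [∀ s, Module ℂ (V s)]
    (ρ : ∀ s, Yangian n →ₐ[ℂ] Module.End ℂ (V s)) :
    Yangian n →ₐ[ℂ] Module.End ℂ (⨂[ℂ] s, V s) :=
  yangianLift (List.ofFn fun s => seriesOf ((siteOp (V := V) s).comp (ρ s))).prod <| by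
    refine IsYangianSeries.list_prod _ ?_ ?_
    · intro T hT
      obtain ⟨s, rfl⟩ := (List.mem_ofFn' _ _).1 hT
      exact isYangianSeries_seriesOf _
    · rw [List.pairwise_ofFn]
      intro i j hij a b c d r s
      simp only [seriesOf, Matrix.of_apply, PowerSeries.coeff_mk, AlgHom.comp_apply]
      exact siteOp_commute hij.ne _ _

end Tensor

/-! ### The spin space and the fundamental evaluation modules `V_p(h)` -/

section Spin

/-- The space `(ℂ^n)^{⊗ N}`. -/
abbrev Spin (n N : ℕ) : Type := ⨂[ℂ] _ : Fin N, (Fin n → ℂ)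

/-- The transposition `P_{i,j}` of the `i`-th and `j`-th tensor factors. -/
def permOp {n N : ℕ} (i j : Fin N) : Module.End ℂ (Spin n N) :=
  (PiTensorProduct.reindex ℂ (fun _ => Fin n → ℂ) (Equiv.swap i j)).toLinearMap

/-- The matrix unit `E_{a,b}` (with `E_{a,b} v_b = v_a`) acting in the `i`-th tensor factor. -/
def unitOp {n N : ℕ} (i : Fin N) (a b : Fin n) : Module.End ℂ (Spin n N) :=
  siteOp i (Matrix.toLin' (Matrix.single a b 1))

/-- The action of `E_{a,b} ∈ gl_n` on the tensor power `(ℂ^n)^{⊗ N}`. -/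
def glOp {n N : ℕ} (a b : Fin n) : Module.End ℂ (Spin n N) := ∑ i, unitOp i a b

/-- The totally antisymmetric tensors, `⋂_i Ker (P_{i,i+1} + 1) ⊂ (ℂ^n)^{⊗ p}`: the space of the
fundamental `gl_n`-module of highest weight `(1, …, 1, 0, …, 0)` (`p` ones). -/
def fundSpace (n p : ℕ) : Submodule ℂ (Spin n p) :=
  ⨅ (i : Fin p) (j : Fin p) (_ : (i : ℕ) + 1 = j), LinearMap.ker (permOp i j + 1)

theorem unitOp_bracket {n N : ℕ} (i : Fin N) (a b c d : Fin n) :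
    unitOp i a b * unitOp i c d + (if d = a then unitOp i c b else 0)
      = unitOp i c d * unitOp i a b + (if b = c then unitOp i a d else 0) := by
  have h : ∀ a b c d : Fin n, (unitOp i a b * unitOp i c d : Module.End ℂ (Spin n N))
      = if b = c then unitOp i a d else 0 := by
    intro a b c d
    rw [unitOp, unitOp, ← map_mul (siteOp i), Module.End.mul_eq_comp, ← Matrix.toLin'_mul]
    split_ifs with h
    · subst h; simp [unitOp]
    · rw [Matrix.single_mul_single_of_ne _ _ _ _ h, map_zero, map_zero]
  rw [h, h, add_comm]

theorem glOp_bracket {n N : ℕ} (a b c d : Fin n) :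
    glOp (N := N) a b * glOp c d + (if d = a then glOp c b else 0)
      = glOp c d * glOp a b + (if b = c then glOp a d else 0) := by
  have h0 : ∀ (P : Prop) [Decidable P] (a b : Fin n), (if P then glOp (N := N) a b else 0)
      = ∑ i, if P then unitOp i a b else 0 := by
    intro P _ a b
    split_ifs <;> simp [glOp]
  have h1 : ∀ a b c d : Fin n, glOp (N := N) a b * glOp c d
      = ∑ i, ∑ j, unitOp i a b * unitOp j c d := fun a b c d => Finset.sum_mul_sum _ _ _ _
  have h2 : glOp (N := N) c d * glOp a b = ∑ i, ∑ j, unitOp j c d * unitOp i a b := by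
    rw [h1, Finset.sum_comm]
  rw [h1, h2, h0, h0, ← Finset.sum_add_distrib, ← Finset.sum_add_distrib]
  refine Finset.sum_congr rfl fun i _ => ?_
  rw [← Finset.sum_erase_add _ _ (Finset.mem_univ i), add_assoc, unitOp_bracket, ← add_assoc,
    ← Finset.sum_erase_add (a := i) (f := fun j => unitOp j c d * unitOp i a b) _
      (Finset.mem_univ i)]
  congr 2
  refine Finset.sum_congr rfl fun j hj => ?_
  exact (siteOp_commute (Finset.ne_of_mem_erase hj).symm _ _).eq

theorem glOp_commute_permOp {n N : ℕ} (a b : Fin n) (i j : Fin N) :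
    Commute (glOp a b) (permOp i j) := by
  have h : ∀ k, unitOp (n := n) k a b * permOp i j = permOp i j * unitOp (Equiv.swap i j k) a b := by
    intro k
    refine PiTensorProduct.ext (MultilinearMap.ext fun v => ?_)
    simp only [LinearMap.compMultilinearMap_apply, Module.End.mul_apply, unitOp, permOp,
      siteOp_tprod, LinearEquiv.coe_coe, PiTensorProduct.reindex_tprod, Equiv.symm_swap]
    congr 1
    funext l
    by_cases hl : l = k
    · subst hl; simp
    · have : Equiv.swap i j l ≠ Equiv.swap i j k := fun h => hl ((Equiv.swap i j).injective h)
      rw [Function.update_of_ne hl, Function.update_of_ne this]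
  rw [commute_iff_eq, glOp, Finset.sum_mul, Finset.mul_sum, Finset.sum_congr rfl fun k _ => h k]
  exact Equiv.sum_comp (Equiv.swap i j) fun k => permOp i j * unitOp k a b

theorem glOp_mem_fundSpace {n p : ℕ} (a b : Fin n) :
    ∀ v ∈ fundSpace n p, glOp a b v ∈ fundSpace n p := by
  intro v hv
  simp only [fundSpace, Submodule.mem_iInf, LinearMap.mem_ker] at hv ⊢
  intro i j hij
  have := ((glOp_commute_permOp a b i j).add_right (Commute.one_right _)).eq
  rw [← Module.End.mul_apply, ← this, Module.End.mul_apply, hv i j hij, map_zero]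

/-- The action of `E_{a,b} ∈ gl_n` on the fundamental module of antisymmetric `p`-tensors. -/
def fundGl (n p : ℕ) (a b : Fin n) : Module.End ℂ (fundSpace n p) :=
  (glOp a b).restrict (glOp_mem_fundSpace a b)

theorem fundGl_bracket (n p : ℕ) (a b c d : Fin n) :
    fundGl n p a b * fundGl n p c d + (if d = a then fundGl n p c b else 0)
      = fundGl n p c d * fundGl n p a b + (if b = c then fundGl n p a d else 0) := by
  apply LinearMap.ext
  intro v
  apply Subtype.ext
  have := LinearMap.congr_fun (glOp_bracket a b c d) (v : Spin n p)
  simp only [fundGl]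
  split_ifs at this ⊢ <;> simpa using this

/-- The Yangian module `V_p(h)`: on the fundamental `gl_n`-module of antisymmetric `p`-tensors,
`T_{a,b}(u)` acts as `δ_{a,b} + E_{b,a} / (u + h)`, i.e. by the pullback through the evaluation
homomorphism `T_{a,b}(u) ↦ δ_{a,b} + E_{b,a} u⁻¹` and the shift `T_{a,b}(u) ↦ T_{a,b}(u + h)`. -/
def fundModule (n p : ℕ) (h : ℂ) : Yangian n →ₐ[ℂ] Module.End ℂ (fundSpace n p) :=
  yangianLift (lax (algebraMap ℂ (Module.End ℂ (fundSpace n p)) h) (fundGl n p))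
    (isYangianSeries_lax _ _ (fun _ _ => Algebra.commute_algebraMap_left _ _) (fundGl_bracket n p))

end Spin

/-! ### Laurent polynomials and the Dunkl operators -/

section Dunkl

/-- The Laurent polynomials `ℂ[z_1^{±1}, …, z_N^{±1}]`. -/
abbrev Laurent (N : ℕ) : Type := AddMonoidAlgebra ℂ (Fin N → ℤ)

/-- The monomial `z_1^{η_1} ⋯ z_N^{η_N}`. -/
def mono {N : ℕ} (η : Fin N → ℤ) : Laurent N := AddMonoidAlgebra.single η 1

/-- The linear operator on Laurent polynomials with prescribed values on monomials. -/
def onMono {N : ℕ} (g : (Fin N → ℤ) → Laurent N) : Module.End ℂ (Laurent N) :=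
  Finsupp.linearCombination ℂ g ∘ₗ (AddMonoidAlgebra.coeffLinearEquiv ℂ).toLinearMap

theorem onMono_mono {N : ℕ} (g : (Fin N → ℤ) → Laurent N) (η : Fin N → ℤ) :
    onMono g (mono η) = g η := by
  simp [onMono, mono]

/-- The operator `K_{i,j}` exchanging the variables `z_i` and `z_j`. -/
def exchOp {N : ℕ} (i j : Fin N) : Module.End ℂ (Laurent N) :=
  onMono fun η => mono (η ∘ Equiv.swap i j)

/-- The Euler operator `z_i ∂/∂z_i`. -/
def eulerOp {N : ℕ} (i : Fin N) : Module.End ℂ (Laurent N) :=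
  onMono fun η => (η i : ℂ) • mono η

/-- The operator `z_j / (z_j - z_i) * (K_{i,j} - 1)` for `i ≠ j`, with the division carried out on
monomials; see `sub_mul_quotOp`. -/
def quotOp {N : ℕ} (i j : Fin N) : Module.End ℂ (Laurent N) :=
  onMono fun η =>
    ∑ c ∈ Finset.Ico (η j) (η i),
        mono (Function.update (Function.update η i c) j (η i + η j - c))
      - ∑ c ∈ Finset.Ico (η i) (η j),
        mono (Function.update (Function.update η i c) j (η i + η j - c))

theorem sum_Ico_telescope {G : Type*} [AddCommGroup G] (g : ℤ → G) (b : ℤ) (k : ℕ) :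
    ∑ c ∈ Finset.Ico b (b + k), (g c - g (c + 1)) = g b - g (b + k) := by
  induction k with
  | zero => simp
  | succ k ih =>
    have : Finset.Ico b (b + (k + 1 : ℕ)) = insert (b + k) (Finset.Ico b (b + k)) := by
      ext x; simp; omega
    rw [this, Finset.sum_insert (by simp), ih]
    push_cast
    rw [add_assoc]
    abel

theorem onMono_ext {N : ℕ} {M : Type*} [AddCommMonoid M] [Module ℂ M]
    {f g : Laurent N →ₗ[ℂ] M} (h : ∀ η, f (mono η) = g (mono η)) : f = g :=
  AddMonoidAlgebra.lhom_ext' fun η => LinearMap.ext_ring (h η)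

theorem sub_mul_quotOp {N : ℕ} {i j : Fin N} (hij : i ≠ j) (f : Laurent N) :
    (mono (Pi.single j 1) - mono (Pi.single i 1)) * quotOp i j f
      = mono (Pi.single j 1) * (exchOp i j f - f) := by
  have hmul : ∀ η θ : Fin N → ℤ, mono η * mono θ = mono (η + θ) := by
    intro η θ
    simp [mono, AddMonoidAlgebra.single_mul_single]
  suffices h : (LinearMap.mulLeft ℂ (mono (Pi.single j 1) - mono (Pi.single i 1))) ∘ₗ quotOp i j
      = (LinearMap.mulLeft ℂ (mono (Pi.single j 1))) ∘ₗ (exchOp i j - LinearMap.id) from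
    LinearMap.congr_fun h f
  refine onMono_ext fun η => ?_
  simp only [LinearMap.comp_apply, LinearMap.mulLeft_apply, LinearMap.sub_apply, LinearMap.id_apply,
    quotOp, exchOp, onMono_mono]
  set w : ℤ → ℤ → Laurent N := fun c d => mono (Function.update (Function.update η i c) j d) with hw
  have hj : ∀ c d, mono (Pi.single j 1) * w c d = w c (d + 1) := by
    intro c d
    simp only [hw, hmul]
    congr 1
    funext l
    by_cases h1 : l = j
    · subst h1; simp [add_comm]
    · simp [h1]
  have hi : ∀ c d, mono (Pi.single i 1) * w c d = w (c + 1) d := by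
    intro c d
    simp only [hw, hmul]
    congr 1
    funext l
    by_cases h1 : l = j
    · subst h1; simp [hij.symm]
    · by_cases h2 : l = i
      · subst h2; simp [h1, add_comm]
      · simp [h1, h2]
  have h0 : mono η = w (η i) (η j) := by simp [hw]
  have h1 : mono (η ∘ Equiv.swap i j) = w (η j) (η i) := by
    simp only [hw]
    congr 1
    funext l
    by_cases h1 : l = j
    · subst h1; simp
    · by_cases h2 : l = i
      · subst h2; simp [h1]
      · simp [h1, h2, Equiv.swap_apply_of_ne_of_ne]
  have hs : ∀ c, (mono (Pi.single j 1) - mono (Pi.single i 1)) * w c (η i + η j - c)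
      = (fun c => w c (η i + η j - c + 1)) c - (fun c => w c (η i + η j - c + 1)) (c + 1) := by
    intro c
    rw [sub_mul, hj, hi]
    simp only
    congr 2
    ring
  change (mono (Pi.single j 1) - mono (Pi.single i 1))
    * (∑ c ∈ Finset.Ico (η j) (η i), w c (η i + η j - c)
      - ∑ c ∈ Finset.Ico (η i) (η j), w c (η i + η j - c)) = _
  rw [h1, h0, mul_sub, mul_sub (mono (Pi.single j 1)), hj, hj, Finset.mul_sum, Finset.mul_sum,
    Finset.sum_congr rfl fun c _ => hs c, Finset.sum_congr rfl fun c _ => hs c]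
  rcases le_total (η j) (η i) with h | h
  · obtain ⟨k, hk⟩ := Int.le.dest h
    rw [Finset.Ico_eq_empty_of_le h, Finset.sum_empty, sub_zero, ← hk, sum_Ico_telescope]
    congr 2 <;> ring
  · obtain ⟨k, hk⟩ := Int.le.dest h
    rw [Finset.Ico_eq_empty_of_le h, Finset.sum_empty, zero_sub, ← hk, sum_Ico_telescope, neg_sub]
    congr 2 <;> ring

/-- The Dunkl operators
`d_i = α z_i ∂/∂z_i - i + ∑_{j > i} z_j / (z_j - z_i) (K_{i,j} - 1)
  - ∑_{j < i} z_i / (z_i - z_j) (K_{i,j} - 1)`. The index `i = 1, …, N` is `(i : ℕ) + 1` below, and the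
operator in the last sum is `quotOp j i`. -/
def dunkl {N : ℕ} (α : ℝ) (i : Fin N) : Module.End ℂ (Laurent N) :=
  (α : ℂ) • eulerOp i - ((i : ℕ) + 1 : ℂ) • LinearMap.id
    + ∑ j with i < j, quotOp i j - ∑ j with j < i, quotOp j i

end Dunkl

/-! ### Non-symmetric Jack polynomials -/

section Jack

variable {N : ℕ}

/-- The set `S^m` of permutations: `σ ∈ S^m` iff, for all `i`,
`σ(i) = #{j ≤ i | m_{σ(j)} ≥ m_{σ(i)}} + #{j > i | m_{σ(j)} > m_{σ(i)}}` (indices from `1` to `N`). -/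
def permSet (m : Fin N → ℤ) : Finset (Equiv.Perm (Fin N)) :=
  {σ | ∀ i, (σ i : ℕ) + 1 = Finset.card {j | j ≤ i ∧ m (σ i) ≤ m (σ j)}
    + Finset.card {j | i < j ∧ m (σ i) < m (σ j)}}

/-- The dominance order: `m' < m`. -/
def DominanceLT (m' m : Fin N → ℤ) : Prop :=
  m' ≠ m ∧ ∑ i, m' i = ∑ i, m i ∧ ∀ k, ∑ i with i ≤ k, m' i ≤ ∑ i with i ≤ k, m i

/-- `(m', σ') < (m, σ)`: either `m' < m` in the dominance order, or `m' = m` and the last non-zero entry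
of `(m_{σ(1)} - m_{σ'(1)}, …, m_{σ(N)} - m_{σ'(N)})` is negative. -/
def PairLT (m' : Fin N → ℤ) (σ' : Equiv.Perm (Fin N)) (m : Fin N → ℤ) (σ : Equiv.Perm (Fin N)) :
    Prop :=
  DominanceLT m' m ∨
    m' = m ∧ ∃ k, m (σ k) - m (σ' k) < 0 ∧ ∀ l, k < l → m (σ l) - m (σ' l) = 0

/-- The eigenvalues `ξ_i^m(σ) = α m_{σ(i)} - σ(i)`. -/
def xi (α : ℝ) (m : Fin N → ℤ) (σ : Equiv.Perm (Fin N)) (i : Fin N) : ℂ :=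
  (α : ℂ) * m (σ i) - ((σ i : ℕ) + 1)

/-- `f` is the non-symmetric Jack polynomial with label `(m, σ)`: it is the monomial
`z_1^{m_{σ(1)}} ⋯ z_N^{m_{σ(N)}}` plus a combination of monomials with strictly smaller labels, and
`d_i f = ξ_i^m(σ) f` for all `i`. -/
structure IsJack (α : ℝ) (m : Fin N → ℤ) (σ : Equiv.Perm (Fin N)) (f : Laurent N) : Prop where
  leading : f.coeff (m ∘ σ) = 1
  triangular : ∀ η, f.coeff η ≠ 0 → η ≠ m ∘ σ →
    ∃ (m' : Fin N → ℤ) (σ' : Equiv.Perm (Fin N)),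
      Antitone m' ∧ σ' ∈ permSet m' ∧ η = m' ∘ σ' ∧ PairLT m' σ' m σ
  eigen : ∀ i, dunkl α i f = xi α m σ i • f

/-- The non-symmetric Jack polynomial `Φ_σ^m`. -/
def jack (α : ℝ) (m : Fin N → ℤ) (σ : Equiv.Perm (Fin N)) : Laurent N :=
  Classical.epsilon (IsJack α m σ)

/-- `E^m`, the span of the `Φ_σ^m`, `σ ∈ S^m`. -/
def jackSpace (α : ℝ) (m : Fin N → ℤ) : Submodule ℂ (Laurent N) :=
  Submodule.span ℂ (jack α m '' (permSet m : Set (Equiv.Perm (Fin N))))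

end Jack

/-! ### The space of states and the Yangian action -/

section States

variable {n N : ℕ}

/-- The space `ℂ[z_1^{±1}, …, z_N^{±1}] ⊗ (ℂ^n)^{⊗ N}`. -/
abbrev State (n N : ℕ) : Type := Laurent N ⊗[ℂ] Spin n N

/-- The fermionic space of states `⋂_i Ker (K_{i,i+1} P_{i,i+1} + 1)`. -/
def fermionSpace (n N : ℕ) : Submodule ℂ (State n N) :=
  ⨅ (i : Fin N) (j : Fin N) (_ : (i : ℕ) + 1 = j),
    LinearMap.ker (TensorProduct.map (exchOp i j) (permOp (n := n) i j) + LinearMap.id)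

/-- `F^m = (E^m ⊗ (ℂ^n)^{⊗ N}) ∩ H^{(-)}`. -/
def stateComponent (n : ℕ) (α : ℝ) (m : Fin N → ℤ) : Submodule ℂ (State n N) :=
  LinearMap.range (TensorProduct.map (jackSpace α m).subtype (LinearMap.id : Module.End ℂ (Spin n N)))
    ⊓ fermionSpace n N

/-- The fermionic monodromy matrix
`(1 + P_{0,1} / (u + d_1)) (1 + P_{0,2} / (u + d_2)) ⋯ (1 + P_{0,N} / (u + d_N))`, an `n × n` matrix
(in the auxiliary space) of power series in `u^{-1}` with coefficients in `End(H)`. -/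
def monodromy (n N : ℕ) (α : ℝ) : Matrix (Fin n) (Fin n) (PowerSeries (Module.End ℂ (State n N))) :=
  (List.ofFn fun i : Fin N =>
    lax (LinearMap.rTensor (Spin n N) (dunkl α i) : Module.End ℂ (State n N))
      fun a b => LinearMap.lTensor (Laurent N) (unitOp i a b)).prod

/-- The operators `T̂_{a,b}^{(s)}` on the space of states. -/
def stateT (α : ℝ) (a b : Fin n) (s : ℕ) : Module.End ℂ (State n N) :=
  PowerSeries.coeff s (monodromy n N α a b)

end States

/-! ### The space `W^m`, the operators `Ř(σ)` and the map `U^m` -/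

section Main

variable {N : ℕ}

/-- `W^m = ⋂_{i : m_i = m_{i+1}} Ker (P_{i,i+1} + 1) ⊂ (ℂ^n)^{⊗ N}`. -/
def wSpace (n : ℕ) (m : Fin N → ℤ) : Submodule ℂ (Spin n N) :=
  ⨅ (i : Fin N) (j : Fin N) (_ : (i : ℕ) + 1 = j ∧ m i = m j), LinearMap.ker (permOp i j + 1)

/-- The `R`-matrix `Ř_{i,j}(u) = u⁻¹ + P_{i,j}`. -/
def rCheck {n : ℕ} (i j : Fin N) (u : ℂ) : Module.End ℂ (Spin n N) := u⁻¹ • 1 + permOp i j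

/-- The recursion for the operators `Ř^{(-)}(σ)`, `σ ∈ S^m`: `Ř(id) = 1` and
`Ř(σ (i,i+1)) = - Ř_{i,i+1}(ξ_i(σ) - ξ_{i+1}(σ)) Ř(σ)` whenever `m_{σ(i)} > m_{σ(i+1)}`. -/
structure IsRFamily {n : ℕ} (α : ℝ) (m : Fin N → ℤ)
    (R : Equiv.Perm (Fin N) → Module.End ℂ (Spin n N)) : Prop where
  one : R 1 = 1
  step : ∀ σ ∈ permSet m, ∀ i j : Fin N, (i : ℕ) + 1 = j → m (σ j) < m (σ i) →
    R (σ * Equiv.swap i j) = -(rCheck i j (xi α m σ i - xi α m σ j) * R σ)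

/-- The operators `Ř^{(-)}(σ)`, `σ ∈ S^m`. -/
def rFamily (n : ℕ) (α : ℝ) (m : Fin N → ℤ) (σ : Equiv.Perm (Fin N)) : Module.End ℂ (Spin n N) :=
  Classical.epsilon (IsRFamily α m) σ

/-- The map `U^m v = ∑_{σ ∈ S^m} Φ_σ^m ⊗ Ř^{(-)}(σ) v`. -/
def uMap (n : ℕ) (α : ℝ) (m : Fin N → ℤ) : Spin n N →ₗ[ℂ] State n N :=
  ∑ σ ∈ permSet m, TensorProduct.mk ℂ _ _ (jack α m σ) ∘ₗ rFamily n α m σ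

/-- The composition `N = p_1 + ⋯ + p_M`, where `M` is the number of distinct values of `m` and
`p_1, …, p_M` are their multiplicities, in decreasing order of the values. -/
def multiplicities (m : Fin N → ℤ) : Composition N where
  blocks := ((Finset.univ.image m).sort (fun x y => x ≥ y)).map fun x => Finset.card {k | m k = x}
  blocks_pos := by
    intro p hp
    obtain ⟨x, hx, rfl⟩ := List.mem_map.1 hp
    obtain ⟨k, -, rfl⟩ := Finset.mem_image.1 ((Finset.mem_sort _).1 hx)
    exact Finset.card_pos.2 ⟨k, by simp⟩
  blocks_sum := by
    have h : ∀ s : Finset ℤ, ((s.sort (fun x y => x ≥ y)).map fun x =>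
        Finset.card {k : Fin N | m k = x}).sum = ∑ x ∈ s, Finset.card {k : Fin N | m k = x} := by
      intro s
      rw [Finset.sum_eq_multiset_sum, ← Finset.sort_eq s (fun x y => x ≥ y)]
      rfl
    rw [h, ← Finset.card_eq_sum_card_image, Finset.card_univ, Fintype.card_fin]

/-- `h_m^{(s)} = ξ^m_{1 + p_1 + ⋯ + p_{s-1}}(id)`, the value of `ξ^m(id)` at the first index of the
`s`-th block. -/
def blockShift (α : ℝ) (m : Fin N → ℤ) (s : Fin (multiplicities m).length) : ℂ :=
  xi α m 1 ((multiplicities m).embedding s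
    ⟨0, (multiplicities m).one_le_blocksFun s⟩)

/-- The space `V_{p_1} ⊗ V_{p_2} ⊗ ⋯ ⊗ V_{p_M}`. -/
abbrev FundTensor (n : ℕ) (m : Fin N → ℤ) : Type :=
  ⨂[ℂ] s : Fin (multiplicities m).length, fundSpace n ((multiplicities m).blocksFun s)

/-- The Yangian module `V_{p_1}(h^{(1)}) ⊗ V_{p_2}(h^{(2)}) ⊗ ⋯ ⊗ V_{p_M}(h^{(M)})`. -/
def fundTensorModule (n : ℕ) (α : ℝ) (m : Fin N → ℤ) :
    Yangian n →ₐ[ℂ] Module.End ℂ (FundTensor n m) :=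
  tensorModule fun s => fundModule n ((multiplicities m).blocksFun s) (blockShift α m s)

/-- The concatenation of tensors
`(ℂ^n)^{⊗ p_1} ⊗ ⋯ ⊗ (ℂ^n)^{⊗ p_M} ≃ (ℂ^n)^{⊗ N}` for `N = p_1 + ⋯ + p_M`, defined on the standard
bases; see `concat_tprod`. -/
def concat (n : ℕ) (c : Composition N) :
    (⨂[ℂ] s : Fin c.length, Spin n (c.blocksFun s)) ≃ₗ[ℂ] Spin n N :=
  (Basis.piTensorProduct fun s : Fin c.length =>
      Basis.piTensorProduct fun _ : Fin (c.blocksFun s) => Pi.basisFun ℂ (Fin n)).equiv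
    (Basis.piTensorProduct fun _ : Fin N => Pi.basisFun ℂ (Fin n))
    ((Equiv.piCurry fun (s : Fin c.length) (_ : Fin (c.blocksFun s)) => Fin n).symm.trans
      (Equiv.arrowCongr c.blocksFinEquiv (Equiv.refl (Fin n))))

theorem concat_tprod (n : ℕ) (c : Composition N)
    (w : ∀ s : Fin c.length, Fin (c.blocksFun s) → Fin n → ℂ) :
    concat n c (PiTensorProduct.tprod ℂ fun s => PiTensorProduct.tprod ℂ (w s))
      = PiTensorProduct.tprod ℂ fun i => w (c.index i) (c.invEmbedding i) := by
  have h : ∀ {ι κ M M' : Type} [AddCommMonoid M] [Module ℂ M] [AddCommMonoid M'] [Module ℂ M']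
      (b : Module.Basis ι ℂ M) (b' : Module.Basis κ ℂ M') (e : ι ≃ κ) (x : M) (k : κ),
      b'.repr (b.equiv b' e x) k = b.repr x (e.symm k) := by
    intro ι κ M M' _ _ _ _ b b' e x k
    have h' : b'.repr.toLinearMap ∘ₗ (b.equiv b' e).toLinearMap
        = (Finsupp.domLCongr e).toLinearMap ∘ₗ b.repr.toLinearMap :=
      b.ext fun i => by simp
    simpa using DFunLike.congr_fun (LinearMap.congr_fun h' x) k
  apply (Basis.piTensorProduct fun _ : Fin N => Pi.basisFun ℂ (Fin n)).repr.injective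
  ext ε
  rw [concat, h]
  simp only [Basis.piTensorProduct_repr_tprod_apply, Pi.basisFun_repr]
  rw [← Fintype.prod_sigma', ← Equiv.prod_comp c.blocksFinEquiv]
  refine Finset.prod_congr rfl fun x _ => ?_
  have hx : (⟨c.index (c.blocksFinEquiv x), c.invEmbedding (c.blocksFinEquiv x)⟩ :
      Σ s : Fin c.length, Fin (c.blocksFun s)) = x := c.blocksFinEquiv.symm_apply_apply x
  conv_rhs => rw [show w (c.index (c.blocksFinEquiv x)) (c.invEmbedding (c.blocksFinEquiv x))
    = w x.1 x.2 from congrArg (fun y : Σ s : Fin c.length, Fin (c.blocksFun s) => w y.1 y.2) hx]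
  rfl

/-- The embedding `V_{p_1} ⊗ ⋯ ⊗ V_{p_M} → (ℂ^n)^{⊗ N}` by concatenation of tensors. -/
def fundEmbedding (n : ℕ) (m : Fin N → ℤ) : FundTensor n m →ₗ[ℂ] Spin n N :=
  (concat n (multiplicities m)).toLinearMap ∘ₗ PiTensorProduct.mapIncl _

end Main

end

end SpinCS

open SpinCS

namespace SpinCS

noncomputable section

/-! ### Ring identities behind the Yang–Baxter equation and fusion -/

section RingLemmas

variable {R M : Type*} [CommRing R] [Ring M] [Algebra R M]

/-! The Dunkl operators are diagonalised, membership in F^m becomes a recursion for spin vectors,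
and the Yangian action is read off from the eigenvalues.

Spectrum. On monomials the d_i are triangular for the order `CompLT` on exponents, with diagonal
entries α η_i - rk η i (`dunkl_mono_mem`). As α > 0, these numbers determine η (`eq_of_wt_eq`), so
the joint eigenspace with the weight of η is at most a line, with highest exponent η. Every weight
occurs: the constant 1 has the weight of η = 0, and the intertwiners K_{i,i+1} - (ξ_i - ξ_{i+1})⁻¹
and f ↦ z_N f(z_N, z_1, …), the latter invertible, lead from there to all exponents
(`hasEigenvector`). Commutativity of the d_i is not needed. The same uniqueness gives the action of
K_{i,i+1} on the Jack polynomials (`exchOp_jack_of_eq`, `exchOp_jack`).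

Isomorphism. Comparing coefficients, ∑ Φ_σ ⊗ w_σ is fermionic iff w obeys the recursion of the Ř(σ)
and P_{i,i+1} w_σ = -w_σ whenever m_{σ(i)} = m_{σ(i+1)} (`jackSum_fermion_iff`). Hence w_σ = Ř(σ)
w_id, which makes U^m injective and onto. Conversely, for v in W^m the antisymmetry must be shown at
every σ. To this end Ř is extended to all permutations, which is consistent by the Yang–Baxter
equation (`rPath_step_unique`). If m_{σ(i)} = m_{σ(i+1)} and k = σ(i), then Ř(σ (i,i+1)) = -(1 +
P_{i,i+1}) Ř(σ); it is also divisible on the right by Ř((k,k+1)) = -(1 + P_{k,k+1}), which kills v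
(`exists_rOp_eq_mul`).

Yangian. On Φ_σ ⊗ v the monodromy matrix acts on v alone, as the product of the factors 1 +
P_{0,i}/(u + ξ_i(σ)). Since Ř(σ) intertwines the parameters ξ(id) and ξ(σ) (`laxProd_mul_rOp`), U^m
intertwines the product for σ = id with T̂. Along a block of equal values of m the parameters ξ(id)
drop by one at each step, and on antisymmetric tensors such a product collapses to an evaluation
module (`fusion_prod`); multiplying the blocks is the iterated coproduct. The module structure on
F^m is transported from the tensor product, so the Yangian relations for T̂ on the whole space of
states are not required. -/

theorem yang_baxter_of_braid (a b c : R) (habc : a * b + b * c = a * c) {P Q : M} (hP : P * P = 1)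
    (hQ : Q * Q = 1) (hPQ : P * Q * P = Q * P * Q) :
    (a • 1 + P) * ((b • 1 + Q) * (c • 1 + P)) = (c • 1 + Q) * ((b • 1 + P) * (a • 1 + Q)) := by
  simp only [mul_add, add_mul, smul_mul_assoc, mul_smul_comm, one_mul, mul_one, smul_add, smul_smul,
    hP, hQ, ← mul_assoc, hPQ]
  have h1 : (a * b) • P + (b * c) • P = (a * c) • P := by rw [← add_smul, habc]
  have h2 : (a * b) • Q + (b * c) • Q = (a * c) • Q := by rw [← add_smul, habc]
  rw [← sub_eq_zero] at h1 h2 ⊢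
  have : (0 : M) = ((a * b) • P + (b * c) • P - (a * c) • P)
      - ((a * b) • Q + (b * c) • Q - (a * c) • Q) := by rw [h1, h2, sub_zero]
  rw [this]
  module

/-- This is the exchange relation for two neighbouring factors, with A = P_{0,i}, B = P_{0,j}, P =
P_{i,j}. The condition on the coefficients is the partial fraction identity for g = 1/(u + x), h =
1/(u + y), c = 1/(x - y). -/
theorem lax_braid (g h c : R) (hc : c * (h - g) = g * h) {A B P : M} (hPP : P * P = 1)
    (hAB : A * B = B * P) (hBA : B * A = A * P) (hPA : P * A = B * P) (hPB : P * B = A * P) :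
    (1 + h • A) * (1 + g • B) * (c • 1 + P) = (c • 1 + P) * ((1 + g • A) * (1 + h • B)) := by
  have h1 : A * B * P = B := by rw [hAB, mul_assoc, hPP, mul_one]
  have h2 : B * P * B = A := by rw [mul_assoc, hPB, ← mul_assoc, hBA, mul_assoc, hPP, mul_one]
  simp only [mul_add, add_mul, smul_mul_assoc, mul_smul_comm, one_mul, mul_one, smul_add, smul_smul,
    ← mul_assoc, h1, h2, hPA, hPB]
  have h3 : (c * (h - g)) • (A - B) = (g * h) • (A - B) := by rw [hc]
  rw [← sub_eq_zero] at h3 ⊢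
  rw [← h3]
  module

theorem mul_one_add_smul_mul {A P D : M} {g : R} (h : P * A = A * P) :
    P * ((1 + g • A) * D) = (1 + g • A) * (P * D) := by
  simp only [add_mul, mul_add, one_mul, smul_mul_assoc, mul_smul_comm, ← mul_assoc, h]

/-- The hypothesis on g is that of g k = 1/(u + h - k). The last factor is peeled off first: it
commutes with the P j l of the remaining indices, so its product with D is still antisymmetric in
them and the induction hypothesis applies. -/
theorem fusion_prod {p : ℕ} (g : ℕ → R) (hg : ∀ k, g k - g 0 = (k : R) * (g 0 * g k))
    (A : Fin p → M) (P : Fin p → Fin p → M) (hA : ∀ j k, j ≠ k → A j * A k = A k * P j k)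
    (hPA : ∀ j l k, k ≠ j → k ≠ l → P j l * A k = A k * P j l) (D : M)
    (hD : ∀ j l, j ≠ l → P j l * D = -D) :
    (List.ofFn fun j : Fin p => 1 + g j • A j).prod * D = (1 + g 0 • ∑ j, A j) * D := by
  induction p generalizing D with
  | zero => simp
  | succ p ih =>
    rw [List.ofFn_succ', List.concat_eq_append, List.prod_append, List.prod_singleton, mul_assoc]
    have ih' := ih (fun j => A j.castSucc) (fun j l => P j.castSucc l.castSucc)
      (fun j k h => hA _ _ (by simpa using h))
      (fun j l k h h' => hPA _ _ _ (by simpa using h) (by simpa using h'))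
      ((1 + g (Fin.last p : ℕ) • A (Fin.last p)) * D) (fun j l h => by
        rw [mul_one_add_smul_mul (hPA _ _ _ (Fin.castSucc_lt_last j).ne' (Fin.castSucc_lt_last l).ne'),
          hD _ _ (by simpa using h), mul_neg])
    simp only [Fin.val_castSucc] at ih' ⊢
    rw [ih', Fin.sum_univ_castSucc]
    -- Each A_j A_p D equals A_p P_{j,p} D = -A_p D. The p such terms change the coefficient of A_p
    -- D from g p to g p - p g 0 g p = g 0.
    have h1 : (∑ j : Fin p, A j.castSucc) * (A (Fin.last p) * D) = -((p : R) • (A (Fin.last p) * D)) := by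
      rw [Finset.sum_mul, Finset.sum_congr rfl (g := fun _ => -(A (Fin.last p) * D))]
      · rw [Finset.sum_const, Finset.card_univ, Fintype.card_fin, Nat.cast_smul_eq_nsmul, smul_neg]
      · intro j _
        rw [← mul_assoc, hA _ _ (Fin.castSucc_lt_last j).ne, mul_assoc,
          hD _ _ (Fin.castSucc_lt_last j).ne, mul_neg]
    have h2 := congrArg (fun r : R => r • (A (Fin.last p) * D)) (hg p)
    simp only [Fin.val_last, mul_add, add_mul, smul_mul_assoc, mul_smul_comm, one_mul, smul_add,
      smul_smul, h1, smul_neg]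
    rw [← sub_eq_zero] at h2 ⊢
    rw [← h2]
    module

end RingLemmas

/-! ### Moving an operator through an ordered product -/

section ListLemmas

variable {M : Type*} [Monoid M]

theorem list_ofFn_prod_mul_of_commute {N : ℕ} (f : Fin N → M) (D : M)
    (h : ∀ k, f k * D = D * f k) : (List.ofFn f).prod * D = D * (List.ofFn f).prod := by
  induction N with
  | zero => simp
  | succ N ih =>
    rw [List.ofFn_succ, List.prod_cons, mul_assoc, ih _ fun k => h _, ← mul_assoc, h, mul_assoc]

/-- If `D` exchanges two neighbouring factors and commutes with the others, it intertwines the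
products. -/
theorem list_ofFn_prod_mul_of_exchange {N : ℕ} (f f' : Fin N → M) (D : M) (i j : Fin N)
    (hij : (i : ℕ) + 1 = j) (hne : ∀ k, k ≠ i → k ≠ j → f' k * D = D * f k)
    (hff : ∀ k, k ≠ i → k ≠ j → f' k = f k)
    (hex : f' i * f' j * D = D * (f i * f j)) :
    (List.ofFn f').prod * D = D * (List.ofFn f).prod := by
  induction N with
  | zero => exact i.elim0
  | succ N ih =>
    rw [List.ofFn_succ, List.ofFn_succ, List.prod_cons, List.prod_cons]
    induction i using Fin.cases with
    | zero =>
      obtain _ | N := N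
      · have := j.2
        rw [← hij] at this
        simp at this
      obtain rfl : j = 1 := by
        ext; simpa using hij.symm
      rw [List.ofFn_succ, List.ofFn_succ, List.prod_cons, List.prod_cons]
      have h1 : (fun k : Fin N => f' k.succ.succ) = fun k => f k.succ.succ :=
        funext fun k => hff _ (Fin.succ_ne_zero _) (by simp [Fin.ext_iff])
      have h2 := list_ofFn_prod_mul_of_commute (fun k : Fin N => f k.succ.succ) D fun k => by
        rw [← hne _ (Fin.succ_ne_zero _) (by simp [Fin.ext_iff]),
          hff _ (Fin.succ_ne_zero _) (by simp [Fin.ext_iff])]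
      rw [h1, mul_assoc, mul_assoc, h2, ← mul_assoc, ← mul_assoc,
        show f' 0 * f' (Fin.succ 0) * D = D * (f 0 * f (Fin.succ 0)) from hex]
      simp only [mul_assoc]
    | succ i =>
      induction j using Fin.cases with
      | zero => simp at hij
      | succ j =>
        rw [mul_assoc, ih (fun k => f k.succ) (fun k => f' k.succ) i j (by simpa using hij)
          (fun k h h' => hne _ (by simpa using h) (by simpa using h'))
          (fun k h h' => hff _ (by simpa using h) (by simpa using h')) hex, ← mul_assoc,
          hne 0 (Fin.succ_ne_zero _).symm (Fin.succ_ne_zero _).symm, mul_assoc]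

end ListLemmas

/-! ### Permutations and matrix units acting on the spin space -/

section SpinOps

variable {n N : ℕ}

theorem spin_ext {V : Type*} [AddCommMonoid V] [Module ℂ V] {f g : Spin n N →ₗ[ℂ] V}
    (h : ∀ v : Fin N → Fin n → ℂ, f (PiTensorProduct.tprod ℂ v) = g (PiTensorProduct.tprod ℂ v)) :
    f = g :=
  PiTensorProduct.ext (MultilinearMap.ext h)

theorem permOp_tprod (i j : Fin N) (v : Fin N → Fin n → ℂ) :
    permOp i j (PiTensorProduct.tprod ℂ v) = PiTensorProduct.tprod ℂ fun k => v (Equiv.swap i j k) := by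
  simp [permOp, PiTensorProduct.reindex_tprod]

theorem permOp_mul_self (i j : Fin N) : permOp (n := n) i j * permOp i j = 1 :=
  spin_ext fun v => by simp [permOp_tprod]

theorem permOp_mul_permOp_mul_permOp (i j k l : Fin N) :
    permOp (n := n) i j * permOp k l * permOp i j
      = permOp (Equiv.swap i j k) (Equiv.swap i j l) := by
  refine spin_ext fun v => ?_
  simp only [Module.End.mul_apply, permOp_tprod]
  congr 1
  funext x
  rw [Equiv.swap_apply_apply]
  simp [Equiv.Perm.mul_apply]

theorem permOp_symm (i j : Fin N) : permOp (n := n) i j = permOp j i := by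
  rw [permOp, permOp, Equiv.swap_comm]

theorem permOp_commute {i j k l : Fin N} (h : k ≠ i) (h' : k ≠ j) (h'' : l ≠ i) (h''' : l ≠ j) :
    permOp (n := n) i j * permOp k l = permOp k l * permOp i j := by
  have := permOp_mul_permOp_mul_permOp (n := n) i j k l
  rw [Equiv.swap_apply_of_ne_of_ne h h', Equiv.swap_apply_of_ne_of_ne h'' h'''] at this
  calc permOp i j * permOp k l = permOp i j * permOp k l * permOp i j * permOp i j := by
        rw [mul_assoc _ (permOp i j) (permOp i j), permOp_mul_self, mul_one]
    _ = _ := by rw [this]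

theorem permOp_mul_unitOp (i j k : Fin N) (a b : Fin n) :
    permOp i j * unitOp k a b = unitOp (Equiv.swap i j k) a b * permOp i j := by
  refine spin_ext fun v => ?_
  simp only [Module.End.mul_apply, unitOp, siteOp_tprod, permOp_tprod]
  congr 1
  funext l
  by_cases hl : l = Equiv.swap i j k
  · subst hl; simp
  · have : Equiv.swap i j l ≠ k := by
      rintro rfl; simp at hl
    simp [Function.update_of_ne hl, Function.update_of_ne this]

theorem toLin'_single (a b : Fin n) (w : Fin n → ℂ) :
    Matrix.toLin' (Matrix.single a b (1 : ℂ)) w = w b • Pi.single a 1 := by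
  rw [Matrix.toLin'_apply, Matrix.single_mulVec, one_mul]
  ext c
  by_cases h : c = a
  · subst h; simp
  · simp [h]

/-- This is the (a, b) entry of the relation P_{0,i} P_{0,j} = P_{0,j} P_{i,j} in the auxiliary
space. -/
theorem sum_unitOp_mul_unitOp {i j : Fin N} (hij : i ≠ j) (a b : Fin n) :
    ∑ c, unitOp i c a * unitOp j b c = unitOp j b a * permOp i j := by
  refine spin_ext fun v => ?_
  rw [LinearMap.sum_apply]
  simp only [Module.End.mul_apply, unitOp, siteOp_tprod, permOp_tprod, toLin'_single,
    Equiv.swap_apply_right, MultilinearMap.map_update_smul, map_smul, Function.update_of_ne hij]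
  have h1 : ∀ c, v j c • v i a • PiTensorProduct.tprod ℂ
      (Function.update (Function.update v j (Pi.single b 1)) i (Pi.single c 1))
      = v i a • PiTensorProduct.tprod ℂ
      (Function.update (Function.update v j (Pi.single b 1)) i (v j c • Pi.single c 1)) := by
    intro c
    rw [MultilinearMap.map_update_smul, smul_comm]
  simp_rw [h1]
  rw [← Finset.smul_sum, ← MultilinearMap.map_update_sum]
  congr 2
  funext l
  have h2 : ∑ c, v j c • (Pi.single c 1 : Fin n → ℂ) = v j := by
    ext d
    simp [Finset.sum_apply, Pi.single_apply]
  by_cases h : l = i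
  · subst h
    rw [Function.update_self, h2, Function.update_of_ne hij, Equiv.swap_apply_left]
  · by_cases h' : l = j
    · subst h'; simp [h]
    · simp [h, h', Equiv.swap_apply_of_ne_of_ne]

end SpinOps

/-! ### Matrices of power series -/

section Series

variable {n : ℕ} {A : Type*} [Semiring A] [Algebra ℂ A]

/-- Power series over `A` as an algebra over the power series with scalar coefficients. -/
@[reducible] def seriesAlgebra (A : Type*) [Semiring A] [Algebra ℂ A] :
    Algebra (PowerSeries ℂ) (PowerSeries A) :=
  (PowerSeries.map (algebraMap ℂ A)).toAlgebra' fun c x => by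
    ext r
    rw [PowerSeries.coeff_mul, PowerSeries.coeff_mul, ← Finset.Nat.sum_antidiagonal_swap]
    simp [Algebra.commutes]

attribute [local instance] seriesAlgebra

theorem series_smul_def (g : PowerSeries ℂ) (f : PowerSeries A) :
    g • f = PowerSeries.map (algebraMap ℂ A) g * f := rfl

/-- The series `1 / (u + x) = u⁻¹ - x u⁻² + ⋯`. -/
def shiftSeries (x : ℂ) : PowerSeries ℂ :=
  PowerSeries.X * PowerSeries.mk fun s => (-x) ^ s

/-- With `X` = u⁻¹ the first factor is (u + x)/u. Identities between the series 1/(u + x) are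
checked by clearing such factors, which are nonzero because their constant term is 1. -/
theorem one_add_mul_shiftSeries (x : ℂ) :
    (1 + PowerSeries.C x * PowerSeries.X) * shiftSeries x = PowerSeries.X := by
  rw [shiftSeries]
  ext s
  rcases s with _ | _ | s
  · simp
  · simp [add_mul, mul_assoc, PowerSeries.coeff_succ_X_mul]
  · rw [PowerSeries.coeff_X, if_neg (by omega)]
    simp [add_mul, mul_assoc, PowerSeries.coeff_succ_X_mul, pow_succ]
    ring

theorem shiftSeries_sub (x y : ℂ) : shiftSeries y - shiftSeries x
    = PowerSeries.C (x - y) * (shiftSeries x * shiftSeries y) := by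
  have hx := one_add_mul_shiftSeries x
  have hy := one_add_mul_shiftSeries y
  have h : ((1 + PowerSeries.C x * PowerSeries.X) * (1 + PowerSeries.C y * PowerSeries.X)
      : PowerSeries ℂ) ≠ 0 := by
    intro h
    have := congrArg (PowerSeries.coeff 0) h
    simp at this
  refine mul_left_cancel₀ h ?_
  rw [map_sub]
  linear_combination (1 + PowerSeries.C x * PowerSeries.X) * hy
    - (1 + PowerSeries.C y * PowerSeries.X) * hx
    - (PowerSeries.C x - PowerSeries.C y) * (1 + PowerSeries.C x * PowerSeries.X) * shiftSeries x * hy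
    - (PowerSeries.C x - PowerSeries.C y) * PowerSeries.X * hx

/-- The matrix `∑ E_{a,b} ⊗ e_{b,a}` with constant series as entries. -/
def auxPerm (e : Fin n → Fin n → A) : Matrix (Fin n) (Fin n) (PowerSeries A) :=
  Matrix.of fun a b => PowerSeries.C (e b a)

/-- An operator in the quantum space as a matrix of series. -/
def auxScalar (n : ℕ) : A →+* Matrix (Fin n) (Fin n) (PowerSeries A) :=
  (Matrix.scalar (Fin n)).comp PowerSeries.C

/-- For a scalar shift the factor takes the form 1 + g P with g in the commutative ring of scalar
series, so that `lax_braid` and `fusion_prod` apply to matrices of operator series. -/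
theorem lax_eq (x : ℂ) (e : Fin n → Fin n → A) :
    lax (algebraMap ℂ A x) e = 1 + shiftSeries x • auxPerm e := by
  ext a b s
  rw [Matrix.add_apply, Matrix.smul_apply, map_add, series_smul_def, auxPerm, Matrix.of_apply,
    PowerSeries.coeff_mul_C, Matrix.one_apply]
  rcases s with _ | s
  · simp [lax, shiftSeries]
  · rw [PowerSeries.coeff_map, shiftSeries, PowerSeries.coeff_succ_X_mul, PowerSeries.coeff_mk,
      neg_pow x]
    split_ifs <;> simp [lax, PowerSeries.coeff_one, Algebra.smul_def, mul_assoc]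

end Series


/-! ### Exchange relation and fusion for products of Lax factors -/

section LaxProd

variable {n N : ℕ}

attribute [local instance] seriesAlgebra

theorem auxScalar_mul_apply {A : Type*} [Semiring A] [Algebra ℂ A] (J : A)
    (T : Matrix (Fin n) (Fin n) (PowerSeries A)) (a b : Fin n) (r : ℕ) :
    PowerSeries.coeff r ((auxScalar n J * T) a b) = J * PowerSeries.coeff r (T a b) := by
  simp [auxScalar, Matrix.scalar_apply, Matrix.diagonal_mul]

theorem mul_auxScalar_apply {A : Type*} [Semiring A] [Algebra ℂ A] (J : A)
    (T : Matrix (Fin n) (Fin n) (PowerSeries A)) (a b : Fin n) (r : ℕ) :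
    PowerSeries.coeff r ((T * auxScalar n J) a b) = PowerSeries.coeff r (T a b) * J := by
  simp [auxScalar, Matrix.scalar_apply, Matrix.mul_diagonal]

theorem auxScalar_neg {A : Type*} [Ring A] [Algebra ℂ A] (J : A) :
    auxScalar n (-J) = -auxScalar n J :=
  map_neg _ _

theorem auxScalar_smul {A : Type*} [Semiring A] [Algebra ℂ A] (c : ℂ) (J : A) :
    auxScalar n (c • J) = PowerSeries.C c • auxScalar n J := by
  ext a b r
  rw [Matrix.smul_apply, series_smul_def, PowerSeries.map_C, PowerSeries.coeff_C_mul]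
  simp only [auxScalar, RingHom.comp_apply, Matrix.scalar_apply, Matrix.diagonal_apply]
  split_ifs
  · simp [PowerSeries.coeff_C, Algebra.smul_def]
  · simp

/-- The matrix `P_{0,k}`. -/
abbrev auxP (n : ℕ) {N : ℕ} (k : Fin N) :
    Matrix (Fin n) (Fin n) (PowerSeries (Module.End ℂ (Spin n N))) :=
  auxPerm (unitOp k)

theorem auxP_mul_auxP {i j : Fin N} (hij : i ≠ j) :
    auxP n i * auxP n j = auxP n j * auxScalar n (permOp i j) := by
  refine Matrix.ext fun a b => PowerSeries.ext fun r => ?_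
  rw [mul_auxScalar_apply, Matrix.mul_apply, map_sum]
  simp only [auxPerm, Matrix.of_apply, PowerSeries.coeff_C_mul, PowerSeries.coeff_C]
  split_ifs
  · rw [sum_unitOp_mul_unitOp hij]
  · simp

theorem auxScalar_mul_auxP (i j k : Fin N) :
    auxScalar n (permOp i j) * auxP n k = auxP n (Equiv.swap i j k) * auxScalar n (permOp i j) := by
  refine Matrix.ext fun a b => PowerSeries.ext fun r => ?_
  rw [mul_auxScalar_apply, auxScalar_mul_apply]
  simp only [auxPerm, Matrix.of_apply, PowerSeries.coeff_C]
  split_ifs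
  · rw [permOp_mul_unitOp]
  · simp

/-- The product `(1 + P_{0,1} / (u + ξ_1)) ⋯ (1 + P_{0,N} / (u + ξ_N))`. -/
def laxProd (n : ℕ) {N : ℕ} (ξ : Fin N → ℂ) :
    Matrix (Fin n) (Fin n) (PowerSeries (Module.End ℂ (Spin n N))) :=
  (List.ofFn fun k => lax (algebraMap ℂ _ (ξ k)) (unitOp k)).prod

/-- The operator Ř_{i,j} exchanges the parameters of the two neighbouring factors by `lax_braid` and
commutes with the others, because P_{i,j} commutes with P_{0,k} for k different from i and j. -/
theorem laxProd_mul_rCheck (ξ : Fin N → ℂ) {i j : Fin N} (hij : (i : ℕ) + 1 = j)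
    (hξ : ξ i ≠ ξ j) (a b : Fin n) (r : ℕ) :
    PowerSeries.coeff r (laxProd n (ξ ∘ Equiv.swap i j) a b) * rCheck i j (ξ i - ξ j)
      = rCheck i j (ξ i - ξ j) * PowerSeries.coeff r (laxProd n ξ a b) := by
  have hne : i ≠ j := by rintro rfl; omega
  rw [← mul_auxScalar_apply, ← auxScalar_mul_apply]
  suffices h : laxProd n (ξ ∘ Equiv.swap i j) * auxScalar n (rCheck i j (ξ i - ξ j))
      = auxScalar n (rCheck i j (ξ i - ξ j)) * laxProd n ξ by rw [h]
  have hD : auxScalar n (rCheck i j (ξ i - ξ j)) = PowerSeries.C ((ξ i - ξ j)⁻¹) • 1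
      + auxScalar n (permOp (n := n) i j) := by
    rw [rCheck, map_add, auxScalar_smul, map_one]
  refine list_ofFn_prod_mul_of_exchange _ _ _ i j hij ?_ ?_ ?_
  · intro k hki hkj
    have := auxScalar_mul_auxP (n := n) i j k
    rw [Equiv.swap_apply_of_ne_of_ne hki hkj] at this
    simp only [Function.comp_apply, Equiv.swap_apply_of_ne_of_ne hki hkj, lax_eq, hD, mul_add,
      add_mul, mul_one, one_mul, smul_mul_assoc, mul_smul_comm, smul_add, smul_smul, this,
      mul_comm (shiftSeries (ξ k))]
    abel
  · intro k hki hkj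
    rw [Function.comp_apply, Equiv.swap_apply_of_ne_of_ne hki hkj]
  · simp only [Function.comp_apply, Equiv.swap_apply_left, Equiv.swap_apply_right, lax_eq, hD]
    refine lax_braid (A := auxP n i) (B := auxP n j) (P := auxScalar n (permOp i j)) _ _ _
      ?_ ?_ (auxP_mul_auxP hne) ?_ ?_ ?_
    · rw [shiftSeries_sub, ← mul_assoc, ← map_mul, inv_mul_cancel₀ (sub_ne_zero.2 hξ), map_one,
        one_mul]
    · rw [← map_mul, permOp_mul_self, map_one]
    · rw [permOp_symm i j]
      exact auxP_mul_auxP hne.symm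
    · rw [auxScalar_mul_auxP, Equiv.swap_apply_left]
    · rw [auxScalar_mul_auxP, Equiv.swap_apply_right]

/-- Fusion: on antisymmetric tensors, the product of the factors with shifts `h, h - 1, …` acts as an
evaluation module. -/
theorem laxProd_mul_of_antisymm (h : ℂ) (q : Module.End ℂ (Spin n N))
    (hq : ∀ i j, i ≠ j → permOp i j * q = -q) (a b : Fin n) (r : ℕ) :
    PowerSeries.coeff r (laxProd n (fun k : Fin N => h - (k : ℕ)) a b) * q
      = PowerSeries.coeff r (lax (algebraMap ℂ (Module.End ℂ (Spin n N)) h) glOp a b) * q := by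
  rw [← mul_auxScalar_apply, ← mul_auxScalar_apply]
  suffices h' : laxProd n (fun k : Fin N => h - (k : ℕ)) * auxScalar n q
      = lax (algebraMap ℂ (Module.End ℂ (Spin n N)) h) glOp * auxScalar n q by rw [h']
  have key := fusion_prod (R := PowerSeries ℂ) (fun k : ℕ => shiftSeries (h - k))
    (fun k => by
      rw [shiftSeries_sub, sub_sub_sub_cancel_left]
      congr 1
      simp)
    (fun k : Fin N => auxP n k) (fun i j => auxScalar n (permOp i j))
    (fun j k hjk => auxP_mul_auxP hjk)
    (fun j l k hj hl => by rw [auxScalar_mul_auxP, Equiv.swap_apply_of_ne_of_ne hj hl])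
    (auxScalar n q) (fun i j hij => by
      rw [← map_mul, hq i j hij]
      exact auxScalar_neg q)
  have hsum : auxPerm (glOp (n := n) (N := N)) = ∑ k, auxP n k := by
    ext a b : 2
    simp [auxPerm, glOp, Matrix.sum_apply]
  simp only [laxProd, lax_eq, hsum]
  simp only [Nat.cast_zero, sub_zero] at key
  exact key

end LaxProd


/-! ### Adjacent transpositions -/

section Adjacent

variable {N : ℕ}

theorem strictMono_of_adjacent {β : Type*} [Preorder β] {f : Fin N → β}
    (h : ∀ i j : Fin N, (i : ℕ) + 1 = j → f i < f j) : StrictMono f := by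
  obtain _ | N := N
  · exact fun i => i.elim0
  · exact Fin.strictMono_iff_lt_succ.2 fun i => h _ _ (by simp)

theorem perm_eq_one_of_strictMono {w : Equiv.Perm (Fin N)} (h : StrictMono w) : w = 1 := by
  have := Subsingleton.elim (h.orderIsoOfSurjective w w.surjective) (OrderIso.refl _)
  exact Equiv.ext fun i => DFunLike.congr_fun this i

theorem exists_descent {w : Equiv.Perm (Fin N)} (hw : w ≠ 1) :
    ∃ i j : Fin N, (i : ℕ) + 1 = j ∧ w j < w i := by
  by_contra! h
  refine hw (perm_eq_one_of_strictMono (strictMono_of_adjacent fun i j hij => ?_))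
  refine (h i j hij).lt_of_ne fun e => ?_
  rw [w.injective e] at hij
  omega

/-- Permutations are ordered lexicographically; sorting a descent lowers them. -/
def permKey (w : Equiv.Perm (Fin N)) : Lex (Fin N → Fin N) := toLex w

theorem permKey_lt {w : Equiv.Perm (Fin N)} {i j : Fin N} (hij : (i : ℕ) + 1 = j) (h : w j < w i) :
    permKey (w * Equiv.swap i j) < permKey w := by
  refine ⟨i, fun k hk => ?_, ?_⟩
  · have hkj : k ≠ j := by
      rintro rfl
      have := Fin.lt_def.1 hk
      omega
    simp [permKey, Equiv.swap_apply_of_ne_of_ne (ne_of_lt hk) hkj]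
  · simpa [permKey] using h

theorem perm_wf : WellFounded fun w w' : Equiv.Perm (Fin N) => permKey w < permKey w' :=
  InvImage.wf permKey wellFounded_lt

theorem swap_mul_swap_comm {i j k l : Fin N} (h1 : i ≠ k) (h2 : i ≠ l) (h3 : j ≠ k)
    (h4 : j ≠ l) : Equiv.swap i j * Equiv.swap k l = Equiv.swap k l * Equiv.swap i j := by
  rw [Equiv.mul_swap_eq_swap_mul, Equiv.swap_apply_of_ne_of_ne h1.symm h3.symm,
    Equiv.swap_apply_of_ne_of_ne h2.symm h4.symm]

theorem swap_braid {i j l : Fin N} (h1 : i ≠ j) (h2 : i ≠ l) (h3 : j ≠ l) :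
    Equiv.swap i j * Equiv.swap j l * Equiv.swap i j
      = Equiv.swap j l * Equiv.swap i j * Equiv.swap j l := by
  rw [Equiv.swap_mul_swap_mul_swap h1 h2, Equiv.swap_comm i j,
    Equiv.swap_comm j l, Equiv.swap_mul_swap_mul_swap h3.symm h2.symm, Equiv.swap_comm]

end Adjacent

/-! ### The operators `Ř(w)` for all permutations -/

section RFamily

variable {n N : ℕ}

theorem spinEnd_mul_neg (a b : Module.End ℂ (Spin n N)) : a * -b = -(a * b) :=
  LinearMap.ext fun x => by simp only [Module.End.mul_apply, LinearMap.neg_apply, map_neg]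

theorem spinEnd_neg_mul (a b : Module.End ℂ (Spin n N)) : -a * b = -(a * b) :=
  LinearMap.ext fun x => by simp only [Module.End.mul_apply, LinearMap.neg_apply]

theorem spinEnd_neg_neg (a : Module.End ℂ (Spin n N)) : -(-a) = a :=
  LinearMap.ext fun x => by simp only [LinearMap.neg_apply, neg_neg]

/-- The Yang–Baxter equation. -/
theorem rCheck_braid {i j l : Fin N} (h1 : i ≠ j) (h2 : i ≠ l) (h3 : j ≠ l) {x y z : ℂ}
    (hxy : x ≠ y) (hyz : y ≠ z) (hxz : x ≠ z) :
    rCheck (n := n) i j (y - z) * (rCheck j l (x - z) * rCheck i j (x - y))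
      = rCheck j l (x - y) * (rCheck i j (x - z) * rCheck j l (y - z)) := by
  refine yang_baxter_of_braid (M := Module.End ℂ (Spin n N)) _ _ _ ?_
    (permOp_mul_self i j) (permOp_mul_self j l) ?_
  · have := sub_ne_zero.2 hxy
    have := sub_ne_zero.2 hyz
    have := sub_ne_zero.2 hxz
    field_simp
    ring
  · rw [permOp_mul_permOp_mul_permOp, permOp_mul_permOp_mul_permOp, Equiv.swap_apply_right,
      Equiv.swap_apply_left, Equiv.swap_apply_of_ne_of_ne h2.symm h3.symm,
      Equiv.swap_apply_of_ne_of_ne h1 h2]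

theorem rCheck_commute {i j k l : Fin N} (h1 : k ≠ i) (h2 : k ≠ j) (h3 : l ≠ i) (h4 : l ≠ j)
    (u v : ℂ) : rCheck (n := n) i j u * rCheck k l v = rCheck k l v * rCheck i j u := by
  simp only [rCheck, mul_add, add_mul, smul_mul_assoc, mul_smul_comm, one_mul, mul_one,
    permOp_commute h1 h2 h3 h4, smul_add, smul_smul, mul_comm u⁻¹]
  abel

/-- `RPath lam w r` says that `r` is obtained from `1` by the recursion for `Ř(w)` along some way of
writing `w` as a product of adjacent transpositions without cancellations. -/
inductive RPath (lam : Fin N → ℂ) : Equiv.Perm (Fin N) → Module.End ℂ (Spin n N) → Prop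
  | one : RPath lam 1 1
  | step (w : Equiv.Perm (Fin N)) (r : Module.End ℂ (Spin n N)) (i j : Fin N)
      (hij : (i : ℕ) + 1 = j) (h : w j < w i) (hr : RPath lam (w * Equiv.swap i j) r) :
      RPath lam w (-(rCheck i j (lam (w j) - lam (w i)) * r))

variable {lam : Fin N → ℂ}

theorem exists_rPath (w : Equiv.Perm (Fin N)) : ∃ r, RPath (n := n) lam w r := by
  induction w using perm_wf.induction with
  | _ w ih =>
    by_cases hw : w = 1
    · exact ⟨1, hw ▸ RPath.one⟩
    · obtain ⟨i, j, hij, h⟩ := exists_descent hw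
      obtain ⟨r, hr⟩ := ih _ (permKey_lt hij h)
      exact ⟨_, RPath.step w r i j hij h hr⟩

/-- A diamond argument: two different descents of w are continued to a common lower permutation.
Descents at distance at least two give commuting factors. Overlapping descents reach the sorted
triple along the two sides of the braid relation, and the two products agree by the Yang–Baxter
equation. -/
theorem rPath_step_unique (hlam : Function.Injective lam) {w : Equiv.Perm (Fin N)}
    (ih : ∀ w', permKey w' < permKey w → ∀ r r', RPath (n := n) lam w' r → RPath lam w' r' → r = r')
    {i j k l : Fin N} (hij : (i : ℕ) + 1 = j) (hkl : (k : ℕ) + 1 = l) (hik : (i : ℕ) < k)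
    (h : w j < w i) (h' : w l < w k) {r r' : Module.End ℂ (Spin n N)}
    (hr : RPath lam (w * Equiv.swap i j) r) (hr' : RPath lam (w * Equiv.swap k l) r') :
    rCheck i j (lam (w j) - lam (w i)) * r = rCheck k l (lam (w l) - lam (w k)) * r' := by
  have nij : i ≠ j := by rintro rfl; omega
  have nkl : k ≠ l := by rintro rfl; omega
  have nik : i ≠ k := by rintro rfl; omega
  have nil : i ≠ l := by rintro rfl; omega
  have njl : j ≠ l := by rintro rfl; omega
  by_cases njk : j = k
  · subst njk
    set x := w l with hx
    set y := w j with hy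
    set z := w i with hz
    obtain ⟨r0, hr0⟩ := exists_rPath (n := n) (lam := lam)
      (w * Equiv.swap i j * Equiv.swap j l * Equiv.swap i j)
    have hr0' : RPath (n := n) lam (w * Equiv.swap j l * Equiv.swap i j * Equiv.swap j l) r0 := by
      rwa [mul_assoc w, mul_assoc w, ← swap_braid nij nil njl, ← mul_assoc, ← mul_assoc]
    have e1 := RPath.step _ _ i j hij (by
      simpa [Equiv.swap_apply_of_ne_of_ne, nij, nil, njl, nij.symm, nil.symm, njl.symm] using h') hr0
    have e2 := RPath.step _ _ j l hkl (by
      simpa [Equiv.swap_apply_of_ne_of_ne, nij, nil, njl, nij.symm, nil.symm, njl.symm]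
        using h'.trans h) e1
    have f1 := RPath.step _ _ j l hkl (by
      simpa [Equiv.swap_apply_of_ne_of_ne, nij, nil, njl, nij.symm, nil.symm, njl.symm] using h) hr0'
    have f2 := RPath.step _ _ i j hij (by
      simpa [Equiv.swap_apply_of_ne_of_ne, nij, nil, njl, nij.symm, nil.symm, njl.symm]
        using h'.trans h) f1
    -- Below w the operator is already unique, so r and r' may be replaced by the ones that pass
    -- through the common r0.
    rw [ih _ (permKey_lt hij h) _ _ hr e2, ih _ (permKey_lt hkl h') _ _ hr' f2]
    simp only [Equiv.Perm.mul_apply, Equiv.swap_apply_left, Equiv.swap_apply_right,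
      Equiv.swap_apply_of_ne_of_ne nil.symm njl.symm, Equiv.swap_apply_of_ne_of_ne nij nil,
      spinEnd_mul_neg, spinEnd_neg_neg, ← hx, ← hy, ← hz]
    have := rCheck_braid (n := n) nij nil njl (x := lam x) (y := lam y) (z := lam z)
      (hlam.ne h'.ne) (hlam.ne h.ne) (hlam.ne (h'.trans h).ne)
    rw [← mul_assoc] at this
    rw [← mul_assoc (rCheck j l _), ← mul_assoc (rCheck i j _), ← mul_assoc (rCheck i j _), this]
    simp only [mul_assoc]
  · obtain ⟨r0, hr0⟩ := exists_rPath (n := n) (lam := lam) (w * Equiv.swap i j * Equiv.swap k l)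
    have hr0' : RPath (n := n) lam (w * Equiv.swap k l * Equiv.swap i j) r0 := by
      rwa [mul_assoc, ← swap_mul_swap_comm nik nil njk njl, ← mul_assoc]
    have e1 := RPath.step _ _ k l hkl (by
      simpa [Equiv.swap_apply_of_ne_of_ne, nik.symm, nil.symm, Ne.symm njk, njl.symm] using h') hr0
    have f1 := RPath.step _ _ i j hij (by
      simpa [Equiv.swap_apply_of_ne_of_ne, nik, nil, njk, njl] using h) hr0'
    rw [ih _ (permKey_lt hij h) _ _ hr e1, ih _ (permKey_lt hkl h') _ _ hr' f1]
    simp only [Equiv.Perm.mul_apply, Equiv.swap_apply_of_ne_of_ne nik nil,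
      Equiv.swap_apply_of_ne_of_ne njk njl, Equiv.swap_apply_of_ne_of_ne nik.symm (Ne.symm njk),
      Equiv.swap_apply_of_ne_of_ne nil.symm njl.symm, spinEnd_mul_neg]
    rw [← mul_assoc, ← mul_assoc, rCheck_commute nik.symm (Ne.symm njk) nil.symm njl.symm]

theorem rPath_unique (hlam : Function.Injective lam) (w : Equiv.Perm (Fin N)) :
    ∀ r r', RPath (n := n) lam w r → RPath lam w r' → r = r' := by
  induction w using perm_wf.induction with
  | _ w ih =>
    have hone : ∀ i j : Fin N, (i : ℕ) + 1 = j → 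
        ¬ (1 : Equiv.Perm (Fin N)) j < (1 : Equiv.Perm (Fin N)) i := by
      intro i j hij h
      have := Fin.lt_def.1 h
      simp at this
      omega
    intro r r' hr hr'
    cases hr with
    | one =>
      cases hr' with
      | one => rfl
      | step _ r' k l hkl h' hr' => exact (hone _ _ hkl h').elim
    | step _ r i j hij h hr =>
      cases hr' with
      | one => exact (hone _ _ hij h).elim
      | step _ r' k l hkl h' hr' =>
        congr 1
        rcases lt_trichotomy (i : ℕ) k with hik | hik | hik
        · exact rPath_step_unique hlam ih hij hkl hik h h' hr hr'
        · obtain rfl : i = k := Fin.ext hik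
          obtain rfl : j = l := Fin.ext (by omega)
          rw [ih _ (permKey_lt hij h) _ _ hr hr']
        · exact (rPath_step_unique hlam ih hkl hij hik h' h hr' hr).symm

/-- The operator `Ř(w)` for an arbitrary permutation `w`. -/
def rOp (n : ℕ) {N : ℕ} (lam : Fin N → ℂ) (w : Equiv.Perm (Fin N)) : Module.End ℂ (Spin n N) :=
  (exists_rPath (n := n) (lam := lam) w).choose

theorem rPath_rOp (w : Equiv.Perm (Fin N)) : RPath lam w (rOp n lam w) :=
  (exists_rPath (n := n) (lam := lam) w).choose_spec

theorem rOp_one (hlam : Function.Injective lam) : rOp n lam 1 = 1 :=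
  rPath_unique hlam 1 _ _ (rPath_rOp 1) RPath.one

theorem rOp_descent (hlam : Function.Injective lam) {w : Equiv.Perm (Fin N)} {i j : Fin N}
    (hij : (i : ℕ) + 1 = j) (h : w j < w i) :
    rOp n lam w = -(rCheck i j (lam (w j) - lam (w i)) * rOp n lam (w * Equiv.swap i j)) :=
  rPath_unique hlam w _ _ (rPath_rOp w) (RPath.step w _ i j hij h (rPath_rOp _))

theorem rOp_mul_swap (hlam : Function.Injective lam) {w : Equiv.Perm (Fin N)} {i j : Fin N}
    (hij : (i : ℕ) + 1 = j) (h : w i < w j) :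
    rOp n lam (w * Equiv.swap i j) = -(rCheck i j (lam (w i) - lam (w j)) * rOp n lam w) := by
  have := rOp_descent (n := n) hlam (w := w * Equiv.swap i j) hij (by simpa using h)
  simpa [mul_assoc] using this

/-- If `w⁻¹` reverses the order of `k` and `k + 1`, then `Ř(w)` is divisible on the right by
`Ř` of the transposition of `k` and `k + 1`. -/
theorem exists_rOp_eq_mul (hlam : Function.Injective lam) {k l : Fin N} (hkl : (k : ℕ) + 1 = l)
    (w : Equiv.Perm (Fin N)) (hw : w.symm l < w.symm k) :
    ∃ r, rOp n lam w = r * rOp n lam (Equiv.swap k l) := by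
  induction w using perm_wf.induction with
  | _ w ih =>
    -- Any descent other than the one with values l, k can be stripped off on the left. When no such
    -- descent exists, w turns out to be the transposition of k and l itself.
    by_cases hd : ∃ i j : Fin N, (i : ℕ) + 1 = j ∧ w j < w i ∧ ¬ (w i = l ∧ w j = k)
    · obtain ⟨i, j, hij, h, hne⟩ := hd
      obtain ⟨r, hr⟩ := ih _ (permKey_lt hij h) (by
        have hsymm : ∀ x, (w * Equiv.swap i j).symm x = Equiv.swap i j (w.symm x) := fun x => by
          rw [Equiv.symm_apply_eq]; simp
        rw [hsymm, hsymm]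
        -- Exchanging the neighbouring positions i, j affects the relative order of no other pair of
        -- positions, so l still stands before k.
        have : ¬ (w.symm l = i ∧ w.symm k = j) := fun ⟨h1, h2⟩ =>
          hne ⟨by rw [← h1]; simp, by rw [← h2]; simp⟩
        rw [Fin.lt_def] at hw ⊢
        simp only [Equiv.swap_apply_def, Fin.ext_iff] at this ⊢
        split_ifs <;> omega)
      exact ⟨_, by rw [rOp_descent hlam hij h, hr, ← mul_assoc, ← spinEnd_neg_mul]⟩
    · push Not at hd
      refine ⟨1, ?_⟩
      rw [one_mul]
      congr 1
      have hw1 : w ≠ 1 := by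
        rintro rfl
        have h1 : l < k := hw
        rw [Fin.lt_def] at h1
        omega
      obtain ⟨i, j, hij, h⟩ := exists_descent hw1
      obtain ⟨hi, hj⟩ := hd i j hij h
      -- A descent left over after sorting at i, j would yield a descent of w with values other than
      -- l, k. At the positions touching i or j this uses that k and l are consecutive: a value
      -- above k and different from l exceeds l, and a value below l and different from k lies below
      -- k.
      have key : w * Equiv.swap i j = 1 := by
        by_contra hne
        obtain ⟨p, q, hpq, hlt⟩ := exists_descent hne
        simp only [Equiv.Perm.mul_apply] at hlt
        have nij : i ≠ j := by rintro rfl; omega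
        have hkl' : k < l := Fin.lt_def.2 (by omega)
        by_cases hqi : q = i
        · have hpi : p ≠ i := by rintro rfl; rw [hqi] at hpq; omega
          have hpj : p ≠ j := by rintro rfl; rw [hqi] at hpq; omega
          rw [hqi, Equiv.swap_apply_left, Equiv.swap_apply_of_ne_of_ne hpi hpj, hj, Fin.lt_def] at hlt
          have hne : w p ≠ l := fun e => hpi (w.injective (e.trans hi.symm))
          rw [Ne, Fin.ext_iff] at hne
          exact hne (congrArg Fin.val (hd p i (hqi ▸ hpq) (by rw [hi, Fin.lt_def]; omega)).1)
        · by_cases hpj : p = j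
          · have hqj : q ≠ j := by rintro rfl; rw [hpj] at hpq; omega
            rw [hpj, Equiv.swap_apply_right, Equiv.swap_apply_of_ne_of_ne hqi hqj, hi, Fin.lt_def] at hlt
            have hne : w q ≠ k := fun e => hqj (w.injective (e.trans hj.symm))
            rw [Ne, Fin.ext_iff] at hne
            have := (hd j q (hpj ▸ hpq) (by rw [hj, Fin.lt_def]; omega)).1
            rw [hj] at this
            exact hkl'.ne this
          · by_cases hpi : p = i
            · have hqj : q = j := Fin.ext (by rw [← hpq, ← hij, hpi])
              rw [hqj, hpi, Equiv.swap_apply_left, Equiv.swap_apply_right, hi, hj] at hlt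
              exact hlt.asymm hkl'
            · have hqj : q ≠ j := fun e => hpi (Fin.ext (by rw [e] at hpq; omega))
              rw [Equiv.swap_apply_of_ne_of_ne hqi hqj, Equiv.swap_apply_of_ne_of_ne hpi hpj] at hlt
              exact hpi (w.injective ((hd p q hpq hlt).1.trans hi.symm))
      rw [mul_eq_one_iff_eq_inv, Equiv.swap_inv] at key
      rw [key] at hi hj ⊢
      rw [Equiv.swap_apply_left] at hi
      rw [Equiv.swap_apply_right] at hj
      rw [hi, hj]

/-- Iteration of the exchange relation along a sequence of descents that sorts w; each step permutes
two neighbouring parameters. -/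
theorem laxProd_mul_rOp (hlam : Function.Injective lam) (w : Equiv.Perm (Fin N)) (a b : Fin n)
    (s : ℕ) :
    PowerSeries.coeff s (laxProd n (lam ∘ w) a b) * rOp n lam w
      = rOp n lam w * PowerSeries.coeff s (laxProd n lam a b) := by
  induction w using perm_wf.induction with
  | _ w ih =>
    by_cases hw : w = 1
    · rw [hw, rOp_one hlam]
      exact (mul_one _).trans (one_mul _).symm
    · obtain ⟨i, j, hij, h⟩ := exists_descent hw
      have h1 := ih _ (permKey_lt hij h)
      have h2 := laxProd_mul_rCheck (n := n) (lam ∘ (w * Equiv.swap i j)) hij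
        (by simpa using hlam.ne h.ne) a b s
      have h3 : (lam ∘ (w * Equiv.swap i j)) ∘ Equiv.swap i j = lam ∘ w := by
        funext x; simp
      rw [h3] at h2
      simp only [Function.comp_apply, Equiv.Perm.mul_apply, Equiv.swap_apply_left,
        Equiv.swap_apply_right] at h2
      rw [rOp_descent hlam hij h, spinEnd_mul_neg, spinEnd_neg_mul, ← mul_assoc, h2, mul_assoc, h1,
        mul_assoc]

/-- At parameter difference 1 the right factor Ř((k,l)) provided by `exists_rOp_eq_mul` is -(1 +
P_{k,l}), which annihilates v. -/
theorem rOp_apply_eq_zero (hlam : Function.Injective lam) {k l : Fin N} (hkl : (k : ℕ) + 1 = l)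
    (hlam1 : lam k - lam l = 1) {v : Spin n N} (hv : permOp k l v = -v) {w : Equiv.Perm (Fin N)}
    (hw : w.symm l < w.symm k) : rOp n lam w v = 0 := by
  obtain ⟨r, hr⟩ := exists_rOp_eq_mul (n := n) hlam hkl w hw
  have h1 := rOp_mul_swap (n := n) hlam (w := 1) hkl (Fin.lt_def.2 (by simp; omega))
  rw [one_mul, rOp_one hlam, mul_one] at h1
  rw [hr, Module.End.mul_apply, h1]
  simp [rCheck, hlam1, hv]

end RFamily


/-! ### Relations between Dunkl operators, permutations and the raising operator -/

section DunklRelations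

variable {N : ℕ}

/-- The variable `z_i`. -/
def zvar (i : Fin N) : Laurent N := mono (Pi.single i 1)

theorem mono_mul_mono (η θ : Fin N → ℤ) : mono η * mono θ = mono (η + θ) := by
  simp [mono, AddMonoidAlgebra.single_mul_single]

/-- The permutation of variables which sends `z^η` to `z^(η ∘ τ)`. -/
def relabel (τ : Equiv.Perm (Fin N)) : Laurent N →ₐ[ℂ] Laurent N :=
  AddMonoidAlgebra.mapDomainAlgHom ℂ ℂ
    { toFun := fun η => η ∘ τ, map_zero' := rfl, map_add' := fun _ _ => rfl : (Fin N → ℤ) →+ (Fin N → ℤ) }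

theorem relabel_mono (τ : Equiv.Perm (Fin N)) (η : Fin N → ℤ) : relabel τ (mono η) = mono (η ∘ τ) := by
  simp [relabel, mono]

theorem relabel_relabel (σ τ : Equiv.Perm (Fin N)) (f : Laurent N) :
    relabel σ (relabel τ f) = relabel (τ * σ) f := by
  suffices h : (relabel σ).toLinearMap ∘ₗ (relabel τ).toLinearMap = (relabel (τ * σ)).toLinearMap from
    LinearMap.congr_fun h f
  exact onMono_ext fun η => by simp [relabel_mono, Function.comp_assoc]

theorem relabel_one (f : Laurent N) : relabel 1 f = f := by
  suffices h : (relabel 1).toLinearMap = (LinearMap.id : Module.End ℂ (Laurent N)) from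
    LinearMap.congr_fun h f
  exact onMono_ext fun η => by simp [relabel_mono]

theorem exchOp_eq_relabel (i j : Fin N) (f : Laurent N) : exchOp i j f = relabel (Equiv.swap i j) f := by
  suffices h : exchOp i j = (relabel (Equiv.swap i j)).toLinearMap from LinearMap.congr_fun h f
  exact onMono_ext fun η => by simp [relabel_mono, exchOp, onMono_mono]

theorem relabel_zvar (τ : Equiv.Perm (Fin N)) (i : Fin N) : relabel τ (zvar i) = zvar (τ⁻¹ i) := by
  rw [zvar, relabel_mono, zvar]
  congr 1
  funext k
  simp only [Function.comp_apply, Pi.single_apply, Equiv.Perm.eq_inv_iff_eq]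

theorem exchOp_exchOp (i j : Fin N) (f : Laurent N) : exchOp i j (exchOp i j f) = f := by
  rw [exchOp_eq_relabel, exchOp_eq_relabel, relabel_relabel, Equiv.swap_mul_self, relabel_one]

theorem mono_injective : Function.Injective (mono : (Fin N → ℤ) → Laurent N) := by
  intro η θ h
  exact (AddMonoidAlgebra.of_injective (R := ℂ)) h

/-- Laurent polynomials form a domain, so identities for the divided differences `quotOp` may be
verified after multiplication by z_j - z_i. -/
theorem zvar_sub_ne_zero {i j : Fin N} (h : i ≠ j) : zvar j - zvar i ≠ 0 := by
  intro e
  have := congrFun (mono_injective (sub_eq_zero.1 e)) i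
  simp [h] at this

theorem zvar_sub_mul_quotOp {i j : Fin N} (h : i ≠ j) (f : Laurent N) :
    (zvar j - zvar i) * quotOp i j f = zvar j * (exchOp i j f - f) :=
  sub_mul_quotOp h f

theorem relabel_quotOp (τ : Equiv.Perm (Fin N)) {i j : Fin N} (h : i ≠ j) (f : Laurent N) :
    relabel τ (quotOp i j f) = quotOp (τ⁻¹ i) (τ⁻¹ j) (relabel τ f) := by
  have h' : τ⁻¹ i ≠ τ⁻¹ j := τ⁻¹.injective.ne h
  refine mul_left_cancel₀ (zvar_sub_ne_zero h') ?_
  rw [zvar_sub_mul_quotOp h', ← relabel_zvar, ← relabel_zvar, ← map_sub, ← map_mul,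
    zvar_sub_mul_quotOp h, map_mul, map_sub, exchOp_eq_relabel, exchOp_eq_relabel, relabel_relabel,
    relabel_relabel, Equiv.swap_mul_eq_mul_swap]

/-- The rational coefficients satisfy z_j/(z_j - z_i) + z_i/(z_i - z_j) = 1. -/
theorem quotOp_add_quotOp {i j : Fin N} (h : i ≠ j) (f : Laurent N) :
    quotOp i j f + quotOp j i f = exchOp i j f - f := by
  refine mul_left_cancel₀ (zvar_sub_ne_zero h) ?_
  have h1 := zvar_sub_mul_quotOp h f
  have h2 := zvar_sub_mul_quotOp h.symm f
  have h3 : exchOp j i f = exchOp i j f := by rw [exchOp_eq_relabel, exchOp_eq_relabel, Equiv.swap_comm]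
  rw [h3] at h2
  linear_combination h1 - h2

theorem zvar_mul_quotOp {i j : Fin N} (h : i ≠ j) (f : Laurent N) :
    zvar j * quotOp j i f = -(zvar i * quotOp i j f) := by
  refine mul_left_cancel₀ (zvar_sub_ne_zero h) ?_
  have h1 := zvar_sub_mul_quotOp h f
  have h2 := zvar_sub_mul_quotOp h.symm f
  have h3 : exchOp j i f = exchOp i j f := by rw [exchOp_eq_relabel, exchOp_eq_relabel, Equiv.swap_comm]
  rw [h3] at h2
  linear_combination zvar i * h1 - zvar j * h2

/-- Since K_{i,j} z_j = z_i K_{i,j}, one has (K - 1)(z_j f) = z_i (K - 1) f - (z_j - z_i) f. -/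
theorem quotOp_zvar_mul {i j : Fin N} (h : i ≠ j) (f : Laurent N) :
    quotOp i j (zvar j * f) = zvar i * quotOp i j f - zvar j * f := by
  refine mul_left_cancel₀ (zvar_sub_ne_zero h) ?_
  have h1 := zvar_sub_mul_quotOp h f
  rw [zvar_sub_mul_quotOp h]
  rw [exchOp_eq_relabel] at h1 ⊢
  rw [map_mul, relabel_zvar, Equiv.swap_inv, Equiv.swap_apply_right]
  linear_combination -zvar i * h1

theorem quotOp_zvar_mul_of_ne {i j k : Fin N} (h : i ≠ j) (hi : k ≠ i) (hj : k ≠ j) (f : Laurent N) :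
    quotOp i j (zvar k * f) = zvar k * quotOp i j f := by
  refine mul_left_cancel₀ (zvar_sub_ne_zero h) ?_
  have h1 := zvar_sub_mul_quotOp h f
  rw [zvar_sub_mul_quotOp h]
  rw [exchOp_eq_relabel] at h1 ⊢
  rw [map_mul, relabel_zvar, Equiv.swap_inv, Equiv.swap_apply_of_ne_of_ne hi hj]
  linear_combination -zvar k * h1

theorem relabel_eulerOp (τ : Equiv.Perm (Fin N)) (i : Fin N) (f : Laurent N) :
    relabel τ (eulerOp i f) = eulerOp (τ⁻¹ i) (relabel τ f) := by
  suffices h : (relabel τ).toLinearMap ∘ₗ eulerOp i = eulerOp (τ⁻¹ i) ∘ₗ (relabel τ).toLinearMap from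
    LinearMap.congr_fun h f
  exact onMono_ext fun η => by simp [relabel_mono, eulerOp, onMono_mono]

theorem eulerOp_zvar_mul (i k : Fin N) (f : Laurent N) :
    eulerOp i (zvar k * f) = zvar k * (eulerOp i f + if i = k then f else 0) := by
  suffices h : eulerOp i ∘ₗ LinearMap.mulLeft ℂ (zvar k) = LinearMap.mulLeft ℂ (zvar k) ∘ₗ
      (eulerOp i + if i = k then LinearMap.id else 0) by
    have := LinearMap.congr_fun h f
    split_ifs at this ⊢ <;> simpa using this
  refine onMono_ext fun η => ?_
  split_ifs with h
  · subst h
    simp [eulerOp, onMono_mono, zvar, mono_mul_mono, mul_add, add_smul, add_comm]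
  · simp [eulerOp, onMono_mono, zvar, mono_mul_mono, h]

theorem dunkl_apply (α : ℝ) (i : Fin N) (f : Laurent N) :
    dunkl α i f = (α : ℂ) • eulerOp i f - ((i : ℕ) + 1 : ℂ) • f
      + ∑ j with i < j, quotOp i j f - ∑ j with j < i, quotOp j i f := by
  simp [dunkl, LinearMap.sum_apply]

theorem relabel_dunkl (α : ℝ) (τ : Equiv.Perm (Fin N)) (i : Fin N) (f : Laurent N) :
    relabel τ (dunkl α i f) = (α : ℂ) • eulerOp (τ⁻¹ i) (relabel τ f)
      - ((i : ℕ) + 1 : ℂ) • relabel τ f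
      + ∑ j with i < j, quotOp (τ⁻¹ i) (τ⁻¹ j) (relabel τ f)
      - ∑ j with j < i, quotOp (τ⁻¹ j) (τ⁻¹ i) (relabel τ f) := by
  rw [dunkl_apply, map_sub, map_add, map_sub, map_smul, map_smul, map_sum, map_sum, relabel_eulerOp]
  congr 1
  · congr 1
    exact Finset.sum_congr rfl fun j hj => relabel_quotOp τ (Finset.mem_filter.1 hj).2.ne f
  · exact Finset.sum_congr rfl fun j hj => relabel_quotOp τ (Finset.mem_filter.1 hj).2.ne f

/-- Positions i and i + 1 lie on the same side of k, so their exchange preserves both ranges of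
summation in d_k. -/
theorem exchOp_dunkl_of_ne (α : ℝ) {i j k : Fin N} (hij : (i : ℕ) + 1 = j) (hi : k ≠ i) (hj : k ≠ j)
    (f : Laurent N) : exchOp i j (dunkl α k f) = dunkl α k (exchOp i j f) := by
  have hlt : ∀ l, k < l ↔ k < Equiv.swap i j l := by
    intro l
    rw [Ne, Fin.ext_iff] at hi hj
    simp only [Equiv.swap_apply_def, Fin.lt_def]
    split_ifs with h1 h2 <;> subst_vars <;> omega
  have hlt' : ∀ l, l < k ↔ Equiv.swap i j l < k := by
    intro l
    rw [Ne, Fin.ext_iff] at hi hj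
    simp only [Equiv.swap_apply_def, Fin.lt_def]
    split_ifs with h1 h2 <;> subst_vars <;> omega
  have h1 : ∀ g : Laurent N, ∑ l with k < l, quotOp k (Equiv.swap i j l) g
      = ∑ l with k < l, quotOp k l g := fun g =>
    Finset.sum_equiv (Equiv.swap i j) (fun l => by simpa using hlt l) fun l _ => rfl
  have h2 : ∀ g : Laurent N, ∑ l with l < k, quotOp (Equiv.swap i j l) k g
      = ∑ l with l < k, quotOp l k g := fun g =>
    Finset.sum_equiv (Equiv.swap i j) (fun l => by simpa using hlt' l) fun l _ => rfl
  rw [exchOp_eq_relabel, exchOp_eq_relabel, relabel_dunkl, dunkl_apply, Equiv.swap_inv,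
    Equiv.swap_apply_of_ne_of_ne hi hj, h1, h2]

/-- The degenerate affine Hecke relation K d_i = d_{i+1} K + 1. With g = K f, the constants -i and
-(i + 1) leave a term g, and the summands linking i and j combine to (K - 1) g by
`quotOp_add_quotOp`; together they give K g = f. -/
theorem exchOp_dunkl (α : ℝ) {i j : Fin N} (hij : (i : ℕ) + 1 = j) (f : Laurent N) :
    exchOp i j (dunkl α i f) = dunkl α j (exchOp i j f) + f := by
  have nij : i ≠ j := by rintro rfl; omega
  have h1 : (Finset.univ.filter fun l => i < l) = insert j (Finset.univ.filter fun l => j < l) := by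
    ext l
    simp only [Finset.mem_filter, Finset.mem_univ, true_and, Finset.mem_insert, Fin.lt_def, Fin.ext_iff]
    omega
  have h2 : (Finset.univ.filter fun l => l < j) = insert i (Finset.univ.filter fun l => l < i) := by
    ext l
    simp only [Finset.mem_filter, Finset.mem_univ, true_and, Finset.mem_insert, Fin.lt_def, Fin.ext_iff]
    omega
  have h3 := quotOp_add_quotOp nij (exchOp i j f)
  rw [exchOp_exchOp] at h3
  rw [exchOp_eq_relabel] at h3 ⊢
  rw [exchOp_eq_relabel, relabel_dunkl, dunkl_apply, Equiv.swap_inv,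
    Equiv.swap_apply_left, h1, h2, Finset.sum_insert (by simp), Finset.sum_insert (by simp),
    Equiv.swap_apply_right]
  have h4 : ∀ g : Laurent N, ∑ l with j < l, quotOp j (Equiv.swap i j l) g = ∑ l with j < l, quotOp j l g := by
    intro g
    refine Finset.sum_congr rfl fun l hl => ?_
    have hl := (Finset.mem_filter.1 hl).2
    rw [Fin.lt_def] at hl
    rw [Equiv.swap_apply_of_ne_of_ne] <;> rintro rfl <;> omega
  have h5 : ∀ g : Laurent N, ∑ l with l < i, quotOp (Equiv.swap i j l) j g = ∑ l with l < i, quotOp l j g := by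
    intro g
    refine Finset.sum_congr rfl fun l hl => ?_
    have hl := (Finset.mem_filter.1 hl).2
    rw [Fin.lt_def] at hl
    rw [Equiv.swap_apply_of_ne_of_ne] <;> rintro rfl <;> omega
  have h6 : ((j : ℕ) : ℂ) = (i : ℕ) + 1 := by rw [← hij]; push_cast; rfl
  rw [h4, h5, h6]
  set g := relabel (Equiv.swap i j) f
  have h7 : f = quotOp i j g + quotOp j i g + g := by rw [h3]; abel
  rw [h7]
  module

theorem dunkl_exchOp_left (α : ℝ) {i j : Fin N} (hij : (i : ℕ) + 1 = j) (f : Laurent N) :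
    dunkl α i (exchOp i j f) = exchOp i j (dunkl α j f) + f := by
  have h := congrArg (exchOp i j) (exchOp_dunkl α hij (exchOp i j f))
  simpa only [exchOp_exchOp, map_add] using h

theorem dunkl_exchOp_right (α : ℝ) {i j : Fin N} (hij : (i : ℕ) + 1 = j) (f : Laurent N) :
    dunkl α j (exchOp i j f) = exchOp i j (dunkl α i f) - f := by
  rw [exchOp_dunkl α hij]
  abel

/-- The operator `f(z_1, …, z_{k+1}) ↦ z_{k+1} f(z_{k+1}, z_1, …, z_k)`. -/
def raise {k : ℕ} (f : Laurent (k + 1)) : Laurent (k + 1) :=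
  zvar (Fin.last k) * relabel (finRotate (k + 1)) f

theorem finRotate_castSucc {k : ℕ} (l : Fin k) : finRotate (k + 1) l.castSucc = l.succ := by
  rw [finRotate_apply, Fin.coeSucc_eq_succ]

theorem finRotate_inv_zero (k : ℕ) : (finRotate (k + 1))⁻¹ 0 = Fin.last k :=
  Equiv.Perm.inv_eq_iff_eq.2 finRotate_last.symm

theorem finRotate_inv_succ {k : ℕ} (l : Fin k) : (finRotate (k + 1))⁻¹ l.succ = l.castSucc :=
  Equiv.Perm.inv_eq_iff_eq.2 (finRotate_castSucc l).symm

/-- The rotation moves index 0 to the last place, so its term passes from the sum over smaller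
indices to the sum over larger ones. Moving z_N through the new term produces an extra -z_N g, where
g is the rotated f; it accounts for the different constants in d_i and d_{i+1}. -/
theorem raise_dunkl_succ (α : ℝ) {k : ℕ} (i : Fin k) (f : Laurent (k + 1)) :
    dunkl α i.castSucc (raise f) = raise (dunkl α i.succ f) := by
  have hne : ∀ l : Fin k, Fin.last k ≠ l.castSucc := fun l => (Fin.castSucc_lt_last l).ne'
  rw [raise, raise, relabel_dunkl, dunkl_apply]
  simp only [Finset.sum_filter, eulerOp_zvar_mul, if_neg (hne i).symm]
  rw [Fin.sum_univ_castSucc, Fin.sum_univ_castSucc, Fin.sum_univ_succ, Fin.sum_univ_succ]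
  simp only [finRotate_inv_zero, finRotate_inv_succ, Fin.castSucc_lt_castSucc_iff, Fin.succ_lt_succ_iff, Fin.castSucc_lt_last,
    Fin.succ_pos, if_true, Fin.not_lt_zero, if_false, Fin.not_lt.2 (Fin.le_last _)]
  set g := relabel (finRotate (k + 1)) f
  have h1 : ∀ l, (if i < l then quotOp i.castSucc l.castSucc (zvar (Fin.last k) * g) else 0)
      = zvar (Fin.last k) * if i < l then quotOp i.castSucc l.castSucc g else 0 := by
    intro l
    split_ifs with h
    · exact quotOp_zvar_mul_of_ne (by simpa using h.ne) (hne i) (hne l) g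
    · simp
  have h2 : ∀ l, (if l < i then quotOp l.castSucc i.castSucc (zvar (Fin.last k) * g) else 0)
      = zvar (Fin.last k) * if l < i then quotOp l.castSucc i.castSucc g else 0 := by
    intro l
    split_ifs with h
    · exact quotOp_zvar_mul_of_ne (by simpa using h.ne) (hne l) (hne i) g
    · simp
  rw [Finset.sum_congr rfl fun l _ => h1 l, Finset.sum_congr rfl fun l _ => h2 l,
    quotOp_zvar_mul (hne i).symm]
  have h3 := zvar_mul_quotOp (hne i).symm g
  simp only [mul_add, mul_sub, mul_smul_comm, h3, Finset.mul_sum, Fin.val_castSucc, Fin.val_succ]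
  push_cast
  simp only [mul_zero, add_zero, zero_add]
  module

/-- Here all k interaction terms change sides. Their k extra summands z_N g turn the constant -(k +
1) into -1, and the Euler operator acting on the new factor z_N contributes α. -/
theorem raise_dunkl_zero (α : ℝ) {k : ℕ} (f : Laurent (k + 1)) :
    dunkl α (Fin.last k) (raise f) = raise (dunkl α 0 f + (α : ℂ) • f) := by
  have hne : ∀ l : Fin k, Fin.last k ≠ l.castSucc := fun l => (Fin.castSucc_lt_last l).ne'
  rw [raise, raise, map_add, map_smul, relabel_dunkl, dunkl_apply]
  simp only [Finset.sum_filter, eulerOp_zvar_mul, if_true]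
  rw [Fin.sum_univ_castSucc, Fin.sum_univ_castSucc, Fin.sum_univ_succ, Fin.sum_univ_succ]
  simp only [finRotate_inv_zero, finRotate_inv_succ, Fin.castSucc_lt_last,
    Fin.succ_pos, if_true, Fin.not_lt_zero, if_false, Fin.not_lt.2 (Fin.le_last _), lt_irrefl]
  set g := relabel (finRotate (k + 1)) f
  have h1 : ∀ l : Fin k, quotOp l.castSucc (Fin.last k) (zvar (Fin.last k) * g)
      = -(zvar (Fin.last k) * quotOp (Fin.last k) l.castSucc g) - zvar (Fin.last k) * g := by
    intro l
    rw [quotOp_zvar_mul (hne l).symm, zvar_mul_quotOp (hne l).symm, neg_neg]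
  rw [Finset.sum_congr rfl fun l _ => h1 l, Finset.sum_sub_distrib, Finset.sum_neg_distrib,
    Finset.sum_const_zero, Finset.sum_const, Finset.card_univ, Fintype.card_fin, ← Nat.cast_smul_eq_nsmul ℂ]
  simp only [mul_add, mul_sub, mul_smul_comm, Finset.mul_sum, Fin.val_last, Fin.val_zero]
  push_cast
  simp only [mul_zero, add_zero, zero_add]
  module

theorem raise_injective {k : ℕ} : Function.Injective (raise (k := k)) := by
  intro f g h
  have hz : zvar (Fin.last k) ≠ 0 := by
    rw [zvar, mono]
    simp
  have := congrArg (relabel (finRotate (k + 1))⁻¹) (mul_left_cancel₀ hz h)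
  simpa [relabel_relabel, relabel_one] using this

theorem raise_surjective {k : ℕ} : Function.Surjective (raise (k := k)) := by
  intro f
  refine ⟨relabel (finRotate (k + 1))⁻¹ (mono (-Pi.single (Fin.last k) 1) * f), ?_⟩
  rw [raise, relabel_relabel, inv_mul_cancel, relabel_one, zvar, ← mul_assoc, mono_mul_mono]
  have : mono (Pi.single (Fin.last k) 1 + -Pi.single (Fin.last k) 1) = (1 : Laurent (k + 1)) := by
    rw [add_neg_cancel]
    rfl
  rw [this, one_mul]

end DunklRelations


/-! ### Compositions: ranks, weights and sorting -/

section Compositions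

variable {N : ℕ}

/-- The position `j` comes before the position `i`, or is equal to it, when the entries of `η` are
sorted in a stable way into decreasing order. -/
def Prec (η : Fin N → ℤ) (j i : Fin N) : Prop := η i < η j ∨ (η i = η j ∧ j ≤ i)

instance (η : Fin N → ℤ) (j i : Fin N) : Decidable (Prec η j i) :=
  inferInstanceAs (Decidable (_ ∨ _))

/-- The rank of the position `i` in the stable sorting of `η` into decreasing order. -/
def rk (η : Fin N → ℤ) (i : Fin N) : ℕ := Finset.card {j | Prec η j i}

/-- The spectrum `α η_i - rk η i` of the Dunkl operators. -/
def wt (α : ℝ) (η : Fin N → ℤ) (i : Fin N) : ℝ := α * η i - rk η i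

theorem Prec.refl (η : Fin N → ℤ) (i : Fin N) : Prec η i i := Or.inr ⟨rfl, le_rfl⟩

theorem Prec.trans {η : Fin N → ℤ} {i j k : Fin N} (h : Prec η i j) (h' : Prec η j k) :
    Prec η i k := by
  unfold Prec at *
  rcases h with h | ⟨h, hl⟩ <;> rcases h' with h' | ⟨h', hl'⟩
  · exact Or.inl (h'.trans h)
  · exact Or.inl (h' ▸ h)
  · exact Or.inl (h ▸ h')
  · exact Or.inr ⟨h'.trans h, hl.trans hl'⟩

theorem Prec.antisymm {η : Fin N → ℤ} {i j : Fin N} (h : Prec η i j) (h' : Prec η j i) : i = j := by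
  unfold Prec at *
  rcases h with h | ⟨h, hl⟩ <;> rcases h' with h' | ⟨h', hl'⟩
  · exact (h.asymm h').elim
  · exact (h.ne' h').elim
  · exact (h'.ne' h).elim
  · exact le_antisymm hl hl'

theorem Prec.total (η : Fin N → ℤ) (i j : Fin N) : Prec η i j ∨ Prec η j i := by
  unfold Prec
  rcases lt_trichotomy (η i) (η j) with h | h | h
  · exact Or.inr (Or.inl h)
  · rcases le_total i j with h' | h'
    · exact Or.inl (Or.inr ⟨h.symm, h'⟩)
    · exact Or.inr (Or.inr ⟨h, h'⟩)
  · exact Or.inl (Or.inl h)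

theorem rk_lt_rk {η : Fin N → ℤ} {i j : Fin N} (h : Prec η j i) (hne : j ≠ i) : rk η j < rk η i := by
  refine Finset.card_lt_card ⟨fun k hk => ?_, fun hs => ?_⟩
  · simp only [Finset.mem_filter, Finset.mem_univ, true_and] at hk ⊢
    exact hk.trans h
  · have := hs (show i ∈ _ by simpa using Prec.refl η i)
    simp only [Finset.mem_filter, Finset.mem_univ, true_and] at this
    exact hne (h.antisymm this)

theorem rk_injective (η : Fin N → ℤ) : Function.Injective (rk η) := by
  intro i j h
  by_contra hne
  rcases Prec.total η i j with h' | h'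
  · exact (rk_lt_rk h' hne).ne h
  · exact (rk_lt_rk h' (Ne.symm hne)).ne' h

/-- Going down the stable sorting, α η_i weakly decreases since α > 0, and -rk strictly decreases.
The order of the weights is therefore the reverse of `Prec`, and no two weights coincide. -/
theorem wt_le_iff {α : ℝ} (hα : 0 < α) (η : Fin N → ℤ) (i j : Fin N) :
    wt α η i ≤ wt α η j ↔ Prec η j i := by
  have key : ∀ {i j}, Prec η j i → j ≠ i → wt α η i < wt α η j := by
    intro i j h hne
    have h1 : (rk η j : ℝ) < rk η i := by exact_mod_cast rk_lt_rk h hne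
    have h2 : η i ≤ η j := by
      rcases h with h | h
      · exact h.le
      · exact h.1.le
    have h3 : (η i : ℝ) ≤ η j := by exact_mod_cast h2
    have := mul_le_mul_of_nonneg_left h3 hα.le
    unfold wt
    linarith
  constructor
  · intro h
    by_cases hij : j = i
    · rw [hij]; exact Prec.refl _ _
    · rcases Prec.total η i j with h' | h'
      · exact absurd (key h' (Ne.symm hij)) (not_lt.2 h)
      · exact h'
  · intro h
    by_cases hij : j = i
    · rw [hij]
    · exact (key h hij).le

theorem wt_injective_pos {α : ℝ} (hα : 0 < α) (η : Fin N → ℤ) : Function.Injective (wt α η) := by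
  intro i j h
  exact (((wt_le_iff hα η i j).1 h.le).antisymm ((wt_le_iff hα η j i).1 h.ge)).symm

/-- The weight of a composition determines it, also after a permutation. -/
theorem eq_of_wt_eq {α : ℝ} (hα : 0 < α) {η θ : Fin N → ℤ} (τ : Equiv.Perm (Fin N))
    (h : ∀ i, wt α θ i = wt α η (τ i)) : θ = η ∘ τ ∧ ∀ i, rk θ i = rk η (τ i) := by
  -- The ranks count comparisons of weights, hence agree; removing them from the weights leaves α
  -- times the entries.
  have h1 : ∀ i, rk θ i = rk η (τ i) := by
    intro i
    refine Finset.card_equiv τ fun j => ?_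
    simp only [Finset.mem_filter, Finset.mem_univ, true_and]
    rw [← wt_le_iff hα, ← wt_le_iff hα, h, h]
  refine ⟨funext fun i => ?_, h1⟩
  have := h i
  unfold wt at this
  rw [h1] at this
  have := mul_left_cancel₀ hα.ne' (sub_left_injective this)
  exact_mod_cast this

/-- Only a tie between the two neighbouring positions could be resolved differently after the
exchange, and the hypothesis excludes such a tie. -/
theorem wt_comp_swap {α : ℝ} {η : Fin N → ℤ} {i j : Fin N} (hij : (i : ℕ) + 1 = j) (h : η i ≠ η j)
    (k : Fin N) : wt α (η ∘ Equiv.swap i j) k = wt α η (Equiv.swap i j k) := by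
  unfold wt
  congr 2
  refine Finset.card_equiv (Equiv.swap i j) fun l => ?_
  simp only [Finset.mem_filter, Finset.mem_univ, true_and]
  simp only [Prec, Function.comp_apply]
  refine or_congr_right (and_congr_right fun he => ?_)
  simp only [Equiv.swap_apply_def, Fin.ext_iff, Fin.le_def] at he ⊢
  have hji : ¬ (j : ℕ) = i := by omega
  split_ifs at he ⊢ <;> omega

theorem wt_zero (α : ℝ) (i : Fin N) : wt α (0 : Fin N → ℤ) i = -((i : ℕ) + 1) := by
  have : rk (0 : Fin N → ℤ) i = (i : ℕ) + 1 := by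
    rw [rk, ← Fin.card_Iic]
    congr 1
    ext j
    simp [Prec]
  simp [wt, this]

/-- The composition `(η_2, …, η_N, η_1 + 1)`. -/
def rotRaise {k : ℕ} (η : Fin (k + 1) → ℤ) : Fin (k + 1) → ℤ :=
  η ∘ finRotate (k + 1) + Pi.single (Fin.last k) 1

theorem rotRaise_castSucc {k : ℕ} (η : Fin (k + 1) → ℤ) (i : Fin k) :
    rotRaise η i.castSucc = η i.succ := by
  simp [rotRaise, (Fin.castSucc_lt_last i).ne]

theorem rotRaise_last {k : ℕ} (η : Fin (k + 1) → ℤ) : rotRaise η (Fin.last k) = η 0 + 1 := by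
  simp [rotRaise]

/-- In first position the entry η 0 precedes all entries equal to it. In last position it would lose
these ties, and the added 1 makes up exactly for that. -/
theorem prec_rotRaise {k : ℕ} (η : Fin (k + 1) → ℤ) (i j : Fin (k + 1)) :
    Prec (rotRaise η) j i ↔ Prec η (finRotate (k + 1) j) (finRotate (k + 1) i) := by
  unfold Prec
  induction i using Fin.lastCases with
  | last =>
    induction j using Fin.lastCases with
    | last => simp
    | cast j =>
      rw [finRotate_castSucc, finRotate_last, rotRaise_last, rotRaise_castSucc]
      have h1 : j.castSucc ≤ Fin.last k := Fin.le_last _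
      have h2 : ¬ j.succ ≤ 0 := by simp
      simp only [h1, h2, and_true, and_false, or_false]
      omega
  | cast i =>
    induction j using Fin.lastCases with
    | last =>
      rw [finRotate_castSucc, finRotate_last, rotRaise_last, rotRaise_castSucc]
      have h1 : ¬ Fin.last k ≤ i.castSucc := by simp
      have h2 : 0 ≤ i.succ := Fin.zero_le _
      simp only [h1, h2, and_true, and_false, or_false]
      omega
    | cast j =>
      simp only [finRotate_castSucc, rotRaise_castSucc, Fin.castSucc_le_castSucc_iff,
        Fin.succ_le_succ_iff]

theorem rk_rotRaise {k : ℕ} (η : Fin (k + 1) → ℤ) (i : Fin (k + 1)) :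
    rk (rotRaise η) i = rk η (finRotate (k + 1) i) :=
  Finset.card_equiv (finRotate (k + 1)) fun j => by simpa using prec_rotRaise η i j

theorem wt_rotRaise_castSucc {α : ℝ} {k : ℕ} (η : Fin (k + 1) → ℤ) (i : Fin k) :
    wt α (rotRaise η) i.castSucc = wt α η i.succ := by
  rw [wt, wt, rk_rotRaise, rotRaise_castSucc, finRotate_castSucc]

theorem wt_rotRaise_last {α : ℝ} {k : ℕ} (η : Fin (k + 1) → ℤ) :
    wt α (rotRaise η) (Fin.last k) = wt α η 0 + α := by
  rw [wt, wt, rk_rotRaise, rotRaise_last, finRotate_last]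
  push_cast
  ring

theorem mem_permSet_iff {m : Fin N → ℤ} {σ : Equiv.Perm (Fin N)} :
    σ ∈ permSet m ↔ ∀ i, (σ i : ℕ) + 1 = rk (m ∘ σ) i := by
  have : ∀ i, rk (m ∘ σ) i = Finset.card {j | j ≤ i ∧ m (σ i) ≤ m (σ j)}
      + Finset.card {j | i < j ∧ m (σ i) < m (σ j)} := by
    intro i
    rw [rk, ← Finset.card_union_of_disjoint]
    · congr 1
      ext j
      simp only [Finset.mem_filter, Finset.mem_univ, true_and, Finset.mem_union]
      simp only [Prec, Function.comp_apply]
      rcases le_or_gt j i with h | h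
      · rw [le_iff_lt_or_eq (a := m (σ i))]
        simp only [h, true_and, and_true, not_lt.2 h, false_and, or_false]
      · simp only [h, true_and, not_le.2 h, false_and, false_or, and_false, or_false]
    · rw [Finset.disjoint_left]
      intro j hj hj'
      simp only [Finset.mem_filter, Finset.mem_univ, true_and] at hj hj'
      exact hj.1.not_gt hj'.1
  simp [permSet, this]

theorem xi_eq_wt (α : ℝ) {m : Fin N → ℤ} {σ : Equiv.Perm (Fin N)} (hσ : σ ∈ permSet m) (i : Fin N) :
    xi α m σ i = (wt α (m ∘ σ) i : ℝ) := by
  have : ((σ i : ℕ) + 1 : ℂ) = (rk (m ∘ σ) i : ℕ) := by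
    rw [← mem_permSet_iff.1 hσ i]; push_cast; rfl
  rw [xi, wt, this]
  push_cast
  rfl

/-- Thus S^m consists of the shortest representatives modulo the stabiliser of m, one for each
rearrangement of m. -/
theorem mem_permSet_iff_of_antitone {m : Fin N → ℤ} (hm : Antitone m) {σ : Equiv.Perm (Fin N)} :
    σ ∈ permSet m ↔ ∀ i j, i < j → m (σ i) = m (σ j) → σ i < σ j := by
  rw [mem_permSet_iff]
  constructor
  · intro h i j hij he
    have := rk_lt_rk (η := m ∘ σ) (Or.inr ⟨he.symm, hij.le⟩ : Prec (m ∘ σ) i j) hij.ne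
    rw [← h, ← h] at this
    exact Fin.lt_def.2 (by omega)
  · intro h i
    have key : ∀ j, Prec (m ∘ σ) j i ↔ σ j ≤ σ i := by
      intro j
      constructor
      · rintro (h1 | ⟨h1, h2⟩)
        · by_contra hlt
          exact h1.not_ge (hm (not_le.1 hlt).le)
        · rcases h2.eq_or_lt with rfl | h2
          · exact le_rfl
          · exact (h j i h2 h1.symm).le
      · intro hle
        rcases (hm hle).lt_or_eq with h1 | h1
        · exact Or.inl h1
        · refine Or.inr ⟨h1, ?_⟩
          by_contra hlt
          exact (h i j (not_le.1 hlt) h1).not_ge hle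
    have : (Finset.univ.filter fun j => Prec (m ∘ σ) j i) = (Finset.Iic (σ i)).map σ.symm.toEmbedding := by
      ext j
      simp [key]
    rw [rk, this, Finset.card_map, Fin.card_Iic]

/-- The decreasing rearrangement of `η`. -/
def srt (η : Fin N → ℤ) : Fin N → ℤ := η ∘ Tuple.sort fun i => -η i

theorem antitone_srt (η : Fin N → ℤ) : Antitone (srt η) := fun i j h => by
  have := Tuple.monotone_sort (fun i => -η i) h
  simpa [srt] using this

theorem srt_comp {m : Fin N → ℤ} (hm : Antitone m) (σ : Equiv.Perm (Fin N)) : srt (m ∘ σ) = m := by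
  have h := Tuple.unique_monotone (f := fun i => -m (σ i)) (σ := Tuple.sort fun i => -(m ∘ σ) i)
    (τ := σ⁻¹) (fun i j h => by
      have := antitone_srt (m ∘ σ) h
      simpa [srt] using this) (fun i j h => by simpa using hm h)
  funext i
  have := congrFun h i
  simpa [srt] using this

theorem exists_permSet_srt (η : Fin N → ℤ) : ∃ σ ∈ permSet (srt η), η = srt η ∘ σ := by
  refine ⟨(Tuple.sort fun i => -η i)⁻¹, ?_, ?_⟩
  · rw [mem_permSet_iff_of_antitone (antitone_srt η)]
    intro i j hij he
    have h := (Tuple.eq_sort_iff (f := fun i => -η i) (σ := Tuple.sort fun i => -η i)).1 rfl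
    by_contra hlt
    simp only [srt, Function.comp_apply, Equiv.Perm.coe_inv, Equiv.apply_symm_apply] at he
    have hne := (Tuple.sort fun i => -η i)⁻¹.injective.ne hij.ne
    have := h.2 _ _ ((not_lt.1 hlt).lt_of_ne hne.symm) (by simpa using he.symm)
    simp only [Equiv.Perm.coe_inv, Equiv.apply_symm_apply] at this
    exact this.asymm hij
  · funext i
    simp [srt]

theorem permSet_eq_of_comp_eq {m : Fin N → ℤ} {σ τ : Equiv.Perm (Fin N)} (hσ : σ ∈ permSet m)
    (hτ : τ ∈ permSet m) (h : m ∘ σ = m ∘ τ) : σ = τ := by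
  refine Equiv.ext fun i => Fin.ext ?_
  have h1 := mem_permSet_iff.1 hσ i
  have h2 := mem_permSet_iff.1 hτ i
  rw [h] at h1
  omega

theorem one_mem_permSet {m : Fin N → ℤ} (hm : Antitone m) : 1 ∈ permSet m :=
  (mem_permSet_iff_of_antitone hm).2 fun _ _ h _ => h

theorem mul_swap_mem_permSet {m : Fin N → ℤ} (hm : Antitone m) {σ : Equiv.Perm (Fin N)}
    (hσ : σ ∈ permSet m) {i j : Fin N} (hij : (i : ℕ) + 1 = j) (h : m (σ i) ≠ m (σ j)) :
    σ * Equiv.swap i j ∈ permSet m := by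
  rw [mem_permSet_iff_of_antitone hm] at hσ ⊢
  intro k l hkl he
  refine hσ _ _ ?_ he
  by_contra hlt
  simp only [Equiv.Perm.mul_apply, Equiv.swap_apply_def, Fin.ext_iff, Fin.lt_def] at he hlt hkl
  have hji : ¬ (j : ℕ) = i := by omega
  split_ifs at he hlt <;> omega

/-- A label strictly between σ(i) and σ(i+1) would carry the same value of m by monotonicity, hence
occupy a position strictly between i and i + 1. This is the source of ξ_i - ξ_{i+1} = 1 at equal
neighbours. -/
theorem permSet_succ_of_eq {m : Fin N → ℤ} (hm : Antitone m) {σ : Equiv.Perm (Fin N)}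
    (hσ : σ ∈ permSet m) {i j : Fin N} (hij : (i : ℕ) + 1 = j) (h : m (σ i) = m (σ j)) :
    (σ i : ℕ) + 1 = σ j := by
  have h1 := (mem_permSet_iff_of_antitone hm).1 hσ i j (Fin.lt_def.2 (by omega)) h
  by_contra hne
  rw [Fin.lt_def] at h1
  obtain ⟨k, hk⟩ : ∃ k, σ k = ⟨σ i + 1, by omega⟩ := σ.surjective _
  have hk1 : m (σ k) = m (σ i) := by
    refine le_antisymm (hm ?_) (h.trans_le (hm ?_))
    · rw [hk, Fin.le_def]; simp
    · rw [hk, Fin.le_def]; simp; omega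
  have hki : ¬ k ≤ i := by
    intro hle
    rcases hle.eq_or_lt with rfl | hlt
    · have := congrArg Fin.val hk
      simp at this
    · have := (mem_permSet_iff_of_antitone hm).1 hσ k i hlt hk1
      rw [hk, Fin.lt_def] at this
      simp at this
  have hkj : ¬ j ≤ k := by
    intro hle
    rcases hle.eq_or_lt with rfl | hlt
    · rw [hk] at hne
      exact hne rfl
    · have := (mem_permSet_iff_of_antitone hm).1 hσ j k hlt (hk1.trans h).symm
      rw [hk, Fin.lt_def] at this
      simp at this
      omega
  rw [Fin.le_def] at hki hkj
  omega

end Compositions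


/-! ### The order on compositions -/

section Order

variable {N : ℕ}

theorem eq_of_partialSum_eq {a b : Fin N → ℤ}
    (h : ∀ k, ∑ i with i ≤ k, a i = ∑ i with i ≤ k, b i) : a = b := by
  have key : ∀ k, a k = b k := by
    intro k
    induction k using WellFoundedLT.induction with
    | _ k ih =>
      have h1 : (Finset.univ.filter fun i => i ≤ k) = insert k (Finset.univ.filter fun i => i < k) := by
        ext i
        simp only [Finset.mem_filter, Finset.mem_univ, true_and, Finset.mem_insert]
        exact le_iff_eq_or_lt
      have h2 := h k
      rw [h1, Finset.sum_insert (by simp), Finset.sum_insert (by simp),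
        Finset.sum_congr rfl fun i hi => ih i (by simpa using hi)] at h2
      exact add_right_cancel h2
  exact funext key

theorem DominanceLT.trans {a b c : Fin N → ℤ} (h : DominanceLT a b) (h' : DominanceLT b c) :
    DominanceLT a c := by
  refine ⟨fun e => h.1 ?_, h.2.1.trans h'.2.1, fun k => (h.2.2 k).trans (h'.2.2 k)⟩
  subst e
  exact eq_of_partialSum_eq fun k => le_antisymm (h.2.2 k) (h'.2.2 k)

/-- The order on compositions underlying the triangularity of the Dunkl operators. -/
def CompLT (η' η : Fin N → ℤ) : Prop :=
  DominanceLT (srt η') (srt η) ∨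
    srt η' = srt η ∧ ∃ k, η k < η' k ∧ ∀ l, k < l → η l = η' l

theorem CompLT.irrefl (η : Fin N → ℤ) : ¬ CompLT η η := by
  rintro (h | ⟨-, k, hk, -⟩)
  · exact h.1 rfl
  · exact lt_irrefl _ hk

theorem CompLT.trans {a b c : Fin N → ℤ} (h : CompLT a b) (h' : CompLT b c) : CompLT a c := by
  rcases h with h | ⟨he, k, hk, hl⟩ <;> rcases h' with h' | ⟨he', k', hk', hl'⟩
  · exact Or.inl (h.trans h')
  · exact Or.inl (he' ▸ h)
  · exact Or.inl (he ▸ h')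
  · refine Or.inr ⟨he.trans he', max k k', ?_, fun l hlt => ?_⟩
    · rcases lt_trichotomy k k' with hlt | rfl | hlt
      · rw [max_eq_right hlt.le, ← hl _ hlt]; exact hk'
      · rw [max_self]; exact hk'.trans hk
      · rw [max_eq_left hlt.le, hl' _ hlt]; exact hk
    · rw [max_lt_iff] at hlt
      rw [hl' l hlt.2, hl l hlt.1]

theorem CompLT.asymm {a b : Fin N → ℤ} (h : CompLT a b) (h' : CompLT b a) : False :=
  CompLT.irrefl a (h.trans h')

theorem exists_maximal_of_isStrictOrder {X : Type*} (r : X → X → Prop) [IsStrictOrder X r]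
    (S : Finset X) {x : X} (hx : x ∈ S) :
    ∃ y ∈ S, (x = y ∨ r x y) ∧ ∀ z ∈ S, ¬ r y z := by
  let _ := partialOrderOfSO r
  obtain ⟨y, hle, hmax⟩ := S.exists_le_maximal hx
  refine ⟨y, hmax.1, hle, fun z hz hlt => irrefl_of r y ?_⟩
  rcases hmax.2 hz (Or.inr hlt) with rfl | h
  · exact hlt
  · exact trans_of r hlt h

instance : IsStrictOrder (Fin N → ℤ) CompLT where
  irrefl := CompLT.irrefl
  trans _ _ _ := CompLT.trans

theorem pairLT_iff_compLT {m' m : Fin N → ℤ} {σ' σ : Equiv.Perm (Fin N)} (hm' : Antitone m')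
    (hm : Antitone m) : PairLT m' σ' m σ ↔ CompLT (m' ∘ σ') (m ∘ σ) := by
  rw [PairLT, CompLT, srt_comp hm', srt_comp hm]
  refine or_congr_right (and_congr_right fun h => ?_)
  subst h
  simp only [Function.comp_apply, sub_neg, sub_eq_zero]

/-- The rearrangement inequality for m against the indicator of the positions up to k. -/
theorem partialSum_comp_perm_le {m : Fin N → ℤ} (hm : Antitone m) (τ : Equiv.Perm (Fin N)) (k : Fin N) :
    ∑ i with i ≤ k, m (τ i) ≤ ∑ i with i ≤ k, m i := by
  have hmono : Monovary m fun i => if i ≤ k then (1 : ℤ) else 0 := by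
    intro i j hij
    refine hm ?_
    by_contra h
    rw [not_le] at h
    dsimp only at hij
    split_ifs at hij with h1 h2 h2
    · exact lt_irrefl _ hij
    · exact absurd hij (by norm_num)
    · exact h1 (h.le.trans h2)
    · exact lt_irrefl _ hij
  simpa [Finset.sum_filter] using hmono.sum_comp_perm_mul_le_sum_mul (σ := τ)

/-- Moving two entries of a composition towards each other. -/
def squeeze (η : Fin N → ℤ) (i j : Fin N) (c : ℤ) : Fin N → ℤ :=
  Function.update (Function.update η i c) j (η i + η j - c)

theorem squeeze_comm (η : Fin N → ℤ) {i j : Fin N} (h : i ≠ j) (c : ℤ) :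
    squeeze η j i (η i + η j - c) = squeeze η i j c := by
  rw [squeeze, squeeze, Function.update_comm h]
  congr 1
  ring

theorem squeeze_apply_left (η : Fin N → ℤ) {i j : Fin N} (h : i ≠ j) (c : ℤ) :
    squeeze η i j c i = c := by
  rw [squeeze, Function.update_of_ne h, Function.update_self]

theorem squeeze_apply_right (η : Fin N → ℤ) (i j : Fin N) (c : ℤ) :
    squeeze η i j c j = η i + η j - c := by
  rw [squeeze, Function.update_self]

theorem squeeze_apply_of_ne (η : Fin N → ℤ) {i j k : Fin N} (hi : k ≠ i) (hj : k ≠ j) (c : ℤ) :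
    squeeze η i j c k = η k := by
  rw [squeeze, Function.update_of_ne hj, Function.update_of_ne hi]

theorem squeeze_self_left (η : Fin N → ℤ) (i j : Fin N) : squeeze η i j (η i) = η := by
  simp [squeeze]

theorem squeeze_self_right (η : Fin N → ℤ) {i j : Fin N} (h : i ≠ j) :
    squeeze η i j (η j) = η ∘ Equiv.swap i j := by
  funext k
  by_cases hj : k = j
  · subst hj; simp [squeeze_apply_right]
  · by_cases hi : k = i
    · subst hi; simp [squeeze_apply_left _ h]
    · simp [squeeze_apply_of_ne _ hi hj, Equiv.swap_apply_of_ne_of_ne hi hj]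

theorem sum_srt (η : Fin N → ℤ) (F : ℤ → ℤ) : ∑ i, F (srt η i) = ∑ i, F (η i) :=
  Equiv.sum_comp (Tuple.sort fun i => -η i) fun i => F (η i)

/-- The squeezed composition is a convex combination of η and η with i, j exchanged. Partial sums of
its sorted form are thus averages of partial sums of rearrangements of η, each bounded by that of
`srt η`. -/
theorem dominanceLT_squeeze (η : Fin N → ℤ) {i j : Fin N} (hij : i ≠ j) {c : ℤ} (h1 : η j < c)
    (h2 : c < η i) : DominanceLT (srt (squeeze η i j c)) (srt η) := by
  have hsum : ∀ F : ℤ → ℤ, ∑ k, (F (squeeze η i j c k) - F (η k))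
      = (F c - F (η i)) + (F (η i + η j - c) - F (η j)) := by
    intro F
    rw [Fintype.sum_eq_add i j hij fun k hk => by rw [squeeze_apply_of_ne _ hk.1 hk.2, sub_self],
      squeeze_apply_left _ hij, squeeze_apply_right]
  refine ⟨fun h => ?_, ?_, fun k => ?_⟩
  -- The sum of squares changes by 2 (c - η i)(c - η j) < 0, so the two sorted forms differ.
  · have := hsum fun x => x ^ 2
    rw [Finset.sum_sub_distrib, ← sum_srt (squeeze η i j c) fun x => x ^ 2,
      ← sum_srt η fun x => x ^ 2, h, sub_self] at this
    nlinarith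
  · have := hsum fun x => x
    rw [Finset.sum_sub_distrib, ← sum_srt (squeeze η i j c) fun x => x,
      ← sum_srt η fun x => x] at this
    linarith
  · obtain ⟨σ, -, hσ⟩ := exists_permSet_srt η
    set ρ := Tuple.sort fun k => -squeeze η i j c k
    have key : ∀ x, (η i - η j) * squeeze η i j c x
        = (c - η j) * η x + (η i - c) * η (Equiv.swap i j x) := by
      intro x
      by_cases hj : x = j
      · subst hj
        rw [squeeze_apply_right, Equiv.swap_apply_right]; ring
      · by_cases hi : x = i
        · subst hi
          rw [squeeze_apply_left _ hij, Equiv.swap_apply_left]; ring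
        · rw [squeeze_apply_of_ne _ hi hj, Equiv.swap_apply_of_ne_of_ne hi hj]; ring
    have e1 : ∑ x with x ≤ k, η (ρ x) ≤ ∑ x with x ≤ k, srt η x := by
      have := partialSum_comp_perm_le (antitone_srt η) (σ * ρ) k
      conv_lhs => rw [hσ]
      exact this
    have e2 : ∑ x with x ≤ k, η (Equiv.swap i j (ρ x)) ≤ ∑ x with x ≤ k, srt η x := by
      have := partialSum_comp_perm_le (antitone_srt η) (σ * Equiv.swap i j * ρ) k
      conv_lhs => rw [hσ]
      exact this
    have e3 : (η i - η j) * ∑ x with x ≤ k, srt (squeeze η i j c) x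
        = (c - η j) * ∑ x with x ≤ k, η (ρ x)
          + (η i - c) * ∑ x with x ≤ k, η (Equiv.swap i j (ρ x)) := by
      rw [Finset.mul_sum, Finset.mul_sum, Finset.mul_sum, ← Finset.sum_add_distrib]
      exact Finset.sum_congr rfl fun x _ => key (ρ x)
    have hD : 0 < η i - η j := by linarith
    refine le_of_mul_le_mul_left ?_ hD
    rw [e3]
    have := mul_le_mul_of_nonneg_left e1 (by linarith : 0 ≤ c - η j)
    have := mul_le_mul_of_nonneg_left e2 (by linarith : 0 ≤ η i - c)
    linarith

theorem srt_comp_perm (η : Fin N → ℤ) (τ : Equiv.Perm (Fin N)) : srt (η ∘ τ) = srt η := by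
  obtain ⟨σ, -, hσ⟩ := exists_permSet_srt η
  conv_lhs => rw [hσ]
  exact srt_comp (antitone_srt η) (σ * τ)

theorem compLT_swap {η : Fin N → ℤ} {i j : Fin N} (hij : i < j) (h : η j < η i) :
    CompLT (η ∘ Equiv.swap i j) η := by
  refine Or.inr ⟨srt_comp_perm _ _, j, by simpa using h, fun l hl => ?_⟩
  simp [Equiv.swap_apply_of_ne_of_ne (hij.trans hl).ne' hl.ne']

/-- The Laurent polynomials all of whose monomials are lower than `z^η`. -/
def lowerSpace (η : Fin N → ℤ) : Submodule ℂ (Laurent N) where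
  carrier := {f | ∀ θ, ¬ CompLT θ η → f.coeff θ = 0}
  add_mem' hf hg θ h := by
    rw [AddMonoidAlgebra.coeff_add, Finsupp.add_apply, hf θ h, hg θ h, add_zero]
  zero_mem' _ _ := rfl
  smul_mem' c f hf θ h := by
    rw [AddMonoidAlgebra.coeff_smul, Finsupp.smul_apply, hf θ h, smul_zero]

theorem coeff_mono (η θ : Fin N → ℤ) : (mono η).coeff θ = if η = θ then 1 else 0 := by
  rw [mono, AddMonoidAlgebra.coeff_single, Finsupp.single_apply]

theorem mono_mem_lowerSpace {η θ : Fin N → ℤ} (h : CompLT θ η) : mono θ ∈ lowerSpace η := by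
  intro ζ hζ
  rw [coeff_mono, if_neg]
  rintro rfl
  exact hζ h

theorem quotOp_mono (i j : Fin N) (η : Fin N → ℤ) : quotOp i j (mono η)
    = ∑ c ∈ Finset.Ico (η j) (η i), mono (squeeze η i j c)
      - ∑ c ∈ Finset.Ico (η i) (η j), mono (squeeze η i j c) := by
  rw [quotOp, onMono_mono]
  rfl

/-- Interior exponents of the string are strictly dominated. As for the ends, the half-open interval
contains z^η itself, with coefficient -1, exactly when η i < η j; when η j < η i it contains the
exchanged monomial instead, and that one is lower because i < j. -/
theorem quotOp_mono_mem {i j : Fin N} (hij : i < j) (η : Fin N → ℤ) :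
    quotOp i j (mono η) + (if η i < η j then (1 : ℂ) else 0) • mono η ∈ lowerSpace η := by
  rw [quotOp_mono]
  split_ifs with h
  · rw [Finset.Ico_eq_empty_of_le h.le, Finset.sum_empty, zero_sub,
      ← Finset.Ioo_insert_left h, Finset.sum_insert (by simp), squeeze_self_left]
    have : -(mono η + ∑ c ∈ Finset.Ioo (η i) (η j), mono (squeeze η i j c)) + (1 : ℂ) • mono η
        = -∑ c ∈ Finset.Ioo (η i) (η j), mono (squeeze η i j c) := by
      rw [one_smul]; abel
    rw [this]
    refine neg_mem (sum_mem fun c hc => mono_mem_lowerSpace (Or.inl ?_))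
    rw [Finset.mem_Ioo] at hc
    rw [← squeeze_comm η hij.ne]
    exact dominanceLT_squeeze η hij.ne' (by linarith) (by linarith)
  · rw [zero_smul, add_zero, Finset.Ico_eq_empty_of_le (not_lt.1 h), Finset.sum_empty, sub_zero]
    refine sum_mem fun c hc => mono_mem_lowerSpace ?_
    rw [Finset.mem_Ico] at hc
    rcases hc.1.eq_or_lt with rfl | hlt
    · rw [squeeze_self_right _ hij.ne]
      exact compLT_swap hij hc.2
    · exact Or.inl (dominanceLT_squeeze η hij.ne hlt hc.2)

/-- The diagonal contributions of `quotOp_mono_mem` correct i + 1 by the number of larger entries to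
the right and of smaller entries to the left of position i, and the result is the rank. -/
theorem dunkl_mono_mem (α : ℝ) (i : Fin N) (η : Fin N → ℤ) :
    dunkl α i (mono η) - (wt α η i : ℂ) • mono η ∈ lowerSpace η := by
  have h1 : ∑ j with i < j, (quotOp i j (mono η) + (if η i < η j then (1 : ℂ) else 0) • mono η)
      ∈ lowerSpace η :=
    sum_mem fun j hj => quotOp_mono_mem (Finset.mem_filter.1 hj).2 η
  have h2 : ∑ j with j < i, (quotOp j i (mono η) + (if η j < η i then (1 : ℂ) else 0) • mono η)
      ∈ lowerSpace η :=
    sum_mem fun j hj => quotOp_mono_mem (Finset.mem_filter.1 hj).2 η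
  convert sub_mem h1 h2 using 1
  rw [Finset.sum_add_distrib, Finset.sum_add_distrib, ← Finset.sum_smul, ← Finset.sum_smul,
    dunkl_apply, eulerOp, onMono_mono]
  have h3 : (rk η i : ℂ) = (i : ℕ) + 1 + ∑ j with i < j, (if η i < η j then (1 : ℂ) else 0)
      - ∑ j with j < i, (if η j < η i then (1 : ℂ) else 0) := by
    have h4 : ((i : ℕ) + 1 : ℂ) = ∑ j, if j ≤ i then (1 : ℂ) else 0 := by
      rw [← Finset.sum_filter, Finset.sum_const, nsmul_one]
      have : (Finset.univ.filter fun j => j ≤ i) = Finset.Iic i := by ext; simp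
      rw [this, Fin.card_Iic]
      push_cast; rfl
    rw [h4, Finset.sum_filter, Finset.sum_filter, ← Finset.sum_add_distrib, ← Finset.sum_sub_distrib,
      rk, Finset.cast_card, Finset.sum_filter]
    refine Finset.sum_congr rfl fun j _ => ?_
    unfold Prec
    rcases lt_trichotomy i j with h | rfl | h
    · simp [h, h.not_ge, h.not_gt]
    · simp
    · rcases lt_trichotomy (η i) (η j) with h' | h' | h'
      · simp [h.le, h.not_gt, h, h', h'.not_gt]
      · simp [h.le, h.not_gt, h, h']
      · simp [h.le, h.not_gt, h, h'.not_gt, h'.ne', h']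
  rw [wt]
  push_cast
  rw [h3]
  module

end Order


/-! ### Joint eigenvectors of the Dunkl operators -/

section Eigen

variable {N : ℕ} {α : ℝ}

/-- `f` is a joint eigenvector (or zero) of the Dunkl operators with eigenvalues `ξ_i`. -/
def JointEigen (α : ℝ) (ξ : Fin N → ℂ) (f : Laurent N) : Prop := ∀ i, dunkl α i f = ξ i • f

theorem sum_coeff_smul_mono (f : Laurent N) : ∑ η ∈ f.coeff.support, f.coeff η • mono η = f := by
  conv_rhs => rw [← AddMonoidAlgebra.sum_coeff_single f]
  rw [Finsupp.sum]
  refine Finset.sum_congr rfl fun η _ => ?_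
  simp [mono]

/-- The off-diagonal part of d_i sends each monomial of f to strictly lower ones, none of which can
be z^θ. -/
theorem coeff_dunkl_of_maximal (i : Fin N) {f : Laurent N} {θ : Fin N → ℤ}
    (hθ : ∀ η ∈ f.coeff.support, ¬ CompLT θ η) :
    (dunkl α i f).coeff θ = (wt α θ i : ℂ) * f.coeff θ := by
  have h1 : dunkl α i f - ∑ η ∈ f.coeff.support, (f.coeff η * wt α η i) • mono η
      = ∑ η ∈ f.coeff.support, f.coeff η • (dunkl α i (mono η) - (wt α η i : ℂ) • mono η) := by
    conv_lhs => rw [← sum_coeff_smul_mono f]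
    rw [map_sum]
    simp only [map_smul, smul_sub, Finset.sum_sub_distrib, smul_smul, sum_coeff_smul_mono]
  have h2 := congrArg (fun g => g.coeff θ) h1
  simp only [AddMonoidAlgebra.coeff_sub, AddMonoidAlgebra.coeff_sum, Finsupp.sub_apply,
    Finsupp.finsetSum_apply, AddMonoidAlgebra.coeff_smul, Finsupp.smul_apply, coeff_mono,
    smul_eq_mul, mul_ite, mul_one, mul_zero, Finset.sum_ite_eq', Finsupp.mem_support_iff] at h2
  have h3 : ∑ η ∈ f.coeff.support, f.coeff η *
      ((dunkl α i (mono η)).coeff θ - if η = θ then (wt α η i : ℂ) else 0) = 0 := by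
    refine Finset.sum_eq_zero fun η hη => ?_
    have := dunkl_mono_mem α i η θ (hθ η hη)
    simp only [AddMonoidAlgebra.coeff_sub, Finsupp.sub_apply, AddMonoidAlgebra.coeff_smul,
      Finsupp.smul_apply, coeff_mono, smul_eq_mul, mul_ite, mul_one, mul_zero] at this
    rw [this, mul_zero]
  rw [h3, sub_eq_zero] at h2
  rw [h2]
  split_ifs with h
  · rw [mul_comm]
  · rw [not_not.1 h, mul_zero]

theorem JointEigen.eq_wt_of_maximal {ξ : Fin N → ℂ} {f : Laurent N} (hf : JointEigen α ξ f)
    {θ : Fin N → ℤ} (hθ : f.coeff θ ≠ 0) (hmax : ∀ η ∈ f.coeff.support, ¬ CompLT θ η) (i : Fin N) :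
    ξ i = (wt α θ i : ℂ) := by
  have := coeff_dunkl_of_maximal (α := α) i hmax
  rw [hf i, AddMonoidAlgebra.coeff_smul, Finsupp.smul_apply, smul_eq_mul] at this
  exact mul_right_cancel₀ hθ this

theorem eq_of_wt_cast_eq (hα : 0 < α) {η θ : Fin N → ℤ} (h : ∀ i, (wt α θ i : ℂ) = wt α η i) :
    θ = η :=
  (eq_of_wt_eq hα (1 : Equiv.Perm (Fin N)) fun i => by
    rw [Equiv.Perm.one_apply]; exact_mod_cast h i).1

/-- A joint eigenvector has the weight of a composition, which is its highest exponent. -/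
theorem JointEigen.exists_wt (hα : 0 < α) {ξ : Fin N → ℂ} {f : Laurent N} (hf : JointEigen α ξ f)
    (hf0 : f ≠ 0) : ∃ θ, (∀ i, ξ i = (wt α θ i : ℂ)) ∧ f.coeff θ ≠ 0 ∧
      ∀ η, f.coeff η ≠ 0 → η = θ ∨ CompLT η θ := by
  obtain ⟨η₀, h₀⟩ : f.coeff.support.Nonempty := by
    rw [Finsupp.support_nonempty_iff, Ne, AddMonoidAlgebra.coeff_eq_zero]
    exact hf0
  obtain ⟨θ, hθ, -, hmax⟩ := exists_maximal_of_isStrictOrder CompLT f.coeff.support h₀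
  have hwt := hf.eq_wt_of_maximal (Finsupp.mem_support_iff.1 hθ) hmax
  refine ⟨θ, hwt, Finsupp.mem_support_iff.1 hθ, fun η hη => ?_⟩
  -- Every exponent lies below some maximal one; all maximal exponents have the weight ξ, so they
  -- coincide with θ.
  obtain ⟨θ', hθ', hle, hmax'⟩ := exists_maximal_of_isStrictOrder CompLT f.coeff.support
    (Finsupp.mem_support_iff.2 hη)
  have hwt' := hf.eq_wt_of_maximal (Finsupp.mem_support_iff.1 hθ') hmax'
  rwa [eq_of_wt_cast_eq hα fun i => (hwt' i).symm.trans (hwt i)] at hle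

/-- The highest exponent of a nonzero eigenvector has its weight, hence would be η. Applied to
differences, this shows that eigenspaces are at most one-dimensional. -/
theorem JointEigen.eq_zero (hα : 0 < α) {η : Fin N → ℤ} {f : Laurent N}
    (hf : JointEigen α (fun i => (wt α η i : ℂ)) f) (h : f.coeff η = 0) : f = 0 := by
  by_contra hf0
  obtain ⟨θ, h1, h2, -⟩ := hf.exists_wt hα hf0
  rw [← eq_of_wt_cast_eq hα h1] at h2
  exact h2 h

theorem JointEigen.sub {ξ : Fin N → ℂ} {f g : Laurent N} (hf : JointEigen α ξ f)
    (hg : JointEigen α ξ g) : JointEigen α ξ (f - g) := fun i => by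
  rw [map_sub, hf i, hg i, smul_sub]

theorem JointEigen.smul {ξ : Fin N → ℂ} {f : Laurent N} (hf : JointEigen α ξ f) (c : ℂ) :
    JointEigen α ξ (c • f) := fun i => by
  rw [map_smul, hf i, smul_comm]

/-- The intertwiner `K_{i,i+1} - (ξ_i - ξ_{i+1})⁻¹`. -/
theorem JointEigen.exchange {ξ : Fin N → ℂ} {f : Laurent N} (hf : JointEigen α ξ f) {i j : Fin N}
    (hij : (i : ℕ) + 1 = j) (hξ : ξ i ≠ ξ j) :
    JointEigen α (ξ ∘ Equiv.swap i j) (exchOp i j f - (ξ i - ξ j)⁻¹ • f) := by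
  have hc : (ξ i - ξ j)⁻¹ * (ξ i - ξ j) = 1 := inv_mul_cancel₀ (sub_ne_zero.2 hξ)
  set c := (ξ i - ξ j)⁻¹
  have h1 : f = (c * (ξ i - ξ j)) • f := by rw [hc, one_smul]
  rw [← sub_eq_zero] at h1
  intro k
  rw [map_sub, map_smul, hf k, Function.comp_apply]
  by_cases hi : k = i
  · subst hi
    rw [dunkl_exchOp_left α hij, hf, map_smul, Equiv.swap_apply_left, ← sub_eq_zero, ← h1]
    module
  · by_cases hj : k = j
    · subst hj
      rw [dunkl_exchOp_right α hij, hf, map_smul, Equiv.swap_apply_right, ← sub_eq_zero,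
        ← neg_eq_zero, ← h1]
      module
    · rw [← exchOp_dunkl_of_ne α hij hi hj, hf, map_smul, Equiv.swap_apply_of_ne_of_ne hi hj]
      module

/-- Since K² = 1, the eigenvalues of K can only be 1 and -1. -/
theorem exchOp_sub_smul_ne_zero {f : Laurent N} (hf : f ≠ 0) (i j : Fin N) {c : ℂ} (hc : c ^ 2 ≠ 1) :
    exchOp i j f - c • f ≠ 0 := by
  intro h
  rw [sub_eq_zero] at h
  have h1 := congrArg (exchOp i j) h
  rw [exchOp_exchOp, map_smul, h, smul_smul] at h1
  have h2 : (1 - c ^ 2) • f = 0 := by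
    rw [sub_smul, one_smul, pow_two, ← h1, sub_self]
  rcases smul_eq_zero.1 h2 with h3 | h3
  · exact hc (sub_eq_zero.1 h3).symm
  · exact hf h3

/-- Both parts of the weight help: α (η i - η j) is positive and the ranks differ by at least one.
Hence the intertwiner for unequal entries never kills an eigenvector. -/
theorem one_lt_wt_sub (hα : 0 < α) {η : Fin N → ℤ} {i j : Fin N} (h : η j < η i) :
    1 < wt α η i - wt α η j := by
  have h1 := rk_lt_rk (Or.inl h : Prec η i j) (by rintro rfl; exact lt_irrefl _ h)
  have h2 : (rk η i : ℝ) + 1 ≤ rk η j := by exact_mod_cast h1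
  have h3 : (η j : ℝ) < η i := by exact_mod_cast h
  have := mul_lt_mul_of_pos_left h3 hα
  unfold wt
  linarith

theorem wt_sub_inv_sq_ne_one (hα : 0 < α) {η : Fin N → ℤ} {i j : Fin N} (h : η i ≠ η j) :
    ((wt α η i - wt α η j : ℂ)⁻¹) ^ 2 ≠ 1 := by
  intro h1
  have h2 : (wt α η i - wt α η j) ^ 2 = 1 := by
    rw [inv_pow, inv_eq_one] at h1
    exact_mod_cast h1
  rcases lt_or_gt_of_ne h with h3 | h3
  · have := one_lt_wt_sub hα h3
    nlinarith
  · have := one_lt_wt_sub hα h3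
    nlinarith

/-- The weight of `η` occurs in the joint spectrum. -/
def HasEigenvector (α : ℝ) (η : Fin N → ℤ) : Prop :=
  ∃ f : Laurent N, f ≠ 0 ∧ JointEigen α (fun i => (wt α η i : ℂ)) f

theorem hasEigenvector_zero : HasEigenvector α (0 : Fin N → ℤ) := by
  refine ⟨mono 0, by simp [mono], fun i => ?_⟩
  simp only [wt_zero]
  rw [dunkl_apply, eulerOp, onMono_mono]
  simp only [quotOp_mono, Pi.zero_apply, Finset.Ico_self, Finset.sum_empty, sub_zero,
    Finset.sum_const_zero]
  push_cast
  module

theorem HasEigenvector.comp_swap (hα : 0 < α) {η : Fin N → ℤ} (h : HasEigenvector α η) {i j : Fin N}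
    (hij : (i : ℕ) + 1 = j) : HasEigenvector α (η ∘ Equiv.swap i j) := by
  by_cases hne : η i = η j
  · rwa [← squeeze_self_right η (by rintro rfl; omega), ← hne, squeeze_self_left]
  · obtain ⟨f, hf0, hf⟩ := h
    have hw : (wt α η i : ℂ) ≠ wt α η j := by
      intro e
      have nij : i ≠ j := by rintro rfl; omega
      exact nij (wt_injective_pos hα η (by exact_mod_cast e))
    refine ⟨_, exchOp_sub_smul_ne_zero hf0 i j (wt_sub_inv_sq_ne_one hα hne), ?_⟩
    convert hf.exchange hij hw using 1
    funext k
    rw [wt_comp_swap hij hne]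
    rfl

theorem HasEigenvector.comp_perm (hα : 0 < α) {η : Fin N → ℤ} (h : HasEigenvector α η)
    (τ : Equiv.Perm (Fin N)) : HasEigenvector α (η ∘ τ) := by
  induction τ using perm_wf.induction with
  | _ τ ih =>
    by_cases hτ : τ = 1
    · rwa [hτ, Equiv.Perm.coe_one, Function.comp_id]
    · obtain ⟨i, j, hij, hlt⟩ := exists_descent hτ
      have := (ih _ (permKey_lt hij hlt)).comp_swap hα hij
      rwa [Function.comp_assoc, ← Equiv.Perm.coe_mul, mul_assoc, Equiv.swap_mul_self, mul_one] at this

/-- As `raise` is bijective, eigenvectors can be transported in both directions; the backward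
direction is what reaches negative exponents. -/
theorem hasEigenvector_rotRaise {k : ℕ} {η : Fin (k + 1) → ℤ} :
    HasEigenvector α (rotRaise η) ↔ HasEigenvector α η := by
  have key : ∀ f : Laurent (k + 1), JointEigen α (fun i => (wt α (rotRaise η) i : ℂ)) (raise f)
      ↔ JointEigen α (fun i => (wt α η i : ℂ)) f := by
    have hsmul : ∀ (c : ℂ) (g : Laurent (k + 1)), c • raise g = raise (c • g) := by
      intro c g
      simp [raise]
    intro f
    unfold JointEigen
    rw [Fin.forall_fin_succ', Fin.forall_fin_succ, and_comm]
    refine and_congr ?_ (forall_congr' fun i => ?_)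
    · rw [raise_dunkl_zero]
      dsimp only
      rw [wt_rotRaise_last, hsmul, raise_injective.eq_iff]
      push_cast
      rw [add_smul, add_left_inj]
    · rw [raise_dunkl_succ]
      dsimp only
      rw [wt_rotRaise_castSucc, hsmul, raise_injective.eq_iff]
  have h0 : ∀ f : Laurent (k + 1), raise f ≠ 0 ↔ f ≠ 0 := by
    intro f
    have : raise (0 : Laurent (k + 1)) = 0 := by simp [raise]
    exact not_congr ⟨fun h => raise_injective (h.trans this.symm), fun h => by rw [h, this]⟩
  constructor
  · rintro ⟨g, hg0, hg⟩
    obtain ⟨f, rfl⟩ := raise_surjective g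
    exact ⟨f, (h0 f).1 hg0, (key f).1 hg⟩
  · rintro ⟨f, hf0, hf⟩
    exact ⟨raise f, (h0 f).2 hf0, (key f).2 hf⟩

theorem hasEigenvector_comp_perm (hα : 0 < α) {η : Fin N → ℤ} (τ : Equiv.Perm (Fin N)) :
    HasEigenvector α (η ∘ τ) ↔ HasEigenvector α η := by
  refine ⟨fun h => ?_, fun h => h.comp_perm hα τ⟩
  have := h.comp_perm hα τ⁻¹
  rwa [Function.comp_assoc, ← Equiv.Perm.coe_mul, mul_inv_cancel, Equiv.Perm.coe_one,
    Function.comp_id] at this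

/-- Adding 1 at position i amounts to a rearrangement that brings this entry to the front, a
rotation with raising, and a rearrangement back. -/
theorem hasEigenvector_add_single (hα : 0 < α) (η : Fin N → ℤ) (i : Fin N) :
    HasEigenvector α (η + Pi.single i 1) ↔ HasEigenvector α η := by
  obtain _ | k := N
  · exact i.elim0
  have h1 : η + Pi.single i 1 = rotRaise (η ∘ (Equiv.swap i (Fin.last k) * (finRotate (k + 1))⁻¹))
      ∘ Equiv.swap i (Fin.last k) := by
    funext l
    simp only [rotRaise, Pi.add_apply, Function.comp_apply, Equiv.Perm.mul_apply, Equiv.Perm.coe_inv,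
      Equiv.symm_apply_apply, Equiv.swap_apply_self, Pi.single_apply]
    congr 1
    simp only [Equiv.swap_apply_eq_iff, Equiv.swap_apply_right]
  rw [h1, hasEigenvector_comp_perm hα, hasEigenvector_rotRaise, hasEigenvector_comp_perm hα]

theorem hasEigenvector_add_zsmul_single (hα : 0 < α) (η : Fin N → ℤ) (i : Fin N) (c : ℤ) :
    HasEigenvector α (η + c • Pi.single i 1) ↔ HasEigenvector α η := by
  induction c using Int.induction_on with
  | zero => simp
  | succ c ih => rw [add_smul, one_smul, ← add_assoc, hasEigenvector_add_single hα, ih]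
  | pred c ih =>
    rw [← ih, ← hasEigenvector_add_single hα _ i, add_assoc, sub_smul, one_smul, sub_add_cancel]

theorem hasEigenvector (hα : 0 < α) (η : Fin N → ℤ) : HasEigenvector α η := by
  have key : ∀ s : Finset (Fin N), HasEigenvector α (∑ i ∈ s, η i • (Pi.single i 1 : Fin N → ℤ)) := by
    intro s
    induction s using Finset.induction_on with
    | empty => exact hasEigenvector_zero
    | insert i s hi ih =>
      rw [Finset.sum_insert hi, add_comm, hasEigenvector_add_zsmul_single hα]
      exact ih
  convert key Finset.univ
  funext l
  simp [Finset.sum_apply, Pi.single_apply]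

end Eigen

/-! ### Non-symmetric Jack polynomials -/

section JackPolynomials

variable {N : ℕ} {α : ℝ} {m : Fin N → ℤ}

/-- Triangularity is automatic: by `JointEigen.exists_wt` all exponents of an eigenvector lie below
the one whose weight it has. -/
theorem isJack_iff (hα : 0 < α) (hm : Antitone m) {σ : Equiv.Perm (Fin N)} (hσ : σ ∈ permSet m)
    {f : Laurent N} : IsJack α m σ f ↔
      JointEigen α (fun i => (wt α (m ∘ σ) i : ℂ)) f ∧ f.coeff (m ∘ σ) = 1 := by
  constructor
  · exact fun h => ⟨fun i => by rw [h.eigen i, xi_eq_wt α hσ], h.leading⟩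
  · rintro ⟨hf, hlead⟩
    refine ⟨hlead, fun η hη hne => ?_, fun i => by rw [hf i, xi_eq_wt α hσ]⟩
    obtain ⟨θ, h1, -, h2⟩ := hf.exists_wt hα (by rintro rfl; simp at hlead)
    rw [← eq_of_wt_cast_eq hα h1] at h2
    obtain ⟨σ', hσ', h3⟩ := exists_permSet_srt η
    refine ⟨srt η, σ', antitone_srt η, hσ', h3, ?_⟩
    rw [pairLT_iff_compLT (antitone_srt η) hm, ← h3]
    exact (h2 η hη).resolve_left hne

theorem existsUnique_isJack (hα : 0 < α) (hm : Antitone m) {σ : Equiv.Perm (Fin N)}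
    (hσ : σ ∈ permSet m) : ∃! f, IsJack α m σ f := by
  simp only [isJack_iff hα hm hσ]
  obtain ⟨f, hf0, hf⟩ := hasEigenvector hα (m ∘ σ)
  have h0 : f.coeff (m ∘ σ) ≠ 0 := fun h => hf0 (hf.eq_zero hα h)
  refine ⟨(f.coeff (m ∘ σ))⁻¹ • f, ⟨hf.smul _, ?_⟩, fun g hg => ?_⟩
  · rw [AddMonoidAlgebra.coeff_smul, Finsupp.smul_apply, smul_eq_mul, inv_mul_cancel₀ h0]
  · refine sub_eq_zero.1 ((hg.1.sub (hf.smul _)).eq_zero hα ?_)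
    rw [AddMonoidAlgebra.coeff_sub, Finsupp.sub_apply, hg.2, AddMonoidAlgebra.coeff_smul,
      Finsupp.smul_apply, smul_eq_mul, inv_mul_cancel₀ h0, sub_self]

theorem isJack_jack (hα : 0 < α) (hm : Antitone m) {σ : Equiv.Perm (Fin N)} (hσ : σ ∈ permSet m) :
    IsJack α m σ (jack α m σ) :=
  Classical.epsilon_spec (existsUnique_isJack hα hm hσ).exists

theorem JointEigen.eq_jack (hα : 0 < α) (hm : Antitone m) {σ : Equiv.Perm (Fin N)}
    (hσ : σ ∈ permSet m) {f : Laurent N} (hf : JointEigen α (xi α m σ) f)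
    (h1 : f.coeff (m ∘ σ) = 1) : f = jack α m σ :=
  (existsUnique_isJack hα hm hσ).unique
    ((isJack_iff hα hm hσ).2 ⟨fun i => by rw [hf i, xi_eq_wt α hσ], h1⟩) (isJack_jack hα hm hσ)

theorem coeff_exchOp (i j : Fin N) (f : Laurent N) (θ : Fin N → ℤ) :
    (exchOp i j f).coeff θ = f.coeff (θ ∘ Equiv.swap i j) := by
  suffices h : Finsupp.lapply θ ∘ₗ (AddMonoidAlgebra.coeffLinearEquiv ℂ).toLinearMap ∘ₗ exchOp i j
      = Finsupp.lapply (θ ∘ Equiv.swap i j) ∘ₗ (AddMonoidAlgebra.coeffLinearEquiv ℂ).toLinearMap from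
    LinearMap.congr_fun h f
  refine onMono_ext fun η => ?_
  change (exchOp i j (mono η)).coeff θ = (mono η).coeff (θ ∘ Equiv.swap i j)
  rw [exchOp, onMono_mono, coeff_mono, coeff_mono]
  congr 1
  rw [eq_iff_iff]
  constructor
  · rintro rfl; funext x; simp
  · rintro rfl; funext x; simp

/-- With ξ_i - ξ_{i+1} = 1 the intertwiner becomes K - 1, and its image would have the weight of m ∘
σ with entries i and j exchanged. A composition with that weight would have to be m ∘ σ itself, with
equal ranks at i and j, which is impossible. -/
theorem exchOp_jack_of_eq (hα : 0 < α) (hm : Antitone m) {σ : Equiv.Perm (Fin N)}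
    (hσ : σ ∈ permSet m) {i j : Fin N} (hij : (i : ℕ) + 1 = j) (h : m (σ i) = m (σ j)) :
    exchOp i j (jack α m σ) = jack α m σ := by
  have hJ := isJack_jack hα hm hσ
  have hξ : xi α m σ i - xi α m σ j = 1 := by
    have := congrArg (fun k : ℕ => (k : ℂ)) (permSet_succ_of_eq hm hσ hij h)
    simp only [Nat.cast_add, Nat.cast_one] at this
    rw [xi, xi, h, ← this]
    ring
  have hne : xi α m σ i ≠ xi α m σ j := by
    rw [← sub_ne_zero, hξ]
    exact one_ne_zero
  have hK := JointEigen.exchange hJ.eigen hij hne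
  rw [hξ, inv_one, one_smul] at hK
  by_contra h0
  obtain ⟨θ, h1, -, -⟩ := hK.exists_wt hα (sub_ne_zero.2 h0)
  obtain ⟨h2, h3⟩ := eq_of_wt_eq hα (η := m ∘ σ) (θ := θ) (Equiv.swap i j) fun k => by
    have := h1 k
    rw [Function.comp_apply, xi_eq_wt α hσ] at this
    exact_mod_cast this.symm
  have nij : i ≠ j := by rintro rfl; omega
  have h4 : θ = m ∘ σ := by
    rw [h2, ← squeeze_self_right _ nij, ← show (m ∘ σ) i = (m ∘ σ) j from h, squeeze_self_left]
  have h5 := h3 i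
  rw [h4, Equiv.swap_apply_left] at h5
  exact nij (rk_injective _ h5)

theorem xi_sub_ne_zero (hα : 0 < α) {σ : Equiv.Perm (Fin N)} (hσ : σ ∈ permSet m)
    {i j : Fin N} (hij : i ≠ j) : xi α m σ i - xi α m σ j ≠ 0 := by
  rw [sub_ne_zero, xi_eq_wt α hσ, xi_eq_wt α hσ]
  exact fun h => hij (wt_injective_pos hα (m ∘ σ) (by exact_mod_cast h))

theorem xi_mul_swap (σ : Equiv.Perm (Fin N)) (i j : Fin N) :
    xi α m (σ * Equiv.swap i j) = xi α m σ ∘ Equiv.swap i j := rfl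

/-- The intertwiner maps Φ_{σ(i,i+1)} into the line of Φ_σ, and the factor is found from the
coefficient of z^{m∘σ}. -/
theorem exchOp_jack_mul_swap (hα : 0 < α) (hm : Antitone m) {σ : Equiv.Perm (Fin N)}
    (hσ : σ ∈ permSet m) {i j : Fin N} (hij : (i : ℕ) + 1 = j) (h : m (σ j) < m (σ i)) :
    exchOp i j (jack α m (σ * Equiv.swap i j))
      = jack α m σ - (xi α m σ i - xi α m σ j)⁻¹ • jack α m (σ * Equiv.swap i j) := by
  have nij : i ≠ j := by rintro rfl; omega
  have hσ' := mul_swap_mem_permSet hm hσ hij h.ne'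
  have hJ := isJack_jack hα hm hσ'
  have hne := sub_ne_zero.1 (xi_sub_ne_zero hα hσ' nij)
  have hK := JointEigen.exchange hJ.eigen hij hne
  have h1 : xi α m (σ * Equiv.swap i j) ∘ Equiv.swap i j = xi α m σ := by
    rw [xi_mul_swap]; funext k; simp
  have h2 : xi α m (σ * Equiv.swap i j) i - xi α m (σ * Equiv.swap i j) j
      = -(xi α m σ i - xi α m σ j) := by
    simp [xi_mul_swap]
  rw [h1, h2, inv_neg, neg_smul, sub_neg_eq_add] at hK
  -- The exponent m ∘ σ is higher than the leading exponent of Φ_{σ(i,i+1)}, so only the K-term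
  -- contributes, with coefficient 1.
  have hlow : (jack α m (σ * Equiv.swap i j)).coeff (m ∘ σ) = 0 := by
    by_contra h0
    have hlt : CompLT ((m ∘ σ) ∘ Equiv.swap i j) (m ∘ σ) :=
      compLT_swap (Fin.lt_def.2 (by omega)) h
    have h3 : m ∘ σ ≠ m ∘ (σ * Equiv.swap i j) := by
      intro e
      refine CompLT.irrefl (m ∘ σ) ?_
      conv_lhs => rw [e]
      exact hlt
    obtain ⟨m', σ', hm', -, h4, h5⟩ := hJ.triangular _ h0 h3
    rw [pairLT_iff_compLT hm' hm, ← h4] at h5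
    exact h5.asymm hlt
  rw [← hK.eq_jack hα hm hσ, add_sub_cancel_right]
  rw [AddMonoidAlgebra.coeff_add, Finsupp.add_apply, AddMonoidAlgebra.coeff_smul, Finsupp.smul_apply,
    hlow, smul_zero, add_zero, coeff_exchOp]
  exact hJ.leading

theorem exchOp_jack (hα : 0 < α) (hm : Antitone m) {σ : Equiv.Perm (Fin N)}
    (hσ : σ ∈ permSet m) {i j : Fin N} (hij : (i : ℕ) + 1 = j) (h : m (σ j) < m (σ i)) :
    exchOp i j (jack α m σ) = (xi α m σ i - xi α m σ j)⁻¹ • jack α m σ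
      + (1 - ((xi α m σ i - xi α m σ j)⁻¹) ^ 2) • jack α m (σ * Equiv.swap i j) := by
  have h1 := exchOp_jack_mul_swap hα hm hσ hij h
  have h2 := congrArg (exchOp i j) h1
  rw [exchOp_exchOp, map_sub, map_smul, h1] at h2
  rw [eq_comm, sub_eq_iff_eq_add] at h2
  rw [h2]
  module

/-- In a vanishing combination, take a maximal leading exponent among the nonzero terms. Another
term contains that monomial only if its own leading exponent is higher. -/
theorem linearIndependent_jack (hα : 0 < α) (hm : Antitone m) :
    LinearIndependent ℂ fun σ : permSet m => jack α m σ := by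
  rw [Fintype.linearIndependent_iff]
  intro c hc
  by_contra! hne
  obtain ⟨σ₀, h₀⟩ := hne
  classical
  obtain ⟨θ, hθ, -, hmax⟩ := exists_maximal_of_isStrictOrder CompLT
    ((Finset.univ.filter fun σ : permSet m => c σ ≠ 0).image fun σ => m ∘ σ.1)
    (Finset.mem_image_of_mem _ (Finset.mem_filter.2 ⟨Finset.mem_univ σ₀, h₀⟩))
  obtain ⟨σ, hσ, rfl⟩ := Finset.mem_image.1 hθ
  have h1 := congrArg (fun f => f.coeff (m ∘ σ.1)) hc
  simp only [AddMonoidAlgebra.coeff_sum, Finsupp.finsetSum_apply, AddMonoidAlgebra.coeff_smul,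
    Finsupp.smul_apply, AddMonoidAlgebra.coeff_zero, Finsupp.zero_apply] at h1
  rw [Finset.sum_eq_single σ, (isJack_jack hα hm σ.2).leading, smul_eq_mul, mul_one] at h1
  · exact (Finset.mem_filter.1 hσ).2 h1
  · intro τ _ hτ
    by_cases hcτ : c τ = 0
    · rw [hcτ, zero_smul]
    by_contra h2
    have h3 := (isJack_jack hα hm τ.2).triangular _ (right_ne_zero_of_smul h2)
      fun e => hτ (Subtype.ext (permSet_eq_of_comp_eq τ.2 σ.2 e.symm))
    obtain ⟨m', σ', hm', -, h4, h5⟩ := h3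
    rw [pairLT_iff_compLT hm' hm, ← h4] at h5
    exact hmax _ (Finset.mem_image_of_mem _ (Finset.mem_filter.2 ⟨Finset.mem_univ τ, hcτ⟩)) h5
  · exact fun h => (h (Finset.mem_univ _)).elim

end JackPolynomials


/-! ### The operators `Ř(σ)` and the map `U^m` -/

section RFamily

variable {n N : ℕ} {α : ℝ} {m : Fin N → ℤ}

theorem xi_eq_xi_one (σ : Equiv.Perm (Fin N)) (i : Fin N) : xi α m σ i = xi α m 1 (σ i) := rfl

theorem xi_eq_comp (σ : Equiv.Perm (Fin N)) : xi α m σ = xi α m 1 ∘ σ := rfl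

theorem xi_one_injective (hα : 0 < α) (hm : Antitone m) : Function.Injective (xi α m 1) := by
  intro i j h
  by_contra hij
  exact xi_sub_ne_zero hα (one_mem_permSet hm) hij (sub_eq_zero.2 h)

theorem isRFamily_rOp (hα : 0 < α) (hm : Antitone m) :
    IsRFamily (n := n) α m (rOp n (xi α m 1)) := by
  refine ⟨rOp_one (xi_one_injective hα hm), fun σ _ i j hij h => ?_⟩
  exact rOp_mul_swap (xi_one_injective hα hm) hij (hm.reflect_lt h)

/-- Sorting a descent of an element of S^m stays inside S^m, since at a descent the values of m
differ. So the recursion restricted to S^m reaches all of S^m. -/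
theorem IsRFamily.eq_rOp (hα : 0 < α) (hm : Antitone m)
    {R : Equiv.Perm (Fin N) → Module.End ℂ (Spin n N)} (hR : IsRFamily α m R)
    {σ : Equiv.Perm (Fin N)} (hσ : σ ∈ permSet m) : R σ = rOp n (xi α m 1) σ := by
  induction σ using perm_wf.induction with
  | _ σ ih =>
    by_cases h1 : σ = 1
    · rw [h1, hR.one, rOp_one (xi_one_injective hα hm)]
    · obtain ⟨i, j, hij, hlt⟩ := exists_descent h1
      have hne : m (σ i) ≠ m (σ j) := fun h =>
        hlt.asymm ((mem_permSet_iff_of_antitone hm).1 hσ i j (Fin.lt_def.2 (by omega)) h)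
      have hmem := mul_swap_mem_permSet hm hσ hij hne
      have hlt' : m ((σ * Equiv.swap i j) j) < m ((σ * Equiv.swap i j) i) := by
        simpa using lt_of_le_of_ne (hm hlt.le) hne
      have e1 := hR.step _ hmem i j hij hlt'
      have e2 := (isRFamily_rOp (n := n) hα hm).step _ hmem i j hij hlt'
      rw [ih _ (permKey_lt hij hlt) hmem, ← e2] at e1
      rwa [mul_assoc, Equiv.swap_mul_self, mul_one] at e1

theorem rFamily_eq_rOp (hα : 0 < α) (hm : Antitone m) {σ : Equiv.Perm (Fin N)}
    (hσ : σ ∈ permSet m) : rFamily n α m σ = rOp n (xi α m 1) σ :=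
  IsRFamily.eq_rOp hα hm (Classical.epsilon_spec ⟨_, isRFamily_rOp hα hm⟩) hσ

end RFamily

/-! ### Sums of Jack polynomials tensored with spin vectors; the fermionic condition as a recursion
-/

section JackSum

variable {n N : ℕ} {α : ℝ} {m : Fin N → ℤ}

/-- The vector `∑_{σ ∈ S^m} Φ_σ ⊗ w_σ`. -/
def jackSum (α : ℝ) (m : Fin N → ℤ) (w : Equiv.Perm (Fin N) → Spin n N) : State n N :=
  ∑ σ ∈ permSet m, jack α m σ ⊗ₜ[ℂ] w σ

theorem uMap_eq_jackSum (v : Spin n N) :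
    uMap n α m v = jackSum α m fun σ => rFamily n α m σ v := by
  simp [uMap, jackSum, LinearMap.sum_apply]

theorem jackSum_inj (hα : 0 < α) (hm : Antitone m) {w w' : Equiv.Perm (Fin N) → Spin n N} :
    jackSum α m w = jackSum α m w' ↔ ∀ σ ∈ permSet m, w σ = w' σ := by
  constructor
  · intro h τ hτ
    obtain ⟨g, hg⟩ := LinearMap.exists_leftInverse_of_injective
      (Finsupp.linearCombination ℂ fun σ : permSet m => jack α m σ)
      (LinearMap.ker_eq_bot.2 (linearIndependent_jack hα hm))
    have hg' : ∀ σ : permSet m, g (jack α m σ) = Finsupp.single σ 1 := by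
      intro σ
      have := LinearMap.congr_fun hg (Finsupp.single σ 1)
      simpa using this
    set f : State n N →ₗ[ℂ] Spin n N := (TensorProduct.lid ℂ (Spin n N)).toLinearMap ∘ₗ
      TensorProduct.map (Finsupp.lapply ⟨τ, hτ⟩ ∘ₗ g) LinearMap.id with hf
    have key : ∀ w, f (jackSum α m w) = w τ := by
      intro w
      rw [jackSum, map_sum, Finset.sum_eq_single τ]
      · simp [hf, hg' ⟨τ, hτ⟩]
      · intro σ hσ hne
        have : (⟨τ, hτ⟩ : permSet m) ≠ ⟨σ, hσ⟩ := fun e => hne (congrArg Subtype.val e).symm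
        simp [hf, hg' ⟨σ, hσ⟩, this.symm]
      · exact fun h => (h hτ).elim
    rw [← key w, h, key]
  · intro h
    exact Finset.sum_congr rfl fun σ hσ => by rw [h σ hσ]

theorem exists_jackSum {x : State n N}
    (hx : x ∈ LinearMap.range (TensorProduct.map (jackSpace α m).subtype
      (LinearMap.id : Module.End ℂ (Spin n N)))) : ∃ w, x = jackSum α m w := by
  have hadd : ∀ w w' : Equiv.Perm (Fin N) → Spin n N,
      jackSum α m w + jackSum α m w' = jackSum α m (w + w') := by
    intro w w'
    simp [jackSum, TensorProduct.tmul_add, Finset.sum_add_distrib]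
  obtain ⟨y, rfl⟩ := hx
  induction y with
  | zero => exact ⟨0, by simp [jackSum]⟩
  | add y y' h h' =>
    obtain ⟨w, hw⟩ := h
    obtain ⟨w', hw'⟩ := h'
    exact ⟨w + w', by rw [map_add, hw, hw', hadd]⟩
  | tmul f v =>
    obtain ⟨f, hf⟩ := f
    simp only [TensorProduct.map_tmul, Submodule.subtype_apply, LinearMap.id_apply]
    induction hf using Submodule.span_induction with
    | mem f hf =>
      obtain ⟨σ, hσ, rfl⟩ := hf
      refine ⟨Pi.single σ v, ?_⟩
      rw [jackSum, Finset.sum_eq_single σ, Pi.single_eq_same]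
      · intro τ _ h
        rw [Pi.single_eq_of_ne h, TensorProduct.tmul_zero]
      · exact fun h => (h hσ).elim
    | zero => exact ⟨0, by simp [jackSum]⟩
    | add f g _ _ h h' =>
      obtain ⟨w, hw⟩ := h
      obtain ⟨w', hw'⟩ := h'
      exact ⟨w + w', by rw [TensorProduct.add_tmul, hw, hw', hadd]⟩
    | smul c f _ h =>
      obtain ⟨w, hw⟩ := h
      refine ⟨c • w, ?_⟩
      rw [← TensorProduct.smul_tmul', hw]
      simp [jackSum, Finset.smul_sum]

theorem jackSum_mem_range (w : Equiv.Perm (Fin N) → Spin n N) :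
    jackSum α m w ∈ LinearMap.range (TensorProduct.map (jackSpace α m).subtype
      (LinearMap.id : Module.End ℂ (Spin n N))) := by
  refine Submodule.sum_mem _ fun σ hσ => ?_
  exact ⟨⟨jack α m σ, Submodule.subset_span ⟨σ, hσ, rfl⟩⟩ ⊗ₜ w σ, by simp⟩

theorem xi_sub_eq_one (hm : Antitone m) {σ : Equiv.Perm (Fin N)} (hσ : σ ∈ permSet m)
    {i j : Fin N} (hij : (i : ℕ) + 1 = j) (h : m (σ i) = m (σ j)) :
    xi α m σ i - xi α m σ j = 1 := by
  have := congrArg (fun k : ℕ => (k : ℂ)) (permSet_succ_of_eq hm hσ hij h)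
  simp only [Nat.cast_add, Nat.cast_one] at this
  rw [xi, xi, h, ← this]
  ring

theorem map_exchOp_permOp_jackSum (hα : 0 < α) (hm : Antitone m)
    (w : Equiv.Perm (Fin N) → Spin n N) {i j : Fin N} (hij : (i : ℕ) + 1 = j) :
    TensorProduct.map (exchOp i j) (permOp (n := n) i j) (jackSum α m w)
      = jackSum α m fun σ => (xi α m σ i - xi α m σ j)⁻¹ • permOp i j (w σ)
        + (if m (σ i) = m (σ j) then 0 else if m (σ j) < m (σ i) then 1
            else 1 - ((xi α m σ i - xi α m σ j)⁻¹) ^ 2 : ℂ)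
          • permOp i j (w (σ * Equiv.swap i j)) := by
  have h1 : ∀ σ ∈ permSet m, exchOp i j (jack α m σ)
      = (xi α m σ i - xi α m σ j)⁻¹ • jack α m σ
        + (if m (σ i) = m (σ j) then 0 else if m (σ j) < m (σ i)
            then 1 - ((xi α m σ i - xi α m σ j)⁻¹) ^ 2 else 1 : ℂ)
          • jack α m (σ * Equiv.swap i j) := by
    intro σ hσ
    split_ifs with h h'
    · have hξ := xi_sub_eq_one (α := α) hm hσ hij h
      rw [exchOp_jack_of_eq hα hm hσ hij h, hξ]
      simp
    · exact exchOp_jack hα hm hσ hij h'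
    · have hσ' := mul_swap_mem_permSet hm hσ hij h
      have := exchOp_jack_mul_swap hα hm hσ' hij
        (by simpa using lt_of_le_of_ne (not_lt.1 h') h)
      rw [mul_assoc, Equiv.swap_mul_self, mul_one] at this
      rw [this]
      simp only [xi_mul_swap, Function.comp_apply, Equiv.swap_apply_left, Equiv.swap_apply_right]
      rw [← neg_sub (xi α m σ i), inv_neg]
      module
  simp only [jackSum, map_sum, TensorProduct.map_tmul]
  rw [Finset.sum_congr rfl fun σ hσ => by rw [h1 σ hσ]]
  simp only [TensorProduct.add_tmul, TensorProduct.tmul_add, Finset.sum_add_distrib,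
    TensorProduct.tmul_smul, TensorProduct.smul_tmul']
  congr 1
  have hs : ∀ (f : Equiv.Perm (Fin N) → State n N),
      (∀ σ ∈ permSet m, m (σ i) = m (σ j) → f σ = 0) → ∑ σ ∈ permSet m, f σ
        = ∑ σ ∈ permSet m with m (σ i) ≠ m (σ j), f σ := by
    intro f hf
    symm
    apply Finset.sum_filter_of_ne
    exact fun σ hσ hne h => hne (hf σ hσ h)
  rw [hs _ fun σ _ h => by rw [if_pos h, zero_smul, TensorProduct.zero_tmul], hs _ fun σ _ h => by rw [if_pos h, zero_smul, TensorProduct.zero_tmul]]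
  -- Reindexing by σ ↦ σ (i,i+1) collects the coefficient of each Φ_σ. It exchanges the two cases of
  -- unequal neighbours, hence the coefficients 1 and 1 - c² as well.
  refine Finset.sum_nbij' (· * Equiv.swap i j) (· * Equiv.swap i j) ?_ ?_ ?_ ?_ ?_
  · intro σ hσ
    rw [Finset.mem_filter] at hσ ⊢
    exact ⟨mul_swap_mem_permSet hm hσ.1 hij hσ.2, by simpa using hσ.2.symm⟩
  · intro σ hσ
    rw [Finset.mem_filter] at hσ ⊢
    exact ⟨mul_swap_mem_permSet hm hσ.1 hij hσ.2, by simpa using hσ.2.symm⟩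
  · intro σ _
    simp [mul_assoc]
  · intro σ _
    simp [mul_assoc]
  · intro σ hσ
    rw [Finset.mem_filter] at hσ
    have e : σ * Equiv.swap i j * Equiv.swap i j = σ := by simp [mul_assoc]
    rw [e]
    congr 2
    simp only [Equiv.Perm.mul_apply, Equiv.swap_apply_left, Equiv.swap_apply_right, xi_mul_swap,
      Function.comp_apply]
    rw [if_neg hσ.2, if_neg (Ne.symm hσ.2)]
    rcases lt_or_gt_of_ne hσ.2 with h | h
    · rw [if_neg h.not_gt, if_pos h]
    · rw [if_pos h, if_neg h.not_gt, ← neg_sub (xi α m σ i), inv_neg, neg_sq]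

theorem permOp_permOp (i j : Fin N) (v : Spin n N) : permOp i j (permOp i j v) = v :=
  LinearMap.congr_fun (permOp_mul_self i j) v

theorem smul_exchange_eq {V : Type*} [AddCommGroup V] [Module ℂ V] (c : ℂ) (x y : V) :
    c • x + -(c • x + y) = -y := by
  abel

theorem smul_exchange_eq_of_neg {V : Type*} [AddCommGroup V] [Module ℂ V] (c : ℂ) (x y : V) :
    c • -(-c • x + y) + (1 - c ^ 2) • x = - -(-c • y + x) := by
  module

/-- Coefficients of Φ_σ are compared, with c = (ξ_i - ξ_j)⁻¹. At equal neighbours c = 1 and the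
condition is P w_σ = -w_σ. For m_{σ(i)} > m_{σ(j)} it reads c P w_σ + P w_{σ(i,j)} = -w_σ; applying
P gives the recursion. The opposite case follows from the recursion because P² = 1. -/
theorem jackSum_fermion_iff (hα : 0 < α) (hm : Antitone m)
    (w : Equiv.Perm (Fin N) → Spin n N) {i j : Fin N} (hij : (i : ℕ) + 1 = j) :
    TensorProduct.map (exchOp i j) (permOp (n := n) i j) (jackSum α m w) = -jackSum α m w ↔
      ∀ σ ∈ permSet m, (m (σ i) = m (σ j) → permOp i j (w σ) = -w σ) ∧
        (m (σ j) < m (σ i) → w (σ * Equiv.swap i j)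
          = -rCheck i j (xi α m σ i - xi α m σ j) (w σ)) := by
  have hneg : -jackSum α m w = jackSum α m fun σ => -w σ := by
    simp [jackSum, TensorProduct.tmul_neg]
  rw [map_exchOp_permOp_jackSum hα hm w hij, hneg, jackSum_inj hα hm]
  have hr : ∀ (c : ℂ) (v : Spin n N), rCheck i j c v = c⁻¹ • v + permOp i j v := fun c v => rfl
  simp only [hr]
  constructor
  · intro H σ hσ
    have := H σ hσ
    refine ⟨fun h => ?_, fun h => ?_⟩
    · have hξ := xi_sub_eq_one (α := α) hm hσ hij h
      rwa [if_pos h, hξ, inv_one, one_smul, zero_smul, add_zero] at this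
    · rw [if_neg h.ne', if_pos h, one_smul] at this
      have := congrArg (permOp i j) this
      rw [map_add, map_smul, permOp_permOp, permOp_permOp, map_neg] at this
      rw [neg_add, ← this]
      abel
  · intro H σ hσ
    split_ifs with h h'
    · have hξ := xi_sub_eq_one (α := α) hm hσ hij h
      rw [hξ, inv_one, one_smul, zero_smul, add_zero, (H σ hσ).1 h]
    · rw [(H σ hσ).2 h', map_neg, map_add, map_smul, permOp_permOp, one_smul]
      exact smul_exchange_eq _ _ _
    · have hσ' := mul_swap_mem_permSet hm hσ hij h
      have := (H _ hσ').2 (by simpa using lt_of_le_of_ne (not_lt.1 h') h)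
      rw [mul_assoc, Equiv.swap_mul_self, mul_one] at this
      simp only [xi_mul_swap, Function.comp_apply, Equiv.swap_apply_left,
        Equiv.swap_apply_right] at this
      rw [← neg_sub (xi α m σ i), inv_neg] at this
      rw [this, map_neg, map_add, map_smul, permOp_permOp]
      exact smul_exchange_eq_of_neg _ _ _

end JackSum


/-! ### Linear maps intertwining matrices of series of operators -/

section Intertwines

variable {n : ℕ} {V V' : Type*} [AddCommMonoid V] [Module ℂ V] [AddCommMonoid V'] [Module ℂ V']

/-- The linear map `J` intertwines the coefficients of two matrices of series of operators. -/
def Intertwines (J : V →ₗ[ℂ] V') (T : Matrix (Fin n) (Fin n) (PowerSeries (Module.End ℂ V)))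
    (T' : Matrix (Fin n) (Fin n) (PowerSeries (Module.End ℂ V'))) : Prop :=
  ∀ a b r v, J (PowerSeries.coeff r (T a b) v) = PowerSeries.coeff r (T' a b) (J v)

theorem coeff_matrix_mul_apply (T S : Matrix (Fin n) (Fin n) (PowerSeries (Module.End ℂ V)))
    (a b : Fin n) (r : ℕ) (v : V) : PowerSeries.coeff r ((T * S) a b) v
      = ∑ c, ∑ p ∈ Finset.HasAntidiagonal.antidiagonal r,
        PowerSeries.coeff p.1 (T a c) (PowerSeries.coeff p.2 (S c b) v) := by
  simp only [Matrix.mul_apply, map_sum, PowerSeries.coeff_mul, LinearMap.sum_apply,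
    Module.End.mul_apply]

theorem coeff_matrix_one_apply (a b : Fin n) (r : ℕ) (v : V) :
    PowerSeries.coeff r ((1 : Matrix (Fin n) (Fin n) (PowerSeries (Module.End ℂ V))) a b) v
      = if a = b ∧ r = 0 then v else 0 := by
  rw [Matrix.one_apply]
  by_cases h : a = b
  · rw [if_pos h, PowerSeries.coeff_one]
    split_ifs <;> simp_all
  · simp [h]

namespace Intertwines

variable {J : V →ₗ[ℂ] V'} {T S : Matrix (Fin n) (Fin n) (PowerSeries (Module.End ℂ V))}
  {T' S' : Matrix (Fin n) (Fin n) (PowerSeries (Module.End ℂ V'))}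

theorem one (J : V →ₗ[ℂ] V') : Intertwines (n := n) J 1 1 := by
  intro a b r v
  rw [coeff_matrix_one_apply, coeff_matrix_one_apply]
  split_ifs <;> simp

theorem mul (hT : Intertwines J T T') (hS : Intertwines J S S') :
    Intertwines J (T * S) (T' * S') := by
  intro a b r v
  rw [coeff_matrix_mul_apply, coeff_matrix_mul_apply, map_sum]
  simp only [map_sum, hT _ _ _ _, hS _ _ _ _]

theorem list_prod_map {β : Type*} (l : List β)
    (f : β → Matrix (Fin n) (Fin n) (PowerSeries (Module.End ℂ V)))
    (f' : β → Matrix (Fin n) (Fin n) (PowerSeries (Module.End ℂ V')))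
    (h : ∀ x ∈ l, Intertwines J (f x) (f' x)) :
    Intertwines J (l.map f).prod (l.map f').prod := by
  induction l with
  | nil => exact one J
  | cons x l ih =>
    rw [List.map_cons, List.map_cons, List.prod_cons, List.prod_cons]
    exact (h x (by simp)).mul (ih fun y hy => h y (by simp [hy]))

theorem list_prod_ofFn {M : ℕ}
    {f : Fin M → Matrix (Fin n) (Fin n) (PowerSeries (Module.End ℂ V))}
    {f' : Fin M → Matrix (Fin n) (Fin n) (PowerSeries (Module.End ℂ V'))}
    (h : ∀ i, Intertwines J (f i) (f' i)) :
    Intertwines J (List.ofFn f).prod (List.ofFn f').prod := by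
  rw [List.ofFn_eq_map, List.ofFn_eq_map]
  exact list_prod_map _ f f' fun i _ => h i

theorem lax {x : Module.End ℂ V} {x' : Module.End ℂ V'} {e : Fin n → Fin n → Module.End ℂ V}
    {e' : Fin n → Fin n → Module.End ℂ V'} (hx : ∀ v, J (x v) = x' (J v))
    (he : ∀ a b v, J (e a b v) = e' a b (J v)) :
    Intertwines J (lax x e) (lax x' e') := by
  intro a b r v
  have hp : ∀ (s : ℕ) v, J ((x ^ s) v) = (x' ^ s) (J v) := by
    intro s
    induction s with
    | zero => intro v; simp
    | succ s ih => intro v; rw [pow_succ, pow_succ, Module.End.mul_apply, ih, hx, Module.End.mul_apply]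
  rcases r with _ | s
  · simp only [SpinCS.lax, Matrix.of_apply, PowerSeries.coeff_mk]
    split_ifs <;> simp
  · simp only [SpinCS.lax, Matrix.of_apply, PowerSeries.coeff_mk, LinearMap.smul_apply, map_smul,
      Module.End.mul_apply, hp, he]

end Intertwines

end Intertwines

/-! ### The map `uMap` as a bijection from W^m onto F^m that intertwines the monodromy -/

section UMap

variable {n N : ℕ} {α : ℝ} {m : Fin N → ℤ}

/-- On a joint eigenvector each d_i in the monodromy matrix can be replaced by its eigenvalue, so f
⊗ · is an intertwiner. -/
theorem stateT_tmul (a b : Fin n) (s : ℕ) {ξ : Fin N → ℂ} {f : Laurent N}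
    (hf : ∀ i, dunkl α i f = ξ i • f) (v : Spin n N) :
    stateT α a b s (f ⊗ₜ[ℂ] v) = f ⊗ₜ[ℂ] PowerSeries.coeff s (laxProd n ξ a b) v := by
  refine Eq.symm (Intertwines.list_prod_ofFn (J := TensorProduct.mk ℂ (Laurent N) (Spin n N) f)
    (fun i => Intertwines.lax (fun v => ?_) fun a b v => ?_) a b s v)
  · simp [hf i, Module.algebraMap_end_apply, TensorProduct.smul_tmul]
  · simp

theorem stateT_uMap (hα : 0 < α) (hm : Antitone m) (a b : Fin n) (s : ℕ) (v : Spin n N) :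
    stateT α a b s (uMap n α m v)
      = uMap n α m (PowerSeries.coeff s (laxProd n (xi α m 1) a b) v) := by
  rw [uMap_eq_jackSum, uMap_eq_jackSum, jackSum, jackSum, map_sum]
  refine Finset.sum_congr rfl fun σ hσ => ?_
  rw [stateT_tmul a b s (isJack_jack hα hm hσ).eigen, rFamily_eq_rOp hα hm hσ, xi_eq_comp,
    ← Module.End.mul_apply, laxProd_mul_rOp (xi_one_injective hα hm), Module.End.mul_apply]

theorem mem_wSpace {v : Spin n N} : v ∈ wSpace n m ↔
    ∀ i j : Fin N, (i : ℕ) + 1 = j → m i = m j → permOp i j v = -v := by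
  simp only [wSpace, Submodule.mem_iInf, LinearMap.mem_ker, LinearMap.add_apply,
    Module.End.one_apply]
  refine forall₂_congr fun i j => ?_
  rw [and_imp]
  refine forall₂_congr fun _ _ => ?_
  exact add_eq_zero_iff_eq_neg

theorem mem_stateComponent {x : State n N} : x ∈ stateComponent n α m ↔
    (∃ w, x = jackSum α m w) ∧ ∀ i j : Fin N, (i : ℕ) + 1 = j →
      TensorProduct.map (exchOp i j) (permOp (n := n) i j) x = -x := by
  rw [stateComponent, Submodule.mem_inf]
  refine and_congr ⟨exists_jackSum, ?_⟩ ?_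
  · rintro ⟨w, rfl⟩
    exact jackSum_mem_range w
  · simp only [fermionSpace, Submodule.mem_iInf, LinearMap.mem_ker, LinearMap.add_apply,
      LinearMap.id_apply]
    refine forall₃_congr fun i j hij => ?_
    exact add_eq_zero_iff_eq_neg

theorem rCheck_one_apply (i j : Fin N) (v : Spin n N) : rCheck i j 1 v = v + permOp i j v := by
  simp [rCheck]

theorem uMap_mem (hα : 0 < α) (hm : Antitone m) {v : Spin n N} (hv : v ∈ wSpace n m) :
    uMap n α m v ∈ stateComponent n α m := by
  have hlam := xi_one_injective hα hm
  rw [uMap_eq_jackSum, mem_stateComponent]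
  refine ⟨⟨_, rfl⟩, fun i j hij => (jackSum_fermion_iff hα hm _ hij).2 fun σ hσ => ⟨fun h => ?_,
    fun h => ?_⟩⟩
  · have h1 := xi_sub_eq_one (α := α) hm hσ hij h
    have h2 : σ i < σ j := Fin.lt_def.2 (by have := permSet_succ_of_eq hm hσ hij h; omega)
    rw [rFamily_eq_rOp hα hm hσ]
    -- The permutation σ (i,j) lies outside S^m, but Ř is defined there as well. It inverts the
    -- labels σ(i), σ(j), which are consecutive with equal values of m, so it annihilates v;
    -- expanding it as -(1 + P_{i,j}) Ř(σ) v gives the antisymmetry.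
    have h3 := rOp_apply_eq_zero hlam (permSet_succ_of_eq hm hσ hij h) h1
      (mem_wSpace.1 hv _ _ (permSet_succ_of_eq hm hσ hij h) h)
      (w := σ * Equiv.swap i j) (by
        have e : ∀ k, (σ * Equiv.swap i j).symm (σ k) = Equiv.swap i j k := by
          intro k
          rw [Equiv.symm_apply_eq]
          simp
        rw [e, e, Equiv.swap_apply_left, Equiv.swap_apply_right]
        exact Fin.lt_def.2 (by omega))
    rw [rOp_mul_swap hlam hij h2, ← xi_eq_xi_one, ← xi_eq_xi_one, h1, LinearMap.neg_apply,
      neg_eq_zero, Module.End.mul_apply, rCheck_one_apply, add_comm] at h3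
    exact eq_neg_of_add_eq_zero_left h3
  · have hσ' := mul_swap_mem_permSet hm hσ hij h.ne'
    rw [rFamily_eq_rOp hα hm hσ, rFamily_eq_rOp hα hm hσ',
      rOp_mul_swap hlam hij (hm.reflect_lt h)]
    rfl

theorem uMap_injective (hα : 0 < α) (hm : Antitone m) : Function.Injective (uMap n α m) := by
  intro v v' h
  rw [uMap_eq_jackSum, uMap_eq_jackSum, jackSum_inj hα hm] at h
  have := h 1 (one_mem_permSet hm)
  rwa [rFamily_eq_rOp hα hm (one_mem_permSet hm), rOp_one (xi_one_injective hα hm)] at this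

theorem exists_uMap_eq (hα : 0 < α) (hm : Antitone m) {x : State n N}
    (hx : x ∈ stateComponent n α m) : ∃ v ∈ wSpace n m, uMap n α m v = x := by
  obtain ⟨⟨w, rfl⟩, hw⟩ := mem_stateComponent.1 hx
  have key : ∀ i j : Fin N, (i : ℕ) + 1 = j → _ := fun i j hij =>
    (jackSum_fermion_iff hα hm w hij).1 (hw i j hij)
  -- The preimage is the component at the identity; the recursion recovers the other components from
  -- it.
  refine ⟨w 1, mem_wSpace.2 fun i j hij h => (key i j hij 1 (one_mem_permSet hm)).1 h, ?_⟩
  rw [uMap_eq_jackSum, jackSum_inj hα hm]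
  intro σ hσ
  rw [rFamily_eq_rOp hα hm hσ]
  induction σ using perm_wf.induction with
  | _ σ ih =>
    by_cases h1 : σ = 1
    · rw [h1, rOp_one (xi_one_injective hα hm)]
      rfl
    · obtain ⟨i, j, hij, hlt⟩ := exists_descent h1
      have hne : m (σ i) ≠ m (σ j) := fun h =>
        hlt.asymm ((mem_permSet_iff_of_antitone hm).1 hσ i j (Fin.lt_def.2 (by omega)) h)
      have hmem := mul_swap_mem_permSet hm hσ hij hne
      have hlt' : m ((σ * Equiv.swap i j) j) < m ((σ * Equiv.swap i j) i) := by
        simpa using lt_of_le_of_ne (hm hlt.le) hne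
      have e1 := (key i j hij _ hmem).2 hlt'
      have e2 := (isRFamily_rOp (n := n) hα hm).step _ hmem i j hij hlt'
      rw [mul_assoc, Equiv.swap_mul_self, mul_one] at e1 e2
      rw [e1, e2, ← ih _ (permKey_lt hij hlt) hmem]
      rfl

/-- The isomorphism `U^m : W^m → F^m`. -/
def uEquiv (n : ℕ) (hα : 0 < α) (hm : Antitone m) : wSpace n m ≃ₗ[ℂ] stateComponent n α m :=
  LinearEquiv.ofBijective ((uMap n α m).restrict fun _ hv => uMap_mem hα hm hv)
    ⟨fun v v' h => Subtype.ext (uMap_injective hα hm (congrArg Subtype.val h)), fun x => by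
      obtain ⟨v, hv, h⟩ := exists_uMap_eq hα hm x.2
      exact ⟨⟨v, hv⟩, Subtype.ext h⟩⟩

theorem uEquiv_apply (hα : 0 < α) (hm : Antitone m) (w : wSpace n m) :
    (uEquiv n hα hm w : State n N) = uMap n α m w := rfl

end UMap


/-! ### Tensor products of subspaces cut out by operators in the factors -/

section SiteKernels

theorem exists_comp_eq_of_ker_le {V W U : Type*} [AddCommGroup V] [Module ℂ V] [AddCommGroup W]
    [Module ℂ W] [AddCommGroup U] [Module ℂ U] (F : V →ₗ[ℂ] W) (f : V →ₗ[ℂ] U)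
    (h : LinearMap.ker F ≤ LinearMap.ker f) : ∃ g : W →ₗ[ℂ] U, g ∘ₗ F = f := by
  obtain ⟨r, hr⟩ := F.rangeRestrict.exists_rightInverse_of_surjective F.range_rangeRestrict
  obtain ⟨g, hg⟩ := LinearMap.exists_extend (f ∘ₗ r)
  refine ⟨g, LinearMap.ext fun v => ?_⟩
  have h1 := LinearMap.congr_fun hg (F.rangeRestrict v)
  have h2 := congrArg Subtype.val (LinearMap.congr_fun hr (F.rangeRestrict v))
  have h3 : r (F.rangeRestrict v) - v ∈ LinearMap.ker f := h (by
    rw [LinearMap.mem_ker, map_sub, sub_eq_zero]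
    exact h2)
  rw [LinearMap.mem_ker, map_sub, sub_eq_zero] at h3
  exact h1.trans h3

theorem exists_projection {V : Type*} [AddCommGroup V] [Module ℂ V] (K : Submodule ℂ V) :
    ∃ π : V →ₗ[ℂ] K, π ∘ₗ K.subtype = LinearMap.id :=
  LinearMap.exists_leftInverse_of_injective K.subtype K.ker_subtype

theorem mapIncl_injective {ι : Type*} {V : ι → Type*} [∀ i, AddCommGroup (V i)]
    [∀ i, Module ℂ (V i)] (K : ∀ i, Submodule ℂ (V i)) :
    Function.Injective (PiTensorProduct.mapIncl K) := by
  choose π hπ using fun i => exists_projection (K i)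
  refine Function.LeftInverse.injective (g := PiTensorProduct.map π) fun x => ?_
  have := LinearMap.congr_fun (PiTensorProduct.map_comp π fun i => (K i).subtype) x
  rw [LinearMap.comp_apply] at this
  rw [PiTensorProduct.mapIncl, ← this]
  simp only [hπ, PiTensorProduct.map_id, LinearMap.id_apply]

variable {ι : Type*} [DecidableEq ι]

theorem map_siteOp {V V' : ι → Type*} [∀ i, AddCommMonoid (V i)] [∀ i, Module ℂ (V i)]
    [∀ i, AddCommMonoid (V' i)] [∀ i, Module ℂ (V' i)] (f : ∀ i, V i →ₗ[ℂ] V' i) (s : ι)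
    (x : Module.End ℂ (V s)) (x' : Module.End ℂ (V' s)) (h : ∀ v, f s (x v) = x' (f s v))
    (v : ⨂[ℂ] i, V i) :
    PiTensorProduct.map f (siteOp s x v) = siteOp s x' (PiTensorProduct.map f v) := by
  suffices h' : PiTensorProduct.map f ∘ₗ siteOp s x = siteOp s x' ∘ₗ PiTensorProduct.map f from
    LinearMap.congr_fun h' v
  refine PiTensorProduct.ext (MultilinearMap.ext fun w => ?_)
  simp only [LinearMap.compMultilinearMap_apply, LinearMap.comp_apply, siteOp_tprod,
    PiTensorProduct.map_tprod]
  congr 1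
  funext i
  by_cases hi : i = s
  · subst hi; simp [h]
  · simp [hi]

theorem map_eq_self_of_siteOp [Fintype ι] {V : ι → Type*} [∀ i, AddCommMonoid (V i)]
    [∀ i, Module ℂ (V i)] (q : ∀ i, Module.End ℂ (V i)) {y : ⨂[ℂ] i, V i}
    (hy : ∀ i, siteOp i (q i) y = y) : PiTensorProduct.map q y = y := by
  have key : ∀ S : Finset ι,
      PiTensorProduct.map (fun i => if i ∈ S then q i else LinearMap.id) y = y := by
    intro S
    induction S using Finset.induction_on with
    | empty => simp [PiTensorProduct.map_id]
    | insert a S ha ih =>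
      conv_rhs => rw [← hy a, ← ih]
      refine LinearMap.congr_fun (f := PiTensorProduct.map _)
        (g := siteOp a (q a) ∘ₗ PiTensorProduct.map _) ?_ y
      refine PiTensorProduct.ext (MultilinearMap.ext fun w => ?_)
      simp only [LinearMap.compMultilinearMap_apply, LinearMap.comp_apply, siteOp_tprod,
        PiTensorProduct.map_tprod]
      congr 1
      funext i
      by_cases hi : i = a
      · subst hi; simp [ha]
      · simp [hi, Finset.mem_insert]
  simpa using key Finset.univ

variable {V : ι → Type*} [∀ i, AddCommGroup (V i)] [∀ i, Module ℂ (V i)]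

/-- If π_i is a projection onto K_i, then 1 - π_i vanishes on the joint kernel of the f i k, so 1 =
π_i + ∑ g_k f_{i,k} for suitable g_k. Acting in the i-th factor of y, this shows that π_i fixes y,
and applying all π_i exhibits y in the tensor product of the K_i. -/
theorem mem_range_mapIncl [Fintype ι] {κ : ι → Type*} [∀ i, Fintype (κ i)]
    (f : ∀ i, κ i → Module.End ℂ (V i)) (K : ∀ i, Submodule ℂ (V i))
    (hK : ∀ i v, (∀ k, f i k v = 0) → v ∈ K i) {y : ⨂[ℂ] i, V i}
    (hy : ∀ i k, siteOp i (f i k) y = 0) : y ∈ LinearMap.range (PiTensorProduct.mapIncl K) := by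
  classical
  choose π hπ using fun i => exists_projection (K i)
  have hq : ∀ i, siteOp i ((K i).subtype ∘ₗ π i) y = y := by
    intro i
    obtain ⟨g, hg⟩ := exists_comp_eq_of_ker_le (LinearMap.pi (f i))
      (LinearMap.id - (K i).subtype ∘ₗ π i) (by
        intro v hv
        have hv' := hK i v fun k => congrFun (LinearMap.mem_ker.1 hv) k
        have := congrArg Subtype.val (LinearMap.congr_fun (hπ i) ⟨v, hv'⟩)
        rw [LinearMap.mem_ker, LinearMap.sub_apply, sub_eq_zero]
        exact this.symm)
    have h1 : (1 : Module.End ℂ (V i)) = (K i).subtype ∘ₗ π i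
        + ∑ k, (g ∘ₗ LinearMap.single ℂ (fun _ => V i) k) * f i k := by
      have h2 : ∑ k, (g ∘ₗ LinearMap.single ℂ (fun _ => V i) k) * f i k
          = g ∘ₗ LinearMap.pi (f i) := by
        refine LinearMap.ext fun v => ?_
        simp only [LinearMap.sum_apply, Module.End.mul_apply, LinearMap.comp_apply,
          LinearMap.single_apply, ← map_sum]
        congr 1
        exact Finset.univ_sum_single (LinearMap.pi (f i) v)
      rw [h2, hg]
      exact (add_sub_cancel _ _).symm
    have h3 := congrArg (fun x => siteOp i x y) h1
    simp only [map_one, map_add, map_sum, map_mul, LinearMap.add_apply, LinearMap.sum_apply,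
      Module.End.mul_apply, Module.End.one_apply, hy, map_zero, Finset.sum_const_zero,
      add_zero] at h3
    exact h3.symm
  refine ⟨PiTensorProduct.map π y, ?_⟩
  have := LinearMap.congr_fun (PiTensorProduct.map_comp (fun i => (K i).subtype) π) y
  rw [LinearMap.comp_apply] at this
  rw [PiTensorProduct.mapIncl, ← this]
  exact map_eq_self_of_siteOp _ hq

end SiteKernels

/-! ### Antisymmetric tensors and fusion -/

section Fusion

variable {n p : ℕ}

theorem mem_fundSpace {v : Spin n p} : v ∈ fundSpace n p ↔
    ∀ i j : Fin p, (i : ℕ) + 1 = j → permOp i j v = -v := by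
  simp only [fundSpace, Submodule.mem_iInf, LinearMap.mem_ker, LinearMap.add_apply,
    Module.End.one_apply]
  exact forall₃_congr fun i j _ => add_eq_zero_iff_eq_neg

/-- Induction on the distance of the positions: conjugating a shorter transposition by an adjacent
one gives (i,j), and three sign changes make one. -/
theorem permOp_apply_of_mem_fundSpace {v : Spin n p} (hv : v ∈ fundSpace n p) {i j : Fin p}
    (hij : i ≠ j) : permOp i j v = -v := by
  rw [mem_fundSpace] at hv
  have key : ∀ (d : ℕ) (i j : Fin p), (i : ℕ) + d + 1 = j → permOp i j v = -v := by
    intro d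
    induction d with
    | zero => exact fun i j h => hv i j h
    | succ d ih =>
      intro i j h
      have hk : (i : ℕ) + d + 1 < p := by omega
      set k : Fin p := ⟨i + d + 1, hk⟩ with hkd
      have h1 := ih i k rfl
      have h2 := hv k j (by rw [← h]; rfl)
      have nik : i ≠ k := by intro e; have := congrArg Fin.val e; simp [hkd] at this; omega
      have nij : i ≠ j := by rintro rfl; omega
      have h3 := permOp_mul_permOp_mul_permOp (n := n) k j i k
      rw [Equiv.swap_apply_left, Equiv.swap_apply_of_ne_of_ne nik nij] at h3
      rw [← h3, Module.End.mul_apply, Module.End.mul_apply, h2, map_neg, h1, neg_neg, h2]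
  rcases lt_or_gt_of_ne hij with h | h
  · exact key (j - i - 1) i j (by rw [Fin.lt_def] at h; omega)
  · rw [permOp_symm]
    exact key (i - j - 1) j i (by rw [Fin.lt_def] at h; omega)

theorem intertwines_fundSpace (n p : ℕ) (h : ℂ) :
    Intertwines (fundSpace n p).subtype (lax (algebraMap ℂ _ h) (fundGl n p))
      (laxProd n fun k : Fin p => h - (k : ℕ)) := by
  intro a b r v
  have h1 : Intertwines (fundSpace n p).subtype (lax (algebraMap ℂ _ h) (fundGl n p))
      (lax (algebraMap ℂ _ h) glOp) :=
    Intertwines.lax (fun v => by simp [Module.algebraMap_end_apply]) fun a b v => rfl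
  rw [h1]
  -- Fusion is stated for an operator q with antisymmetric values; a projection onto the
  -- antisymmetric tensors serves as q and fixes v.
  obtain ⟨π, hπ⟩ := exists_projection (V := Spin n p) (fundSpace n p)
  have h2 := LinearMap.congr_fun (laxProd_mul_of_antisymm h ((fundSpace n p).subtype ∘ₗ π)
    (fun i j hij => LinearMap.ext fun w => permOp_apply_of_mem_fundSpace (π w).2 hij) a b r) v
  have h3 : ((fundSpace n p).subtype ∘ₗ π) v = (fundSpace n p).subtype v :=
    congrArg Subtype.val (LinearMap.congr_fun hπ v)
  rw [Module.End.mul_apply, Module.End.mul_apply, h3] at h2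
  exact h2.symm

end Fusion

/-! ### Concatenation of tensors -/

section Concat

variable {n N : ℕ} (c : Composition N)

theorem concat_tprod_embedding (w : ∀ s : Fin c.length, Fin (c.blocksFun s) → Fin n → ℂ)
    {w' : Fin N → Fin n → ℂ} (h : ∀ s j, w' (c.embedding s j) = w s j) :
    concat n c (PiTensorProduct.tprod ℂ fun s => PiTensorProduct.tprod ℂ (w s))
      = PiTensorProduct.tprod ℂ w' := by
  rw [concat_tprod]
  congr 1
  funext i
  rw [← h, c.embedding_comp_inv]

theorem embedding_eq_iff {s t : Fin c.length} {j : Fin (c.blocksFun s)} {k : Fin (c.blocksFun t)} :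
    c.embedding s j = c.embedding t k ↔ (⟨s, j⟩ : Σ s, Fin (c.blocksFun s)) = ⟨t, k⟩ :=
  (c.blocksFinEquiv.apply_eq_iff_eq (x := ⟨s, j⟩) (y := ⟨t, k⟩))

theorem exists_embedding_eq (i : Fin N) : ∃ s j, c.embedding s j = i :=
  ⟨_, _, c.embedding_comp_inv i⟩

theorem blocks_ext {V : Type*} [AddCommMonoid V] [Module ℂ V]
    {f g : (⨂[ℂ] s : Fin c.length, Spin n (c.blocksFun s)) →ₗ[ℂ] V}
    (h : ∀ w : ∀ s : Fin c.length, Fin (c.blocksFun s) → Fin n → ℂ,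
      f (PiTensorProduct.tprod ℂ fun s => PiTensorProduct.tprod ℂ (w s))
        = g (PiTensorProduct.tprod ℂ fun s => PiTensorProduct.tprod ℂ (w s))) : f = g := by
  refine (Basis.piTensorProduct fun s : Fin c.length =>
    Basis.piTensorProduct fun _ : Fin (c.blocksFun s) => Pi.basisFun ℂ (Fin n)).ext fun ε => ?_
  simp only [Basis.piTensorProduct_apply]
  exact h _

theorem apply_index_embedding {M : Type*} (w : ∀ s : Fin c.length, Fin (c.blocksFun s) → M)
    (t : Fin c.length) (k : Fin (c.blocksFun t)) :
    w (c.index (c.embedding t k)) (c.invEmbedding (c.embedding t k)) = w t k :=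
  congrArg (fun y : Σ s : Fin c.length, Fin (c.blocksFun s) => w y.1 y.2)
    (c.blocksFinEquiv.symm_apply_apply ⟨t, k⟩)

theorem concat_siteOp_siteOp (s : Fin c.length) (j : Fin (c.blocksFun s))
    (f : Module.End ℂ (Fin n → ℂ)) (x : ⨂[ℂ] s : Fin c.length, Spin n (c.blocksFun s)) :
    concat n c (siteOp s (siteOp j f) x) = siteOp (c.embedding s j) f (concat n c x) := by
  suffices h : (concat n c).toLinearMap ∘ₗ siteOp s (siteOp j f)
      = siteOp (c.embedding s j) f ∘ₗ (concat n c).toLinearMap from LinearMap.congr_fun h x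
  refine blocks_ext c fun w => ?_
  simp only [LinearMap.comp_apply, LinearEquiv.coe_coe, siteOp_tprod]
  have h1 : Function.update (fun s => PiTensorProduct.tprod ℂ (w s)) s
        (PiTensorProduct.tprod ℂ (Function.update (w s) j (f (w s j))))
      = fun t => PiTensorProduct.tprod ℂ
        (Function.update w s (Function.update (w s) j (f (w s j))) t) := by
    funext t
    by_cases ht : t = s
    · subst ht; simp
    · simp [ht]
  rw [h1, concat_tprod n c w, siteOp_tprod]
  refine concat_tprod_embedding c _ fun t k => ?_
  rw [apply_index_embedding c w]
  by_cases ht : t = s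
  · subst ht
    rw [Function.update_self]
    by_cases hk : k = j
    · subst hk; simp
    · rw [Function.update_of_ne hk, Function.update_of_ne ((c.embedding t).injective.ne hk),
        apply_index_embedding c w]
  · rw [Function.update_of_ne ht, Function.update_of_ne, apply_index_embedding c w]
    intro e
    exact ht (congrArg Sigma.fst ((embedding_eq_iff c).1 e))

theorem concat_siteOp_permOp (s : Fin c.length) (j j' : Fin (c.blocksFun s))
    (x : ⨂[ℂ] s : Fin c.length, Spin n (c.blocksFun s)) :
    concat n c (siteOp s (permOp j j') x)
      = permOp (c.embedding s j) (c.embedding s j') (concat n c x) := by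
  suffices h : (concat n c).toLinearMap ∘ₗ siteOp s (permOp j j')
      = permOp (c.embedding s j) (c.embedding s j') ∘ₗ (concat n c).toLinearMap from
    LinearMap.congr_fun h x
  refine blocks_ext c fun w => ?_
  simp only [LinearMap.comp_apply, LinearEquiv.coe_coe, siteOp_tprod, permOp_tprod]
  have h1 : Function.update (fun s => PiTensorProduct.tprod ℂ (w s)) s
        (PiTensorProduct.tprod ℂ fun k => w s (Equiv.swap j j' k))
      = fun t => PiTensorProduct.tprod ℂ
        (Function.update w s (fun k => w s (Equiv.swap j j' k)) t) := by
    funext t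
    by_cases ht : t = s
    · subst ht; simp
    · simp [ht]
  rw [h1, concat_tprod n c w, permOp_tprod]
  refine concat_tprod_embedding c _ fun t k => ?_
  by_cases ht : t = s
  · subst ht
    rw [Function.update_self, (c.embedding t).injective.swap_apply, apply_index_embedding c w]
  · rw [Function.update_of_ne ht, Equiv.swap_apply_of_ne_of_ne, apply_index_embedding c w]
    · exact fun e => ht (congrArg Sigma.fst ((embedding_eq_iff c).1 e))
    · exact fun e => ht (congrArg Sigma.fst ((embedding_eq_iff c).1 e))

theorem list_ofFn_eq_flatten {β : Type*} (g : Fin N → β) :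
    List.ofFn g
      = (List.ofFn fun s : Fin c.length => List.ofFn fun j => g (c.embedding s j)).flatten := by
  obtain ⟨l, hl⟩ : ∃ l, l = List.ofFn g := ⟨_, rfl⟩
  have hN : l.length = N := by simp [hl]
  subst hN
  conv_lhs => rw [← hl, ← List.flatten_splitWrtComposition l c]
  congr 1
  refine List.ext_getElem (by simp) fun s h1 h2 => ?_
  rw [List.getElem_splitWrtComposition, List.getElem_ofFn]
  have h3 : s < c.length := by simpa using h2
  have h4 := c.sizeUpTo_succ h3
  have h5 := c.sizeUpTo_le (s + 1)
  refine List.ext_getElem ?_ fun j h6 h7 => ?_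
  · simp only [List.length_drop, List.length_take, List.length_ofFn, Composition.blocksFun,
      List.get_eq_getElem]
    omega
  · have h8 : ∀ i : Fin l.length, l[i] = g i := by
      intro i
      exact (List.getElem_of_eq hl i.2).trans (List.getElem_ofFn _)
    rw [List.getElem_drop, List.getElem_take, List.getElem_ofFn, ← h8]
    simp [Composition.coe_embedding]

end Concat


/-! ### The blocks of a weakly decreasing sequence -/

section Blocks

variable {N : ℕ} {m : Fin N → ℤ}

theorem sum_map_card_eq (m : Fin N → ℤ) {l : List ℤ} (hl : l.Nodup) :
    (l.map fun x => Finset.card {k | m k = x}).sum = Finset.card {k | m k ∈ l} := by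
  rw [← List.sum_toFinset _ hl, Finset.card_eq_sum_card_fiberwise (f := m) (t := l.toFinset)]
  · refine Finset.sum_congr rfl fun x hx => ?_
    congr 1
    ext k
    simp only [Finset.mem_filter, Finset.mem_univ, true_and]
    exact ⟨fun h => ⟨h ▸ List.mem_toFinset.1 hx, h⟩, fun h => h.2⟩
  · intro k hk
    simpa using hk

/-- For weakly decreasing m the positions with value above x form an initial segment. This locates
the blocks by counting. -/
theorem lt_card_iff (hm : Antitone m) (x : ℤ) (k : Fin N) :
    (k : ℕ) < Finset.card {l | x < m l} ↔ x < m k := by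
  constructor
  · intro h
    by_contra hk
    have : ({l | x < m l} : Finset (Fin N)) ⊆ Finset.Iio k := by
      intro l hl
      rw [Finset.mem_filter] at hl
      rw [Finset.mem_Iio]
      exact hm.reflect_lt (lt_of_le_of_lt (not_lt.1 hk) hl.2)
    have := Finset.card_le_card this
    rw [Fin.card_Iio] at this
    omega
  · intro h
    have : Finset.Iic k ⊆ ({l | x < m l} : Finset (Fin N)) := by
      intro l hl
      rw [Finset.mem_Iic] at hl
      exact Finset.mem_filter.2 ⟨Finset.mem_univ _, h.trans_le (hm hl)⟩
    have := Finset.card_le_card this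
    rw [Fin.card_Iic] at this
    omega

/-- The distinct values of `m`, in decreasing order. -/
def valueList (m : Fin N → ℤ) : List ℤ := (Finset.univ.image m).sort (fun x y => x ≥ y)

theorem valueList_pairwise (m : Fin N → ℤ) : (valueList m).Pairwise (· > ·) :=
  (Finset.sortedGT_sort _).pairwise

theorem length_multiplicities (m : Fin N → ℤ) : (multiplicities m).length = (valueList m).length :=
  List.length_map _

/-- The common value of `m` on the `s`-th block. -/
def blockValue (m : Fin N → ℤ) (s : Fin (multiplicities m).length) : ℤ :=
  (valueList m)[(s : ℕ)]'(by rw [← length_multiplicities]; exact s.2)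

theorem mem_valueList (m : Fin N → ℤ) (k : Fin N) : m k ∈ valueList m := by
  simp [valueList]

theorem blockValue_strictAnti (m : Fin N → ℤ) : StrictAnti (blockValue m) := by
  intro s t h
  exact List.pairwise_iff_getElem.1 (valueList_pairwise m) _ _ _ _ h

theorem exists_blockValue (m : Fin N → ℤ) (k : Fin N) : ∃ s, blockValue m s = m k := by
  obtain ⟨s, hs, h⟩ := List.getElem_of_mem (mem_valueList m k)
  exact ⟨⟨s, by rwa [length_multiplicities]⟩, h⟩

theorem sizeUpTo_multiplicities (m : Fin N → ℤ) (s : ℕ) :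
    (multiplicities m).sizeUpTo s = Finset.card {k | m k ∈ (valueList m).take s} := by
  rw [Composition.sizeUpTo, ← sum_map_card_eq m ((valueList_pairwise m).imp ne_of_gt |>.sublist (List.take_sublist _ _)),
    List.map_take]
  rfl

theorem sizeUpTo_eq_card_lt (m : Fin N → ℤ) (s : Fin (multiplicities m).length) :
    (multiplicities m).sizeUpTo s = Finset.card {k | blockValue m s < m k} := by
  rw [sizeUpTo_multiplicities]
  congr 1
  ext k
  simp only [Finset.mem_filter, Finset.mem_univ, true_and, List.mem_take_iff_getElem]
  constructor
  · rintro ⟨t, ht, h⟩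
    rw [← h]
    exact List.pairwise_iff_getElem.1 (valueList_pairwise m) _ _ _ _ (by omega)
  · intro h
    obtain ⟨t, ht⟩ := exists_blockValue m k
    rw [← ht, (blockValue_strictAnti m).lt_iff_gt] at h
    have := length_multiplicities m
    exact ⟨t, by rw [Fin.lt_def] at h; omega, ht⟩

/-- The condition blockValue ≤ m k is written as a strict inequality between integers so that
`lt_card_iff` applies to the right end of the block too. -/
theorem sizeUpTo_succ_eq_card_le (m : Fin N → ℤ) (s : Fin (multiplicities m).length) :
    (multiplicities m).sizeUpTo (s + 1) = Finset.card {k | blockValue m s - 1 < m k} := by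
  rw [sizeUpTo_multiplicities]
  congr 1
  ext k
  simp only [Finset.mem_filter, Finset.mem_univ, true_and, List.mem_take_iff_getElem,
    Int.sub_one_lt_iff]
  constructor
  · rintro ⟨t, ht, h⟩
    rw [← h]
    have ht' : t < (multiplicities m).length := by rw [length_multiplicities]; omega
    exact (blockValue_strictAnti m).antitone (a := ⟨t, ht'⟩) (b := s) (Fin.le_def.2 (by simp; omega))
  · intro h
    obtain ⟨t, ht⟩ := exists_blockValue m k
    rw [← ht, (blockValue_strictAnti m).le_iff_ge] at h
    have := length_multiplicities m
    exact ⟨t, by rw [Fin.le_def] at h; omega, ht⟩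

theorem apply_embedding_multiplicities (hm : Antitone m) (s : Fin (multiplicities m).length)
    (j : Fin ((multiplicities m).blocksFun s)) :
    m ((multiplicities m).embedding s j) = blockValue m s := by
  have h1 := (lt_card_iff hm (blockValue m s) ((multiplicities m).embedding s j)).not
  have h2 := lt_card_iff hm (blockValue m s - 1) ((multiplicities m).embedding s j)
  rw [← sizeUpTo_eq_card_lt, Composition.coe_embedding] at h1
  rw [← sizeUpTo_succ_eq_card_le, Composition.coe_embedding, Composition.sizeUpTo_succ'] at h2
  have h3 := h1.1 (by omega)
  have h4 := h2.1 (by omega)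
  omega

/-- Within a block m is constant and only the position grows, so the parameters are h, h - 1, …, as
fusion requires. -/
theorem xi_embedding (hm : Antitone m) (α : ℝ) (s : Fin (multiplicities m).length)
    (j : Fin ((multiplicities m).blocksFun s)) :
    xi α m 1 ((multiplicities m).embedding s j) = blockShift α m s - (j : ℕ) := by
  simp only [blockShift, xi, Equiv.Perm.one_apply, apply_embedding_multiplicities hm,
    Composition.coe_embedding]
  push_cast
  ring

theorem mem_wSpace_iff_blocks {n : ℕ} (hm : Antitone m) {v : Spin n N} : v ∈ wSpace n m ↔
    ∀ s, ∀ j j' : Fin ((multiplicities m).blocksFun s), (j : ℕ) + 1 = j' →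
      permOp ((multiplicities m).embedding s j) ((multiplicities m).embedding s j') v = -v := by
  rw [mem_wSpace]
  constructor
  · intro h s j j' hj
    refine h _ _ ?_ ?_
    · rw [Composition.coe_embedding, Composition.coe_embedding]
      omega
    · rw [apply_embedding_multiplicities hm, apply_embedding_multiplicities hm]
  · intro h i i' hi hmi
    obtain ⟨s, j, rfl⟩ := exists_embedding_eq (multiplicities m) i
    obtain ⟨t, j', rfl⟩ := exists_embedding_eq (multiplicities m) i'
    rw [apply_embedding_multiplicities hm, apply_embedding_multiplicities hm] at hmi
    obtain rfl := (blockValue_strictAnti m).injective hmi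
    rw [Composition.coe_embedding, Composition.coe_embedding] at hi
    exact h s j j' (by omega)

end Blocks

/-! ### The tensor product of fundamental modules inside `(ℂ^n)^{⊗ N}` -/

section FundEmbedding

variable {n N : ℕ} {α : ℝ} {m : Fin N → ℤ}

theorem Intertwines.comp {V V' V'' : Type*} [AddCommMonoid V] [Module ℂ V] [AddCommMonoid V']
    [Module ℂ V'] [AddCommMonoid V''] [Module ℂ V''] {J : V →ₗ[ℂ] V'} {J' : V' →ₗ[ℂ] V''}
    {T : Matrix (Fin n) (Fin n) (PowerSeries (Module.End ℂ V))}
    {T' : Matrix (Fin n) (Fin n) (PowerSeries (Module.End ℂ V'))}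
    {T'' : Matrix (Fin n) (Fin n) (PowerSeries (Module.End ℂ V''))}
    (h' : Intertwines J' T' T'') (h : Intertwines J T T') : Intertwines (J' ∘ₗ J) T T'' := by
  intro a b r v
  rw [LinearMap.comp_apply, h, h', LinearMap.comp_apply]

/-- A matrix of series of operators acting in the `s`-th tensor factor. -/
def siteMatrix (n : ℕ) {ι : Type*} [DecidableEq ι] {V : ι → Type*} [∀ i, AddCommMonoid (V i)]
    [∀ i, Module ℂ (V i)] (s : ι) : Matrix (Fin n) (Fin n) (PowerSeries (Module.End ℂ (V s))) →+*
      Matrix (Fin n) (Fin n) (PowerSeries (Module.End ℂ (⨂[ℂ] i, V i))) :=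
  (PowerSeries.map (siteOp (V := V) s : Module.End ℂ (V s) →+* _)).mapMatrix

theorem coeff_siteMatrix {ι : Type*} [DecidableEq ι] {V : ι → Type*} [∀ i, AddCommMonoid (V i)]
    [∀ i, Module ℂ (V i)] (s : ι) (T : Matrix (Fin n) (Fin n) (PowerSeries (Module.End ℂ (V s))))
    (a b : Fin n) (r : ℕ) : PowerSeries.coeff r (siteMatrix n (V := V) s T a b)
      = siteOp s (PowerSeries.coeff r (T a b)) := by
  simp [siteMatrix]

theorem siteMatrix_lax {ι : Type*} [DecidableEq ι] {V : ι → Type*} [∀ i, AddCommMonoid (V i)]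
    [∀ i, Module ℂ (V i)] (s : ι) (x : Module.End ℂ (V s)) (e : Fin n → Fin n → Module.End ℂ (V s)) :
    siteMatrix n (V := V) s (lax x e) = lax (siteOp s x) fun a b => siteOp s (e a b) := by
  refine Matrix.ext fun a b => PowerSeries.ext fun r => ?_
  rw [coeff_siteMatrix]
  rcases r with _ | r
  · simp only [lax, Matrix.of_apply, PowerSeries.coeff_mk]
    split_ifs <;> simp
  · simp [lax]

theorem intertwines_concat (c : Composition N) (s : Fin c.length) (ξ : Fin N → ℂ) :
    Intertwines (concat n c).toLinearMap
      (siteMatrix n (V := fun s => Spin n (c.blocksFun s)) s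
        (laxProd n fun j => ξ (c.embedding s j)))
      (List.ofFn fun j => lax (algebraMap ℂ _ (ξ (c.embedding s j)))
        (unitOp (c.embedding s j))).prod := by
  rw [laxProd, map_list_prod, List.map_ofFn]
  refine Intertwines.list_prod_ofFn fun j => ?_
  rw [Function.comp_apply, siteMatrix_lax]
  refine Intertwines.lax (fun v => ?_) fun a b v => concat_siteOp_siteOp c s j _ v
  rw [AlgHom.commutes]
  simp [Module.algebraMap_end_apply]

theorem laxProd_eq_prod_blocks (c : Composition N) (ξ : Fin N → ℂ) :
    laxProd n ξ = (List.ofFn fun s => (List.ofFn fun j => lax (algebraMap ℂ _ (ξ (c.embedding s j)))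
      (unitOp (c.embedding s j))).prod).prod := by
  rw [laxProd, list_ofFn_eq_flatten c, List.prod_flatten, List.map_ofFn]
  rfl

/-- The product over all sites is grouped by blocks; each block fuses on antisymmetric tensors to
the factor V_p(h). The ordered product of the blocks is the matrix product defining the iterated
coproduct. -/
theorem fundEmbedding_fundTensorModule (hm : Antitone m) (a b : Fin n) (r : ℕ)
    (x : FundTensor n m) : fundEmbedding n m (fundTensorModule n α m (yT a b r) x)
      = PowerSeries.coeff r (laxProd n (xi α m 1) a b) (fundEmbedding n m x) := by
  have key : Intertwines (fundEmbedding n m)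
      (List.ofFn fun s => seriesOf ((siteOp (V := fun s => fundSpace n ((multiplicities m).blocksFun s))
        s).comp (fundModule n ((multiplicities m).blocksFun s) (blockShift α m s)))).prod
      (laxProd n (xi α m 1)) := by
    rw [laxProd_eq_prod_blocks (multiplicities m)]
    refine Intertwines.list_prod_ofFn fun s => (intertwines_concat _ s _).comp ?_
    intro a b r v
    simp only [seriesOf, Matrix.of_apply, PowerSeries.coeff_mk, AlgHom.comp_apply, fundModule,
      yangianLift_yT, coeff_siteMatrix, xi_embedding hm]
    exact map_siteOp _ s _ _ (fun v => intertwines_fundSpace n _ _ a b r v) v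
  rw [fundTensorModule, tensorModule, yangianLift_yT]
  exact key a b r x

theorem fundEmbedding_injective : Function.Injective (fundEmbedding n m) :=
  (concat n (multiplicities m)).injective.comp
    (mapIncl_injective (V := fun s => Spin n ((multiplicities m).blocksFun s)) _)

theorem range_fundEmbedding (hm : Antitone m) :
    LinearMap.range (fundEmbedding n m) = wSpace n m := by
  ext v
  rw [mem_wSpace_iff_blocks hm]
  constructor
  · rintro ⟨x, rfl⟩ s j j' hj
    rw [fundEmbedding, LinearMap.comp_apply, LinearEquiv.coe_coe, ← concat_siteOp_permOp]
    -- Antisymmetry in block s says that P_{j,j'} restricts there to the scalar -1, which is then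
    -- pulled out of the tensor product.
    have := map_siteOp (fun s => (fundSpace n ((multiplicities m).blocksFun s)).subtype) s
      (algebraMap ℂ _ (-1)) (permOp j j') (fun v => by
        refine Eq.trans ?_ (mem_fundSpace.1 v.2 j j' hj).symm
        rw [Module.algebraMap_end_apply, map_smul]
        exact neg_one_smul ℂ (v.1 : Spin n ((multiplicities m).blocksFun s))) x
    rw [PiTensorProduct.mapIncl, ← this, AlgHom.commutes, Module.algebraMap_end_apply, map_smul,
      map_smul]
    exact neg_one_smul ℂ (_ : Spin n N)
  · intro h
    obtain ⟨y, rfl⟩ := (concat n (multiplicities m)).surjective v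
    have hy := mem_range_mapIncl (V := fun s => Spin n ((multiplicities m).blocksFun s))
      (κ := fun s => {q : Fin ((multiplicities m).blocksFun s) ×
        Fin ((multiplicities m).blocksFun s) // (q.1 : ℕ) + 1 = q.2})
      (fun s q => permOp q.1.1 q.1.2 + 1)
      (fun s => fundSpace n ((multiplicities m).blocksFun s)) (fun s v hv =>
        mem_fundSpace.2 fun i j hij => add_eq_zero_iff_eq_neg.1 (hv ⟨(i, j), hij⟩))
      (y := y) (fun s q => by
        have := h s q.1.1 q.1.2 q.2
        rw [← concat_siteOp_permOp, ← map_neg] at this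
        rw [map_add, map_one, LinearMap.add_apply, (concat n _).injective this,
          Module.End.one_apply, neg_add_cancel])
    obtain ⟨x, hx⟩ := hy
    exact ⟨x, by rw [fundEmbedding, LinearMap.comp_apply, hx]; rfl⟩

/-- The identification of `V_{p_1} ⊗ ⋯ ⊗ V_{p_M}` with `W^m` by concatenation of tensors. -/
def fundEquiv (n : ℕ) (hm : Antitone m) : FundTensor n m ≃ₗ[ℂ] wSpace n m :=
  LinearEquiv.ofInjective (fundEmbedding n m) fundEmbedding_injective ≪≫ₗ
    LinearEquiv.ofEq _ _ (range_fundEmbedding hm)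

theorem fundEquiv_apply (hm : Antitone m) (x : FundTensor n m) :
    (fundEquiv n hm x : Spin n N) = fundEmbedding n m x := rfl

end FundEmbedding

end

end SpinCS

/-! ### The main theorem -/

theorem mainTheorem3 (n N : ℕ) (α : ℝ) (hα : 0 < α) (m : Fin N → ℤ) (hm : Antitone m) :
    -- the non-symmetric Jack polynomials and the operators `Ř(σ)`, `σ ∈ S^m`, are well defined
    (∀ σ ∈ permSet m, ∃! f, IsJack α m σ f) ∧
    (∃ R : Equiv.Perm (Fin N) → Module.End ℂ (Spin n N), IsRFamily α m R ∧
      ∀ R', IsRFamily α m R' → ∀ σ ∈ permSet m, R' σ = R σ) ∧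
    -- `U^m` maps `W^m` to `F^m`
    (∀ v ∈ wSpace n m, uMap n α m v ∈ stateComponent n α m) ∧
    ∃ (ρF : Yangian n →ₐ[ℂ] Module.End ℂ (stateComponent n α m))
      (ι : FundTensor n m ≃ₗ[ℂ] wSpace n m)
      (U : wSpace n m ≃ₗ[ℂ] stateComponent n α m),
      -- `F^m` is invariant under the operators `T̂`, which make it a Yangian module
      (∀ a b s x, (ρF (yT a b s) x : State n N) = stateT α a b s x) ∧
      -- concatenation of tensors identifies `V_{p_1} ⊗ ⋯ ⊗ V_{p_M}` with `W^m`
      (∀ x, (ι x : Spin n N) = fundEmbedding n m x) ∧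
      -- `U^m` restricts to a linear isomorphism of `W^m` onto `F^m`
      (∀ w, (U w : State n N) = uMap n α m w) ∧
      -- which intertwines the actions of the Yangian
      (∀ y x, U (ι (fundTensorModule n α m y x)) = ρF y (U (ι x))) := by
  refine ⟨fun σ hσ => existsUnique_isJack hα hm hσ, ⟨_, isRFamily_rOp hα hm, fun R' hR' σ hσ =>
    hR'.eq_rOp hα hm hσ⟩, fun v hv => uMap_mem hα hm hv,
    ((fundEquiv n hm ≪≫ₗ uEquiv n hα hm).conjAlgEquiv ℂ).toAlgHom.comp (fundTensorModule n α m),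
    fundEquiv n hm, uEquiv n hα hm, fun a b s x => ?_, fundEquiv_apply hm, uEquiv_apply hα hm,
    fun y x => ?_⟩
  -- The action on F^m is the conjugate of the tensor product action, so it is a module by
  -- construction. That it is given by T̂ is checked on vectors U(ι x), using that both ι and U
  -- intertwine with the product of Lax factors for ξ(id).
  · obtain ⟨x, rfl⟩ := (fundEquiv n hm ≪≫ₗ uEquiv n hα hm).surjective x
    have h : ((fundEquiv n hm ≪≫ₗ uEquiv n hα hm).conjAlgEquiv ℂ).toAlgHom.comp
        (fundTensorModule n α m) (yT a b s) ((fundEquiv n hm ≪≫ₗ uEquiv n hα hm) x)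
        = uEquiv n hα hm (fundEquiv n hm (fundTensorModule n α m (yT a b s) x)) := by
      simp [LinearEquiv.conjAlgEquiv_apply]
    rw [h, uEquiv_apply, fundEquiv_apply, fundEmbedding_fundTensorModule hm, ← stateT_uMap hα hm]
    rfl
  · simp [LinearEquiv.conjAlgEquiv_apply]
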